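/- For a CNF formula $\phi$ let $|\phi|$ be its number of clauses plus its number of variables. Its incidence graph $G_\phi$ is the bipartite graph on the variables and clauses of $\phi$ in which a variable $x$ and a clause $C$ are adjacent iff $x$ occurs (negated or not) in $C$. Consider inputs $(\phi,(T,X))$ that consist of a CNF formula $\phi$ and a tree decomposition $(T,X)$ of $G_\phi$ that is nice: the tree $T$ has maximal degree at most $3$ and $O((\mathcal{TW}(\phi)+1)(|\phi|+1))$ nodes, where $\mathcal{TW}(\phi)$ denotes the width of the given decomposition $(T,X)$ (the maximal size of a bag minus one, read as $0$ if $\phi$ is empty). Let $d=\max\{2,\Delta(T)\}\in\{2,3\}$, where $\Delta(T)$ is the maximal degree of $T$. For every $\varepsilon'>0$ there are a constant $\delta<1$ and a deterministic algorithm which, on every such input, decides whether $\phi$ is satisfiable and simultaneously runs in space $O^*\big(2^{\varepsilon'\mathcal{TW}(\phi)}\big)$ and in time $O^*\big(d^{\,\delta\,\mathcal{TW}(\phi)\log_2|\phi|}\big)$. Here $O^*$ suppresses factors polynomial in $|\phi|$: the bounds are $C(|\phi|+1)^k\,2^{\varepsilon'\mathcal{TW}(\phi)}$ and $C(|\phi|+1)^k\,d^{\,\delta\,\mathcal{TW}(\phi)\log_2|\phi|}$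 (with $\log_2 0$ read as $0$), where $C$ and $k$ depend only on $\varepsilon'$ and on the constant in the bound on the number of nodes. The model of computation: algorithms are structured programs (assignment, sequencing, conditional, while loop) over finitely many variables that hold binary trees, with the operations nil, copy, cons, head, tail and a test for nil; an assignment costs one unit of time plus the sizes of the trees it reads, a test or an empty command costs one unit, and the space is the maximum over the run of the total size of all variables. -/

import Mathlib

/-! ## A machine model with time and space

Structured programs over finitely many variables that hold binary trees (Lisp data).  The size of a
tree is its number of `cons` cells.  Every assignment is charged one unit plus the sizes of the
operands it reads and every test one unit, so that a multitape Turing machine that keeps each tree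
as a parenthesised string on a tape of its own simulates a run with a constant factor loss in time
and in space.  The space of a run is the largest total size of all variables at any moment. -/

namespace TreeWidthSat

/-- Binary trees, the only data type. -/
inductive Data : Type
  | nil : Data
  | cons : Data → Data → Data

namespace Data

/-- The number of `cons` cells. -/
def size : Data → ℕ
  | nil => 0
  | cons a b => a.size + b.size + 1

/-- First component; `nil` for `nil`. -/
def head : Data → Data
  | nil => nil
  | cons a _ => a

/-- Second component; `nil` for `nil`. -/
def tail : Data → Data
  | nil => nil
  | cons _ b => b

/-- The list `[a₁, …, aₖ]` as the tree `cons a₁ (cons a₂ (… nil))`. -/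
def ofList : List Data → Data
  | [] => nil
  | a :: l => cons a (ofList l)

open Classical in
/-- A truth value: `nil` is false and `cons nil nil` is true. -/
noncomputable def ofProp (p : Prop) : Data := if p then cons nil nil else nil

/-- The list of the truth values of `p 0, …, p (k - 1)`. -/
noncomputable def ofPred {k : ℕ} (p : Fin k → Prop) : Data :=
  ofList (List.ofFn fun i => ofProp (p i))

end Data

/-- The contents of the variables. -/
abbrev Store (V : Type) : Type := V → Data

/-- The total size of all variables. -/
def Store.size {V : Type} [Fintype V] (σ : Store V) : ℕ := ∑ x, (σ x).size

/-- Right-hand sides of assignments. -/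
inductive Rhs (V : Type) : Type
  | nil : Rhs V
  | var (y : V) : Rhs V
  | cons (y z : V) : Rhs V
  | head (y : V) : Rhs V
  | tail (y : V) : Rhs V

namespace Rhs

/-- The value of a right-hand side. -/
def eval {V : Type} (σ : Store V) : Rhs V → Data
  | nil => Data.nil
  | var y => σ y
  | cons y z => Data.cons (σ y) (σ z)
  | head y => (σ y).head
  | tail y => (σ y).tail

/-- The total size of the operands of a right-hand side. -/
def cost {V : Type} (σ : Store V) : Rhs V → ℕ
  | nil => 0
  | var y => (σ y).size
  | cons y z => (σ y).size + (σ z).size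
  | head y => (σ y).size
  | tail y => (σ y).size

end Rhs

/-- Commands. A test `x` succeeds if the value of `x` is not `nil`. -/
inductive Cmd (V : Type) : Type
  | skip : Cmd V
  | assign (x : V) (e : Rhs V) : Cmd V
  | seq (c₁ c₂ : Cmd V) : Cmd V
  | cond (x : V) (c₁ c₂ : Cmd V) : Cmd V
  | loop (x : V) (c : Cmd V) : Cmd V

/-- `Exec c σ σ' t s`: started in the store `σ`, the command `c` halts in the store `σ'` after time
`t`, and the largest total size of the variables during the run (ends included) is `s`. -/
inductive Exec {V : Type} [Fintype V] [DecidableEq V] :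
    Cmd V → Store V → Store V → ℕ → ℕ → Prop
  | skip (σ : Store V) : Exec Cmd.skip σ σ 1 σ.size
  | assign (σ : Store V) (x : V) (e : Rhs V) :
      Exec (Cmd.assign x e) σ (Function.update σ x (e.eval σ)) (1 + e.cost σ)
        (max σ.size (Store.size (Function.update σ x (e.eval σ))))
  | seq {c₁ c₂ : Cmd V} {σ σ₁ σ₂ : Store V} {t₁ t₂ s₁ s₂ : ℕ}
      (h₁ : Exec c₁ σ σ₁ t₁ s₁) (h₂ : Exec c₂ σ₁ σ₂ t₂ s₂) :
      Exec (Cmd.seq c₁ c₂) σ σ₂ (t₁ + t₂) (max s₁ s₂)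
  | condTrue {x : V} {c₁ c₂ : Cmd V} {σ σ₁ : Store V} {t s : ℕ}
      (hx : σ x ≠ Data.nil) (h : Exec c₁ σ σ₁ t s) :
      Exec (Cmd.cond x c₁ c₂) σ σ₁ (1 + t) s
  | condFalse {x : V} {c₁ c₂ : Cmd V} {σ σ₁ : Store V} {t s : ℕ}
      (hx : σ x = Data.nil) (h : Exec c₂ σ σ₁ t s) :
      Exec (Cmd.cond x c₁ c₂) σ σ₁ (1 + t) s
  | loopTrue {x : V} {c : Cmd V} {σ σ₁ σ₂ : Store V} {t₁ t₂ s₁ s₂ : ℕ}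
      (hx : σ x ≠ Data.nil) (h₁ : Exec c σ σ₁ t₁ s₁) (h₂ : Exec (Cmd.loop x c) σ₁ σ₂ t₂ s₂) :
      Exec (Cmd.loop x c) σ σ₂ (1 + t₁ + t₂) (max s₁ s₂)
  | loopFalse {x : V} {c : Cmd V} {σ : Store V} (hx : σ x = Data.nil) :
      Exec (Cmd.loop x c) σ σ 1 σ.size

/-- An algorithm: a command over finitely many variables, with an input and an output variable. -/
structure Algorithm where
  Var : Type
  [varFintype : Fintype Var]
  [varDecEq : DecidableEq Var]
  input : Var
  output : Var
  body : Cmd Var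

attribute [instance] Algorithm.varFintype Algorithm.varDecEq

/-- On input `x` (all other variables being `nil`) the algorithm halts with output `y` after time
`t`, using space `s`. -/
def Algorithm.Runs (A : Algorithm) (x y : Data) (t s : ℕ) : Prop :=
  ∃ σ' : Store A.Var,
    Exec A.body (Function.update (fun _ => Data.nil) A.input x) σ' t s ∧ σ' A.output = y

/-! ## Formulas in conjunctive normal form -/

/-- A CNF formula with variables `0, …, numVars - 1` and clauses `0, …, numClauses - 1`. A clause is
a set of literals, and the literal `(v, b)` is true if the variable `v` has the value `b`. -/
structure CNF where
  numVars : ℕ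
  numClauses : ℕ
  clause : Fin numClauses → Finset (Fin numVars × Bool)

namespace CNF

/-- `|φ|`: the number of clauses plus the number of variables. -/
def size (φ : CNF) : ℕ := φ.numClauses + φ.numVars

/-- Some truth assignment makes some literal of every clause true. -/
def Satisfiable (φ : CNF) : Prop :=
  ∃ a : Fin φ.numVars → Bool, ∀ j, ∃ l ∈ φ.clause j, a l.1 = l.2

/-- The nodes of the incidence graph: variables and clauses. -/
abbrev Node (φ : CNF) : Type := Fin φ.numVars ⊕ Fin φ.numClauses

/-- The incidence graph: a variable and a clause are adjacent if the variable occurs in the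
clause. -/
def incidenceGraph (φ : CNF) : SimpleGraph φ.Node :=
  SimpleGraph.fromRel fun x y =>
    ∃ (v : Fin φ.numVars) (j : Fin φ.numClauses),
      x = Sum.inl v ∧ y = Sum.inr j ∧ ∃ b : Bool, (v, b) ∈ φ.clause j

end CNF

/-! ## Tree decompositions -/

/-- A tree decomposition of `G` whose tree has the node set `W`. -/
structure TreeDecomposition {V : Type} (G : SimpleGraph V) (W : Type) where
  tree : SimpleGraph W
  bag : W → Finset V
  isTree : tree.IsTree
  exists_mem_bag : ∀ v, ∃ t, v ∈ bag t
  exists_adj_bag : ∀ u v, G.Adj u v → ∃ t, u ∈ bag t ∧ v ∈ bag t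
  subtree : ∀ v, (tree.induce {t | v ∈ bag t}).Connected

namespace TreeDecomposition

variable {V : Type} {G : SimpleGraph V} {W : Type}

/-- The width: the maximal size of a bag minus one. (It is set to `0` if all bags are empty, which
happens only if `G` has no vertices.) -/
def width [Fintype W] (D : TreeDecomposition G W) : ℕ :=
  (Finset.univ.sup fun t => (D.bag t).card) - 1

open Classical in
/-- The maximal degree of the tree. -/
noncomputable def maxDegree [Fintype W] (D : TreeDecomposition G W) : ℕ := D.tree.maxDegree

/-- The base `d` of the running time: the maximal degree of the tree, but at least `2`. -/
noncomputable def base [Fintype W] (D : TreeDecomposition G W) : ℕ := max 2 D.maxDegree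

end TreeDecomposition

/-- A tree decomposition of the incidence graph of `φ` is nice (with the constant `K`) if its tree
has degrees at most `3` and `O(width · |φ|)` nodes. (The two `+ 1` only serve to admit decompositions
of width `0` and the empty formula.) -/
def IsNice {φ : CNF} {N : ℕ} (K : ℕ) (D : TreeDecomposition φ.incidenceGraph (Fin N)) : Prop :=
  D.maxDegree ≤ 3 ∧ N ≤ K * (D.width + 1) * (φ.size + 1)

/-! ## The input of an algorithm -/

/-- A formula is given by its clauses, each of them as two lists of truth values: which variables
occur positively, and which occur negatively. -/
noncomputable def encodeFormula (φ : CNF) : Data :=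
  Data.ofList (List.ofFn fun j =>
    Data.cons (Data.ofPred fun v => (v, true) ∈ φ.clause j)
      (Data.ofPred fun v => (v, false) ∈ φ.clause j))

/-- A tree decomposition is given by its nodes, each of them as three lists of truth values: which
nodes are its neighbours, which variables and which clauses are in its bag. -/
noncomputable def encodeDecomposition {φ : CNF} {N : ℕ}
    (D : TreeDecomposition φ.incidenceGraph (Fin N)) : Data :=
  Data.ofList (List.ofFn fun t =>
    Data.cons (Data.ofPred fun u => D.tree.Adj t u)
      (Data.cons (Data.ofPred fun v => Sum.inl v ∈ D.bag t)
        (Data.ofPred fun j => Sum.inr j ∈ D.bag t)))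

/-- The input: a formula together with a tree decomposition of its incidence graph. -/
noncomputable def encodeInput (φ : CNF) {N : ℕ}
    (D : TreeDecomposition φ.incidenceGraph (Fin N)) : Data :=
  Data.cons (encodeFormula φ) (encodeDecomposition D)

end TreeWidthSat

/-! ### Programs: size versus time, and commands on disjoint sets of variables -/

namespace TreeWidthSat

namespace Data

/-! Give each clause, like each variable, a Boolean value. A clause with the value true has weight
-1 and forbids the literals that occur in it; all other weights are 1. For a fixed assignment of the
variables, summing over the values of one clause gives 1 minus the indicator that none of its
literals is true, which is the indicator that the clause is satisfied. So the sum of all products of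
weights counts the satisfying assignments, and it is a two-state model with pair interactions on the
incidence graph itself (`partitionSum`, `partitionSum_toInput`).

The sum is evaluated by divide and conquer. Every set of vertices has a bag as balanced separator
(`IsTreeBags.exists_separates`). Once the values on the separator are fixed, the sum factors over
the components that remain, each of at most half the size. Write n for the size of the formula and w
for the maximal bag size. The recursion has about log n levels with at most 2^w branches per level,
hence about 2^(w log n) steps up to factors polynomial in n and exponential in w, in polynomial
space. If the tree has a node of degree 3, this is good enough, because 2^(3/2) < 3.

If all degrees are at most 2, the tree is a path. Then only w - m of the separator vertices are
branched on, where m = ⌊w/(q+1)⌋, and the remaining ones are carried through the recursion in a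
table over all their values. A component lies between two earlier separators, and it sees at most m
tabulated vertices on either side (`PathGood.left`). Tables therefore have at most 2^(3m) entries,
while the exponent of the time drops by a factor of about 1 - 1/(q+1). Factors exponential in w cost
only a small change of δ: either log n is large enough to absorb them, or n, and with it w, is
bounded (`absorb`).

For the machine model, the recursion is a stack machine whose single step is a polynomial-time
function of its state (`PolyFun.envStep`). It is iterated by a loop whose space does not depend on
the number of rounds (`PolyFun.exec_loop`). The running time is counted by `evals_pending` and
`EvalsComponents.double`. The exponent κ of the polynomial for a step is the same for all q, so q
can be chosen large in terms of κ and ε' (`exists_algorithm`). -/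

theorem size_head_le (a : Data) : a.head.size ≤ a.size := by
  cases a with
  | nil => simp [head]
  | cons a b => simp [head, size]; omega

theorem size_tail_le (a : Data) : a.tail.size ≤ a.size := by
  cases a with
  | nil => simp [tail]
  | cons a b => simp [tail, size]; omega

end Data

theorem Store.size_update_le {V : Type} [Fintype V] [DecidableEq V] (σ : Store V) (x : V)
    (d : Data) : Store.size (Function.update σ x d) ≤ σ.size + d.size := by
  unfold Store.size
  rw [← Finset.add_sum_erase _ _ (Finset.mem_univ x),
    ← Finset.add_sum_erase (a := x) _ (fun x => (σ x).size) (Finset.mem_univ x)]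
  have : ∑ y ∈ Finset.univ.erase x, (Function.update σ x d y).size
      = ∑ y ∈ Finset.univ.erase x, (σ y).size :=
    Finset.sum_congr rfl fun y hy => by
      rw [Function.update_of_ne (Finset.ne_of_mem_erase hy)]
  simp only [Function.update_self, this]
  omega

theorem Rhs.size_eval_le {V : Type} (σ : Store V) (e : Rhs V) :
    (e.eval σ).size ≤ 1 + e.cost σ := by
  cases e with
  | nil => simp [eval, Data.size]
  | var y => simp [eval, cost]
  | cons y z => simp only [eval, cost, Data.size]; omega
  | head y => have := Data.size_head_le (σ y); simp [eval, cost]; omega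
  | tail y => have := Data.size_tail_le (σ y); simp [eval, cost]; omega

/-- The space of a run is at most the initial size plus the time. -/
theorem Exec.space_le {V : Type} [Fintype V] [DecidableEq V] {c : Cmd V} {σ σ' : Store V}
    {t s : ℕ} (h : Exec c σ σ' t s) : s ≤ σ.size + t ∧ σ'.size ≤ σ.size + t := by
  induction h with
  | skip σ => simp
  | assign σ x e =>
    have h₁ := Store.size_update_le σ x (e.eval σ)
    have h₂ := Rhs.size_eval_le σ e
    omega
  | seq _ _ ih₁ ih₂ => omega
  | condTrue _ _ ih => omega
  | condFalse _ _ ih => omega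
  | loopTrue _ _ _ ih₁ ih₂ => omega
  | loopFalse _ => simp

/-! ### Renaming of variables -/

/-- Renaming of the variables of a right-hand side. -/
def Rhs.map {V V' : Type} (e : V → V') : Rhs V → Rhs V'
  | nil => nil
  | var y => var (e y)
  | cons y z => cons (e y) (e z)
  | head y => head (e y)
  | tail y => tail (e y)

/-- Renaming of the variables of a command. -/
def Cmd.map {V V' : Type} (e : V → V') : Cmd V → Cmd V'
  | skip => skip
  | assign x r => assign (e x) (r.map e)
  | seq c₁ c₂ => seq (c₁.map e) (c₂.map e)
  | cond x c₁ c₂ => cond (e x) (c₁.map e) (c₂.map e)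
  | loop x c => loop (e x) (c.map e)

theorem Store.size_elim {V V' : Type} [Fintype V] [Fintype V'] (σ : Store V) (ρ : Store V') :
    Store.size (V := V ⊕ V') (Sum.elim σ ρ) = σ.size + ρ.size := by
  simp [Store.size]

theorem Rhs.eval_map_inl {V V' : Type} (σ : Store V) (ρ : Store V') (e : Rhs V) :
    (e.map Sum.inl).eval (V := V ⊕ V') (Sum.elim σ ρ) = e.eval σ := by
  cases e <;> rfl

theorem Rhs.cost_map_inl {V V' : Type} (σ : Store V) (ρ : Store V') (e : Rhs V) :
    (e.map Sum.inl).cost (V := V ⊕ V') (Sum.elim σ ρ) = e.cost σ := by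
  cases e <;> rfl

theorem Rhs.eval_map_inr {V V' : Type} (σ : Store V) (ρ : Store V') (e : Rhs V') :
    (e.map Sum.inr).eval (V := V ⊕ V') (Sum.elim σ ρ) = e.eval ρ := by
  cases e <;> rfl

theorem Rhs.cost_map_inr {V V' : Type} (σ : Store V) (ρ : Store V') (e : Rhs V') :
    (e.map Sum.inr).cost (V := V ⊕ V') (Sum.elim σ ρ) = e.cost ρ := by
  cases e <;> rfl

/-- A frame rule: variables that a command does not mention stay as they are and only add their size
to the space. Programs are composed by giving each its own summand of the variables. -/
theorem Exec.map_inl {V V' : Type} [Fintype V] [DecidableEq V] [Fintype V'] [DecidableEq V']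
    {c : Cmd V} {σ σ' : Store V} {t s : ℕ} (h : Exec c σ σ' t s) (ρ : Store V') :
    Exec (V := V ⊕ V') (c.map Sum.inl) (Sum.elim σ ρ) (Sum.elim σ' ρ) t (s + ρ.size) := by
  induction h with
  | skip σ => rw [← Store.size_elim]; exact Exec.skip _
  | assign σ x e =>
    have := Exec.assign (V := V ⊕ V') (Sum.elim σ ρ) (Sum.inl x) (e.map Sum.inl)
    rw [Rhs.eval_map_inl, Rhs.cost_map_inl, Sum.update_elim_inl, Store.size_elim,
      Store.size_elim, Nat.add_max_add_right] at this
    exact this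
  | seq _ _ ih₁ ih₂ => rw [← Nat.add_max_add_right]; exact Exec.seq ih₁ ih₂
  | condTrue hx _ ih => exact Exec.condTrue hx ih
  | condFalse hx _ ih => exact Exec.condFalse hx ih
  | loopTrue hx _ _ ih₁ ih₂ => rw [← Nat.add_max_add_right]; exact Exec.loopTrue hx ih₁ ih₂
  | loopFalse hx => rw [← Store.size_elim]; exact Exec.loopFalse hx

theorem Exec.map_inr {V V' : Type} [Fintype V] [DecidableEq V] [Fintype V'] [DecidableEq V']
    {c : Cmd V'} {ρ ρ' : Store V'} {t s : ℕ} (h : Exec c ρ ρ' t s) (σ : Store V) :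
    Exec (V := V ⊕ V') (c.map Sum.inr) (Sum.elim σ ρ) (Sum.elim σ ρ') t (σ.size + s) := by
  induction h with
  | skip ρ => rw [← Store.size_elim]; exact Exec.skip _
  | assign ρ x e =>
    have := Exec.assign (V := V ⊕ V') (Sum.elim σ ρ) (Sum.inr x) (e.map Sum.inr)
    rw [Rhs.eval_map_inr, Rhs.cost_map_inr, Sum.update_elim_inr, Store.size_elim,
      Store.size_elim, Nat.add_max_add_left] at this
    exact this
  | seq _ _ ih₁ ih₂ => rw [← Nat.add_max_add_left]; exact Exec.seq ih₁ ih₂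
  | condTrue hx _ ih => exact Exec.condTrue hx ih
  | condFalse hx _ ih => exact Exec.condFalse hx ih
  | loopTrue hx _ _ ih₁ ih₂ => rw [← Nat.add_max_add_left]; exact Exec.loopTrue hx ih₁ ih₂
  | loopFalse hx => rw [← Store.size_elim]; exact Exec.loopFalse hx

section

variable {V V' : Type} [DecidableEq V] [DecidableEq V']

/-- The store whose only variable with a value is `i`. -/
def Store.single (i : V) (x : Data) : Store V := Function.update (fun _ => Data.nil) i x

@[simp] theorem Store.single_self (i : V) (x : Data) : Store.single i x i = x := by
  simp [Store.single]

@[simp] theorem Store.update_single (i : V) (x y : Data) :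
    Function.update (Store.single i x) i y = Store.single i y := by
  simp [Store.single]

theorem Store.single_inl (i : V) (j : V') (x : Data) :
    Store.single (V := V ⊕ V') (Sum.inl i) x
      = Sum.elim (Store.single i x) (Store.single j Data.nil) := by
  have : Store.single j Data.nil = fun _ : V' => Data.nil := by simp [Store.single]
  rw [this]
  unfold Store.single
  rw [← Sum.update_elim_inl]
  congr 1
  funext z
  cases z <;> rfl

end

/-! ### Runs within a time bound -/

/-- The command `c` leads from `σ` to `σ'` in time at most `T`. -/
def RunsIn {V : Type} [Fintype V] [DecidableEq V] (c : Cmd V) (σ σ' : Store V) (T : ℕ) : Prop :=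
  ∃ t s, Exec c σ σ' t s ∧ t ≤ T

section RunsIn

variable {V V' : Type} [Fintype V] [DecidableEq V] [Fintype V'] [DecidableEq V']

theorem RunsIn.mono {c : Cmd V} {σ σ' : Store V} {T T' : ℕ} (h : RunsIn c σ σ' T) (hT : T ≤ T') :
    RunsIn c σ σ' T' := by
  obtain ⟨t, s, h, ht⟩ := h
  exact ⟨t, s, h, ht.trans hT⟩

theorem RunsIn.seq {c₁ c₂ : Cmd V} {σ σ₁ σ₂ : Store V} {T₁ T₂ : ℕ} (h₁ : RunsIn c₁ σ σ₁ T₁)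
    (h₂ : RunsIn c₂ σ₁ σ₂ T₂) : RunsIn (Cmd.seq c₁ c₂) σ σ₂ (T₁ + T₂) := by
  obtain ⟨t, s, h₁, ht⟩ := h₁
  obtain ⟨t', s', h₂, ht'⟩ := h₂
  exact ⟨_, _, Exec.seq h₁ h₂, by omega⟩

theorem RunsIn.assign {σ σ' : Store V} {x : V} {e : Rhs V} {T : ℕ}
    (h : Function.update σ x (e.eval σ) = σ') (hT : 1 + e.cost σ ≤ T) :
    RunsIn (Cmd.assign x e) σ σ' T := by
  subst h
  exact ⟨_, _, Exec.assign σ x e, hT⟩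

theorem RunsIn.condTrue {x : V} {c₁ c₂ : Cmd V} {σ σ' : Store V} {T : ℕ} (hx : σ x ≠ Data.nil)
    (h : RunsIn c₁ σ σ' T) : RunsIn (Cmd.cond x c₁ c₂) σ σ' (1 + T) := by
  obtain ⟨t, s, h, ht⟩ := h
  exact ⟨_, _, Exec.condTrue hx h, by omega⟩

theorem RunsIn.condFalse {x : V} {c₁ c₂ : Cmd V} {σ σ' : Store V} {T : ℕ} (hx : σ x = Data.nil)
    (h : RunsIn c₂ σ σ' T) : RunsIn (Cmd.cond x c₁ c₂) σ σ' (1 + T) := by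
  obtain ⟨t, s, h, ht⟩ := h
  exact ⟨_, _, Exec.condFalse hx h, by omega⟩

theorem RunsIn.map_inl {c : Cmd V} {σ σ' : Store V} {T : ℕ} (h : RunsIn c σ σ' T)
    (ρ : Store V') :
    RunsIn (V := V ⊕ V') (c.map Sum.inl) (Sum.elim σ ρ) (Sum.elim σ' ρ) T := by
  obtain ⟨t, s, h, ht⟩ := h
  exact ⟨_, _, h.map_inl ρ, ht⟩

theorem RunsIn.map_inr {c : Cmd V'} {ρ ρ' : Store V'} {T : ℕ} (h : RunsIn c ρ ρ' T)
    (σ : Store V) :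
    RunsIn (V := V ⊕ V') (c.map Sum.inr) (Sum.elim σ ρ) (Sum.elim σ ρ') T := by
  obtain ⟨t, s, h, ht⟩ := h
  exact ⟨_, _, h.map_inr σ, ht⟩

theorem Store.size_single (i : V) (x : Data) : (Store.single i x).size = x.size := by
  unfold Store.size Store.single
  rw [Finset.sum_eq_single i] <;> simp +contextual [Function.update_of_ne, Data.size]

end RunsIn

end TreeWidthSat
-- Polynomial-time functions: composition, branching, iteration
namespace TreeWidthSat

/-! ### Encodings of types -/

/-- A type whose elements are represented by trees. -/
class Enc (α : Type) where
  enc : α → Data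

open Enc

instance : Enc Data := ⟨id⟩

instance : Enc Bool := ⟨fun b => if b then Data.cons Data.nil Data.nil else Data.nil⟩

instance : Enc ℕ := ⟨fun n => Data.ofList (List.replicate n Data.nil)⟩

instance {α β : Type} [Enc α] [Enc β] : Enc (α × β) := ⟨fun p => Data.cons (enc p.1) (enc p.2)⟩

instance {α : Type} [Enc α] : Enc (List α) := ⟨fun l => Data.ofList (l.map enc)⟩

instance {α : Type} [Enc α] (p : α → Prop) : Enc {a // p a} := ⟨fun a => enc a.1⟩

/-- The size of the encoding. -/
def sz {α : Type} [Enc α] (a : α) : ℕ := (enc a).size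

section sz

variable {α β : Type} [Enc α] [Enc β]

@[simp] theorem sz_pair (a : α) (b : β) : sz (a, b) = sz a + sz b + 1 := rfl

theorem sz_prod (p : α × β) : sz p = sz p.1 + sz p.2 + 1 := rfl

@[simp] theorem sz_nil : sz ([] : List α) = 0 := rfl

@[simp] theorem sz_cons (a : α) (l : List α) : sz (a :: l) = sz a + sz l + 1 := rfl

@[simp] theorem sz_append (l l' : List α) : sz (l ++ l') = sz l + sz l' := by
  induction l with
  | nil => simp
  | cons a l ih => simp [ih]; omega

theorem sz_bool_le (b : Bool) : sz b ≤ 1 := by cases b <;> decide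

@[simp] theorem sz_nat (n : ℕ) : sz n = n := by
  induction n with
  | zero => rfl
  | succ n ih =>
    change Data.size (Data.cons Data.nil (enc n)) = n + 1
    change (enc n).size = n at ih
    simp [Data.size, ih]

@[simp] theorem sz_subtype {p : α → Prop} (a : {a // p a}) : sz a = sz a.1 := rfl

theorem length_le_sz (l : List α) : l.length ≤ sz l := by
  induction l with
  | nil => simp
  | cons a l ih => simp; omega

theorem sz_le_of_mem {a : α} {l : List α} (h : a ∈ l) : sz a ≤ sz l := by
  induction h with
  | head => simp; omega
  | tail _ _ ih => simp; omega

theorem sz_reverse (l : List α) : sz l.reverse = sz l := by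
  induction l with
  | nil => simp
  | cons a l ih => simp [ih]; omega

theorem sz_le_of_sublist {l l' : List α} (h : l.Sublist l') : sz l ≤ sz l' := by
  induction h with
  | slnil => simp
  | cons a _ ih => simp; omega
  | cons_cons a _ ih => simp; omega

theorem sz_le_of_forall {l : List α} {B : ℕ} (h : ∀ a ∈ l, sz a ≤ B) :
    sz l ≤ l.length * (B + 1) := by
  induction l with
  | nil => simp
  | cons a l ih =>
    have h₁ := h a (by simp)
    have h₂ := ih fun b hb => h b (by simp [hb])
    simp only [sz_cons, List.length_cons]
    nlinarith

end sz

/-! ### Polynomial bounds -/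

/-- The quantity `b a` is bounded by a polynomial in the size of `a`. -/
def PolyBdd {α : Type} [Enc α] (b : α → ℕ) : Prop := ∃ k : ℕ, ∀ a, b a ≤ (sz a + 2) ^ k

namespace PolyBdd

variable {α β : Type} [Enc α] [Enc β] {b c : α → ℕ}

theorem mono (hc : PolyBdd c) (h : ∀ a, b a ≤ c a) : PolyBdd b := by
  obtain ⟨k, hk⟩ := hc
  exact ⟨k, fun a => (h a).trans (hk a)⟩

/-- The base `sz a + 2` is at least 2, so a single power of it dominates constants, and sums cost
only one more in the exponent. -/
theorem const (n : ℕ) : PolyBdd fun _ : α => n :=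
  ⟨n, fun a => Nat.lt_two_pow_self.le.trans (Nat.pow_le_pow_left (by omega) n)⟩

theorem sz : PolyBdd fun a : α => sz a := ⟨1, fun a => by simp⟩

theorem mul (hb : PolyBdd b) (hc : PolyBdd c) : PolyBdd fun a => b a * c a := by
  obtain ⟨k, hk⟩ := hb
  obtain ⟨l, hl⟩ := hc
  exact ⟨k + l, fun a => by rw [pow_add]; exact Nat.mul_le_mul (hk a) (hl a)⟩

theorem add (hb : PolyBdd b) (hc : PolyBdd c) : PolyBdd fun a => b a + c a := by
  obtain ⟨k, hk⟩ := hb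
  obtain ⟨l, hl⟩ := hc
  refine ⟨k + l + 1, fun a => (Nat.add_le_add (hk a) (hl a)).trans ?_⟩
  have h₁ : (TreeWidthSat.sz a + 2) ^ k ≤ (TreeWidthSat.sz a + 2) ^ (k + l) :=
    Nat.pow_le_pow_right (by omega) (by omega)
  have h₂ : (TreeWidthSat.sz a + 2) ^ l ≤ (TreeWidthSat.sz a + 2) ^ (k + l) :=
    Nat.pow_le_pow_right (by omega) (by omega)
  rw [pow_succ]
  nlinarith [Nat.zero_le ((TreeWidthSat.sz a + 2) ^ (k + l) * TreeWidthSat.sz a)]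

theorem comp {d : β → ℕ} (hd : PolyBdd d) {f : α → β}
    (hf : PolyBdd fun a => TreeWidthSat.sz (f a)) : PolyBdd fun a => d (f a) := by
  obtain ⟨k, hk⟩ := hf
  obtain ⟨l, hl⟩ := hd
  refine ⟨(k + 2) * l, fun a => (hl _).trans ?_⟩
  rw [pow_mul]
  refine Nat.pow_le_pow_left ?_ l
  have h₁ := hk a
  have h₂ : 1 ≤ (TreeWidthSat.sz a + 2) ^ k := Nat.one_le_pow _ _ (by omega)
  have h₃ : 4 ≤ (TreeWidthSat.sz a + 2) ^ 2 := by nlinarith [Nat.zero_le (TreeWidthSat.sz a)]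
  rw [pow_add]
  nlinarith

end PolyBdd

/-! ### Functions computable in polynomial time -/

/-- The function `f` is computed in polynomial time by a command that works on a single variable
and leaves all its auxiliary variables empty. -/
@[fun_prop]
def PolyFun {α β : Type} [Enc α] [Enc β] (f : α → β) : Prop :=
  ∃ (V : Type) (_ : Fintype V) (_ : DecidableEq V) (i : V) (c : Cmd V) (b : α → ℕ),
    PolyBdd b ∧ ∀ a, RunsIn c (Store.single i (enc a)) (Store.single i (enc (f a))) (b a)

namespace PolyFun

variable {α β γ δ : Type} [Enc α] [Enc β] [Enc γ] [Enc δ]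

/-- A command cannot write more than its time allows. This bounds intermediate results in
compositions. -/
theorem size {f : α → β} (hf : PolyFun f) : PolyBdd fun a => sz (f a) := by
  obtain ⟨V, _, _, i, c, b, hb, h⟩ := hf
  refine (PolyBdd.sz.add hb).mono fun a => ?_
  obtain ⟨t, s, h, ht⟩ := h a
  have := h.space_le.2
  rw [Store.size_single, Store.size_single] at this
  change sz (f a) ≤ sz a + t at this
  omega

/-- A function that does not change the encoding. -/
theorem of_enc_eq {f : α → β} (h : ∀ a, enc (f a) = enc a) : PolyFun f :=
  ⟨Unit, inferInstance, inferInstance, (), Cmd.skip, fun _ => 1, PolyBdd.const 1, fun a =>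
    ⟨_, _, by rw [h a]; exact Exec.skip _, le_rfl⟩⟩

theorem of_assign {f : α → β} (e : Rhs Unit)
    (h : ∀ a : α, e.eval (Store.single () (enc a)) = enc (f a))
    (hc : ∀ a : α, e.cost (Store.single () (enc a)) ≤ 2 * sz a) : PolyFun f :=
  ⟨Unit, inferInstance, inferInstance, (), Cmd.assign () e, fun a => 1 + 2 * sz a,
    (PolyBdd.const 1).add ((PolyBdd.const 2).mul PolyBdd.sz), fun a =>
    RunsIn.assign (by rw [h a, Store.update_single]) (by have := hc a; simp only; omega)⟩

theorem of_enc_eq_head {f : α → β} (h : ∀ a, enc (f a) = (enc a).head) : PolyFun f :=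
  of_assign (Rhs.head ()) (fun a => by simp [Rhs.eval, h])
    (fun a => by simp [Rhs.cost, sz]; omega)

theorem of_enc_eq_tail {f : α → β} (h : ∀ a, enc (f a) = (enc a).tail) : PolyFun f :=
  of_assign (Rhs.tail ()) (fun a => by simp [Rhs.eval, h])
    (fun a => by simp [Rhs.cost, sz]; omega)

theorem of_enc_eq_nil {f : α → β} (h : ∀ a, enc (f a) = Data.nil) : PolyFun f :=
  of_assign Rhs.nil (fun a => by simp [Rhs.eval, h]) (fun a => by simp [Rhs.cost])

@[fun_prop]
theorem id : PolyFun fun a : α => a := of_enc_eq fun _ => rfl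

/-- A command that is started with the value of a polynomial-time function. -/
theorem comp_of_runsIn {f : α → β} {h : α → γ} (hf : PolyFun f) {V' : Type} [Fintype V']
    [DecidableEq V'] {j : V'} {c' : Cmd V'} {b' : α → ℕ} (hb' : PolyBdd b')
    (hh : PolyBdd fun a => sz (h a))
    (h' : ∀ a, RunsIn c' (Store.single j (enc (f a))) (Store.single j (enc (h a))) (b' a)) :
    PolyFun h := by
  have hs := hf.size
  obtain ⟨V, _, _, i, c, b, hb, hc⟩ := hf
  -- The result of `c` is moved to `j` and that of `c'` back to `i`. The source is cleared after
  -- each move, so that all auxiliary variables are empty again at the end.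
  refine ⟨V ⊕ V', inferInstance, inferInstance, Sum.inl i,
    ((c.map Sum.inl).seq ((Cmd.assign (Sum.inr j) (Rhs.var (Sum.inl i))).seq
      (Cmd.assign (Sum.inl i) Rhs.nil))).seq
    ((c'.map Sum.inr).seq ((Cmd.assign (Sum.inl i) (Rhs.var (Sum.inr j))).seq
      (Cmd.assign (Sum.inr j) Rhs.nil))),
    fun a => (b a + (1 + sz (f a) + 1)) + (b' a + (1 + sz (h a) + 1)), ?_, fun a => ?_⟩
  · exact (hb.add (((PolyBdd.const 1).add hs).add (PolyBdd.const 1))).add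
      (hb'.add (((PolyBdd.const 1).add hh).add (PolyBdd.const 1)))
  · rw [Store.single_inl i j, Store.single_inl i j]
    refine (((hc a).map_inl _).seq (RunsIn.seq
      (RunsIn.assign (σ' := Sum.elim (Store.single i (enc (f a))) (Store.single j (enc (f a)))) ?_ ?_)
      (RunsIn.assign (σ' := Sum.elim (Store.single i Data.nil) (Store.single j (enc (f a))))
        ?_ ?_))).seq
      (((h' a).map_inr _).seq (RunsIn.seq (RunsIn.assign
        (σ' := Sum.elim (Store.single i (enc (h a))) (Store.single j (enc (h a)))) ?_ ?_)
        (RunsIn.assign ?_ ?_))) <;>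
    simp [Rhs.eval, Rhs.cost, sz, Sum.update_elim_inl, Sum.update_elim_inr]

@[fun_prop]
theorem comp {g : β → γ} {f : α → β} (hg : PolyFun g) (hf : PolyFun f) :
    PolyFun fun a => g (f a) := by
  have hs' := hg.size.comp hf.size
  obtain ⟨V', _, _, j, c', b', hb', h'⟩ := hg
  exact hf.comp_of_runsIn (hb'.comp hf.size) hs' fun a => h' (f a)

@[fun_prop]
theorem prodMk {f : α → β} {g : α → γ} (hf : PolyFun f) (hg : PolyFun g) :
    PolyFun fun a => (f a, g a) := by
  have hs := hf.size
  have hs' := hg.size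
  obtain ⟨V, _, _, i, c, b, hb, h⟩ := hf
  obtain ⟨V', _, _, j, c', b', hb', h'⟩ := hg
  -- The argument is copied before `c` overwrites it.
  refine ⟨V ⊕ V', inferInstance, inferInstance, Sum.inl i,
    (Cmd.assign (Sum.inr j) (Rhs.var (Sum.inl i))).seq
      ((c.map Sum.inl).seq ((c'.map Sum.inr).seq
        ((Cmd.assign (Sum.inl i) (Rhs.cons (Sum.inl i) (Sum.inr j))).seq
          (Cmd.assign (Sum.inr j) Rhs.nil)))),
    fun a => (1 + sz a) + (b a + (b' a + ((1 + (sz (f a) + sz (g a))) + 1))), ?_, fun a => ?_⟩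
  · exact ((PolyBdd.const 1).add PolyBdd.sz).add (hb.add (hb'.add
      (((PolyBdd.const 1).add (hs.add hs')).add (PolyBdd.const 1))))
  · rw [Store.single_inl i j, Store.single_inl i j]
    refine (RunsIn.assign (σ' := Sum.elim (Store.single i (enc a)) (Store.single j (enc a)))
      ?_ ?_).seq (((h a).map_inl _).seq (((h' a).map_inr _).seq ((RunsIn.assign
        (σ' := Sum.elim (Store.single i (enc (f a, g a))) (Store.single j (enc (g a)))) ?_ ?_).seq
        (RunsIn.assign ?_ ?_)))) <;>
    simp [Rhs.eval, Rhs.cost, sz, Sum.update_elim_inl, Sum.update_elim_inr, enc]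

/-- Case distinction according to whether the encoding of `p a` is `nil`. -/
theorem cases {p : α → β} (hp : PolyFun p) {h : α → γ}
    (h₁ : PolyFun fun a : {a // enc (p a) ≠ Data.nil} => h a.1)
    (h₂ : PolyFun fun a : {a // enc (p a) = Data.nil} => h a.1) : PolyFun h := by
  classical
  have hs := hp.size
  have hs₁ := h₁.size
  have hs₂ := h₂.size
  obtain ⟨V, _, _, i, c, b, hb, hc⟩ := hp
  obtain ⟨V₁, _, _, i₁, c₁, b₁, ⟨k₁, hb₁⟩, hc₁⟩ := h₁
  obtain ⟨V₂, _, _, i₂, c₂, b₂, ⟨k₂, hb₂⟩, hc₂⟩ := h₂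
  obtain ⟨l₁, hl₁⟩ := hs₁
  obtain ⟨l₂, hl₂⟩ := hs₂
  -- A copy of the argument waits in `i₁` while `c` computes the test, and it moves on to `i₂` only
  -- in the second case.
  refine ⟨V ⊕ (V₁ ⊕ V₂), inferInstance, inferInstance, Sum.inl i,
    (Cmd.assign (Sum.inr (Sum.inl i₁)) (Rhs.var (Sum.inl i))).seq
    ((c.map Sum.inl).seq
    (Cmd.cond (Sum.inl i)
      ((((c₁.map Sum.inl).map Sum.inr).seq
        (Cmd.assign (Sum.inl i) (Rhs.var (Sum.inr (Sum.inl i₁))))).seq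
        (Cmd.assign (Sum.inr (Sum.inl i₁)) Rhs.nil))
      (((Cmd.assign (Sum.inr (Sum.inr i₂)) (Rhs.var (Sum.inr (Sum.inl i₁)))).seq
        (Cmd.assign (Sum.inr (Sum.inl i₁)) Rhs.nil)).seq
        ((((c₂.map Sum.inr).map Sum.inr).seq
        (Cmd.assign (Sum.inl i) (Rhs.var (Sum.inr (Sum.inr i₂))))).seq
        (Cmd.assign (Sum.inr (Sum.inr i₂)) Rhs.nil))))),
    -- One bound has to serve both branches, so the powers for both of them enter.
    fun a => (1 + sz a) + (b a + (1 + (((1 + sz a) + (1 + sz a)) +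
      ((((sz a + 2) ^ k₁ + (sz a + 2) ^ k₂) +
        (1 + ((sz a + 2) ^ l₁ + (sz a + 2) ^ l₂))) + 1)))), ?_, fun a => ?_⟩
  · have hk : ∀ k, PolyBdd fun a : α => (sz a + 2) ^ k := fun k => ⟨k, fun a => le_rfl⟩
    exact ((PolyBdd.const 1).add PolyBdd.sz).add (hb.add ((PolyBdd.const 1).add
      ((((PolyBdd.const 1).add PolyBdd.sz).add ((PolyBdd.const 1).add PolyBdd.sz)).add
      ((((hk k₁).add (hk k₂)).add ((PolyBdd.const 1).add ((hk l₁).add (hk l₂)))).add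
        (PolyBdd.const 1)))))
  · rw [Store.single_inl i (Sum.inl i₁ : V₁ ⊕ V₂), Store.single_inl i (Sum.inl i₁ : V₁ ⊕ V₂),
      Store.single_inl i₁ i₂]
    refine (RunsIn.assign (σ' := Sum.elim (Store.single i (enc a))
      (Sum.elim (Store.single i₁ (enc a)) (Store.single i₂ Data.nil))) ?_ ?_).seq
      (((hc a).map_inl _).seq ?_)
    · simp [Rhs.eval, Sum.update_elim_inr, Sum.update_elim_inl]
    · simp [Rhs.cost, sz]
    · by_cases hpa : enc (p a) = Data.nil
      · have e₁ := hb₂ ⟨a, hpa⟩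
        have e₂ := hl₂ ⟨a, hpa⟩
        simp only [sz_subtype] at e₁ e₂
        refine RunsIn.condFalse (by simpa using hpa) ?_
        refine ((RunsIn.seq
          (RunsIn.assign (σ' := Sum.elim (Store.single i Data.nil)
            (Sum.elim (Store.single i₁ (enc a)) (Store.single i₂ (enc a)))) ?_ ?_)
          (RunsIn.assign (σ' := Sum.elim (Store.single i Data.nil)
            (Sum.elim (Store.single i₁ Data.nil) (Store.single i₂ (enc a)))) ?_ ?_)).seq
          (((((hc₂ ⟨a, hpa⟩).map_inr _).map_inr _).mono ?_ |>.seq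
          (RunsIn.assign (σ' := Sum.elim (Store.single i (enc (h a)))
            (Sum.elim (Store.single i₁ Data.nil) (Store.single i₂ (enc (h a))))) ?_ ?_)).seq
          (RunsIn.assign ?_ ?_)))
        any_goals simp [Rhs.eval, Rhs.cost, Sum.update_elim_inl, Sum.update_elim_inr, hpa]
        · rfl
        · omega
        · change sz (h a) ≤ _
          omega
      · have e₁ := hb₁ ⟨a, hpa⟩
        have e₂ := hl₁ ⟨a, hpa⟩
        simp only [sz_subtype] at e₁ e₂
        refine RunsIn.condTrue (by simpa using hpa) ?_
        refine (((((((hc₁ ⟨a, hpa⟩).map_inl _).map_inr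
          _).mono (T' := (sz a + 2) ^ k₁ + (sz a + 2) ^ k₂) ?_).seq
          (RunsIn.assign (T := 1 + ((sz a + 2) ^ l₁ + (sz a + 2) ^ l₂)) (σ' := Sum.elim (Store.single i (enc (h a)))
            (Sum.elim (Store.single i₁ (enc (h a))) (Store.single i₂ Data.nil))) ?_ ?_)).seq
          (RunsIn.assign (T := 1) ?_ ?_)).mono ?_)
        · omega
        · simp [Rhs.eval, Sum.update_elim_inl]
        · simp only [Rhs.cost, Sum.elim_inr, Sum.elim_inl, Store.single_self]
          change 1 + sz (h a) ≤ _
          omega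
        · simp [Rhs.eval, Sum.update_elim_inl, Sum.update_elim_inr]
        · simp [Rhs.cost]
        · omega

/-- Repetition of the command `c`, which works on the variable `i`, as long as the head of the
value of `i` is not `nil`; the additional variable holds this head. -/
def _root_.TreeWidthSat.Cmd.repeat {V : Type} (c : Cmd V) (i : V) : Cmd (V ⊕ Unit) :=
  (Cmd.assign (Sum.inr ()) (Rhs.head (Sum.inl i))).seq
    (Cmd.loop (Sum.inr ()) ((c.map Sum.inl).seq (Cmd.assign (Sum.inr ()) (Rhs.head (Sum.inl i)))))

/-- Here space is separated from time. The bound "space is at most initial size plus time" is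
applied to each round alone, so the space involves the largest state and the cost of one round, but
not the number `R` of rounds. -/
theorem exec_loop {V : Type} [Fintype V] [DecidableEq V] {c : Cmd V} {i : V}
    {g : Bool × β → Bool × β} {S T : ℕ}
    (hc : ∀ y, sz y ≤ S → RunsIn c (Store.single i (enc y)) (Store.single i (enc (g y))) T)
    (R : ℕ) (x : Bool × β) (hrun : ∀ j < R, (g^[j] x).1 = true) (hfinal : (g^[R] x).1 = false)
    (hS : ∀ j ≤ R, sz (g^[j] x) ≤ S) :
    ∃ t s, Exec (V := V ⊕ Unit)
      (Cmd.loop (Sum.inr ())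
        ((c.map Sum.inl).seq (Cmd.assign (Sum.inr ()) (Rhs.head (Sum.inl i)))))
      (Sum.elim (Store.single i (enc x)) (Store.single () (enc x.1)))
      (Sum.elim (Store.single i (enc (g^[R] x))) (Store.single () Data.nil)) t s ∧
      t ≤ 1 + R * (T + S + 2) ∧ s ≤ 2 * S + T + 2 := by
  induction R generalizing x with
  | zero =>
    have hx : enc x.1 = Data.nil := by
      simp only [Function.iterate_zero, _root_.id] at hfinal
      rw [hfinal]
      rfl
    have h0 := hS 0 le_rfl
    rw [hx]
    refine ⟨_, _, Exec.loopFalse (by simp), by omega, ?_⟩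
    rw [Store.size_elim, Store.size_single, Store.size_single]
    change sz x + 0 ≤ _
    simp only [Function.iterate_zero, _root_.id] at h0
    omega
  | succ R ih =>
    have hx : x.1 = true := hrun 0 (by omega)
    have h0 := hS 0 (by omega)
    have h1 := hS 1 (by omega)
    simp only [Function.iterate_zero, Function.iterate_one, _root_.id] at h0 h1
    obtain ⟨t, s, h, ht, hs⟩ := ih (g x) (fun j hj => hrun (j + 1) (by omega)) hfinal
      (fun j hj => hS (j + 1) (by omega))
    obtain ⟨t', s', h', ht'⟩ := ((hc x h0).map_inl (Store.single () (enc x.1))).seq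
      (RunsIn.assign (T := 1 + S) (σ' := Sum.elim (Store.single i (enc (g x)))
        (Store.single () (enc (g x).1))) (e := Rhs.head (Sum.inl i)) (x := Sum.inr ())
        (by simp only [Rhs.eval, Sum.elim_inl, Store.single_self, Sum.update_elim_inr,
              Store.update_single]
            rfl)
        (by simpa [Rhs.cost, sz] using h1))
    have hsp := h'.space_le.1
    rw [Store.size_elim, Store.size_single, Store.size_single, hx] at hsp
    change s' ≤ sz x + 1 + t' at hsp
    refine ⟨_, _, Exec.loopTrue (by simp [hx, enc]) h' h, ?_, ?_⟩
    · rw [Nat.succ_mul]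
      omega
    · exact max_le (by omega) hs

theorem runsIn_repeat {V : Type} [Fintype V] [DecidableEq V] {c : Cmd V} {i : V}
    {g : Bool × β → Bool × β} {S T : ℕ}
    (hc : ∀ y, sz y ≤ S → RunsIn c (Store.single i (enc y)) (Store.single i (enc (g y))) T)
    (R : ℕ) (x : Bool × β) (hrun : ∀ j < R, (g^[j] x).1 = true) (hfinal : (g^[R] x).1 = false)
    (hS : ∀ j ≤ R, sz (g^[j] x) ≤ S) :
    ∃ t s, Exec (c.repeat i) (Store.single (Sum.inl i) (enc x))
      (Store.single (Sum.inl i) (enc (g^[R] x))) t s ∧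
      t ≤ 2 + S + R * (T + S + 2) ∧ s ≤ 2 * S + T + 2 := by
  obtain ⟨t, s, h, ht, hs⟩ := exec_loop hc R x hrun hfinal hS
  have h0 := hS 0 (by omega)
  simp only [Function.iterate_zero, _root_.id] at h0
  obtain ⟨t', s', h', ht'⟩ := RunsIn.assign (σ := Sum.elim (Store.single i (enc x))
    (Store.single () Data.nil)) (T := 1 + S) (σ' := Sum.elim (Store.single i (enc x))
        (Store.single () (enc x.1))) (e := Rhs.head (Sum.inl i)) (x := Sum.inr ())
        (by simp only [Rhs.eval, Sum.elim_inl, Store.single_self, Sum.update_elim_inr,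
              Store.update_single]
            rfl)
        (by simpa [Rhs.cost, sz] using h0)
  have hsp := h'.space_le.1
  rw [Store.size_elim, Store.size_single, Store.size_single] at hsp
  change s' ≤ sz x + 0 + t' at hsp
  rw [Store.single_inl i (), Store.single_inl i ()]
  exact ⟨_, _, Exec.seq h' h, by omega, max_le (by omega) hs⟩

/-- Iteration of a polynomial-time function. -/
theorem iterate {g : Bool × β → Bool × β} (hg : PolyFun g) {init : α → Bool × β}
    (hi : PolyFun init) {R B : α → ℕ} (hR : PolyBdd R) (hB : PolyBdd B)
    (hrun : ∀ a, ∀ j < R a, (g^[j] (init a)).1 = true)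
    (hfinal : ∀ a, (g^[R a] (init a)).1 = false)
    (hS : ∀ a, ∀ j ≤ R a, sz (g^[j] (init a)) ≤ B a) :
    PolyFun fun a => g^[R a] (init a) := by
  obtain ⟨V, _, _, i, c, b, ⟨k, hb⟩, hc⟩ := hg
  obtain ⟨l, hl⟩ := hB
  have hk : PolyBdd fun a : α => ((sz a + 2) ^ l + 2) ^ k := by
    refine ⟨(l + 2) * k, fun a => ?_⟩
    rw [pow_mul]
    refine Nat.pow_le_pow_left ?_ k
    have h₂ : 1 ≤ (sz a + 2) ^ l := Nat.one_le_pow _ _ (by omega)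
    have h₃ : 4 ≤ (sz a + 2) ^ 2 := by nlinarith [Nat.zero_le (sz a)]
    rw [pow_add]
    nlinarith
  have hl' : PolyBdd fun a : α => (sz a + 2) ^ l := ⟨l, fun a => le_rfl⟩
  refine hi.comp_of_runsIn (c' := c.repeat i) (j := Sum.inl i)
    (b' := fun a => 2 + (sz a + 2) ^ l + R a * (((sz a + 2) ^ l + 2) ^ k + (sz a + 2) ^ l + 2))
    ?_ (hl'.mono fun a => (hS a _ le_rfl).trans (hl a)) fun a => ?_
  · exact ((PolyBdd.const 2).add hl').add (hR.mul ((hk.add hl').add (PolyBdd.const 2)))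
  · obtain ⟨t, s, h, ht, -⟩ := runsIn_repeat (g := g) (S := (sz a + 2) ^ l)
      (T := ((sz a + 2) ^ l + 2) ^ k) (c := c) (i := i)
      (fun y hy => (hc y).mono ((hb y).trans (Nat.pow_le_pow_left (by omega) k)))
      (R a) (init a) (hrun a) (hfinal a) (fun j hj => (hS a j hj).trans (hl a))
    exact ⟨t, s, h, ht⟩

end PolyFun

end TreeWidthSat
-- Lists, Booleans and unary numbers in polynomial time
namespace TreeWidthSat
open Enc

/-- Case distinction on a list. -/
def listCase {β γ : Type} (l : List β) (x : γ) (f : β → List β → γ) : γ :=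
  match l with
  | [] => x
  | b :: t => f b t

@[simp] theorem listCase_nil {β γ : Type} (x : γ) (f : β → List β → γ) :
    listCase [] x f = x := rfl

@[simp] theorem listCase_cons {β γ : Type} (b : β) (t : List β) (x : γ) (f : β → List β → γ) :
    listCase (b :: t) x f = f b t := rfl

/-- Case distinction on a natural number. -/
def natCase {γ : Type} (n : ℕ) (x : γ) (f : ℕ → γ) : γ :=
  match n with
  | 0 => x
  | m + 1 => f m

@[simp] theorem natCase_zero {γ : Type} (x : γ) (f : ℕ → γ) : natCase 0 x f = x := rfl

@[simp] theorem natCase_succ {γ : Type} (n : ℕ) (x : γ) (f : ℕ → γ) :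
    natCase (n + 1) x f = f n := rfl

theorem PolyBdd.pow {α : Type} [Enc α] {b : α → ℕ} (hb : PolyBdd b) (k : ℕ) :
    PolyBdd fun a => b a ^ k := by
  obtain ⟨l, hl⟩ := hb
  exact ⟨l * k, fun a => by rw [pow_mul]; exact Nat.pow_le_pow_left (hl a) k⟩

namespace PolyFun

variable {α β γ δ σ : Type} [Enc α] [Enc β] [Enc γ] [Enc δ] [Enc σ]

theorem of_enc_eq_comp {f : α → β} {g : α → γ} (hf : PolyFun f) (h : ∀ a, enc (g a) = enc (f a)) :
    PolyFun g := by
  obtain ⟨V, i₁, i₂, i, c, t, ht, hc⟩ := hf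
  exact ⟨V, i₁, i₂, i, c, t, ht, fun a => by rw [h a]; exact hc a⟩

theorem data_const (d : Data) : PolyFun fun _ : α => d := by
  induction d with
  | nil => exact of_enc_eq_nil fun _ => rfl
  | cons d e hd he =>
    have : PolyFun fun p : Data × Data => Data.cons p.1 p.2 := of_enc_eq fun _ => rfl
    exact this.comp (hd.prodMk he)

@[fun_prop]
theorem const (b : β) : PolyFun fun _ : α => b :=
  (data_const (enc b)).of_enc_eq_comp fun _ => rfl

theorem fst' : PolyFun fun p : α × β => p.1 := of_enc_eq_head fun _ => rfl

theorem snd' : PolyFun fun p : α × β => p.2 := of_enc_eq_tail fun _ => rfl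

@[fun_prop]
theorem fst {f : α → β × γ} (hf : PolyFun f) : PolyFun fun a => (f a).1 := fst'.comp hf

@[fun_prop]
theorem snd {f : α → β × γ} (hf : PolyFun f) : PolyFun fun a => (f a).2 := snd'.comp hf

@[fun_prop]
theorem subtype_val {p : α → Prop} : PolyFun fun a : {a // p a} => a.1 :=
  of_enc_eq fun _ => rfl

@[fun_prop]
theorem ite {p : α → Bool} {f g : α → β} (hp : PolyFun p) (hf : PolyFun f) (hg : PolyFun g) :
    PolyFun fun a => if p a = true then f a else g a := by
  refine hp.cases ?_ ?_
  · have : (fun a : {a // enc (p a) ≠ Data.nil} => if p a.1 = true then f a.1 else g a.1)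
        = fun a => f a.1 := by
      funext ⟨a, ha⟩
      cases hpa : p a
      · exact absurd (by rw [hpa]; rfl) ha
      · simp
    rw [this]
    exact hf.comp subtype_val
  · have : (fun a : {a // enc (p a) = Data.nil} => if p a.1 = true then f a.1 else g a.1)
        = fun a => g a.1 := by
      funext ⟨a, ha⟩
      cases hpa : p a
      · simp
      · rw [hpa] at ha
        cases ha
    rw [this]
    exact hg.comp subtype_val

@[fun_prop]
theorem listCase {l : α → List β} {x : α → γ} {f : α → β → List β → γ} (hl : PolyFun l)
    (hx : PolyFun x) (hf : PolyFun fun p : α × (β × List β) => f p.1 p.2.1 p.2.2) :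
    PolyFun fun a => TreeWidthSat.listCase (l a) (x a) (f a) := by
  refine hl.cases ?_ ?_
  · have hne : ∀ a : {a // enc (l a) ≠ Data.nil}, l a.1 ≠ [] := by
      rintro ⟨a, ha⟩ h
      exact ha (by simp only at h; rw [h]; rfl)
    -- A nonempty list and the pair of its head and tail have the same encoding, so taking the list
    -- apart costs nothing.
    have h₁ : PolyFun fun a : {a // enc (l a) ≠ Data.nil} =>
        (a.1, ((l a.1).head (hne a), (l a.1).tail)) := by
      refine prodMk subtype_val ((hl.comp subtype_val).of_enc_eq_comp fun a => ?_)
      conv_rhs => rw [← List.cons_head_tail (hne a)]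
      rfl
    convert hf.comp h₁ using 2 with a
    conv_lhs => rw [← List.cons_head_tail (hne a)]
    rfl
  · convert hx.comp subtype_val using 2 with a
    obtain ⟨a, ha⟩ := a
    cases h : l a with
    | nil => rfl
    | cons b t => rw [h] at ha; cases ha

@[fun_prop]
theorem cons {f : α → β} {g : α → List β} (hf : PolyFun f) (hg : PolyFun g) :
    PolyFun fun a => f a :: g a := by
  have : PolyFun fun p : β × List β => p.1 :: p.2 := of_enc_eq fun _ => rfl
  exact this.comp (hf.prodMk hg)

@[fun_prop]
theorem isEmpty {l : α → List β} (hl : PolyFun l) : PolyFun fun a => (l a).isEmpty := by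
  have : PolyFun fun a => TreeWidthSat.listCase (l a) true fun _ _ => false := by fun_prop
  convert this using 2 with a
  cases l a <;> rfl

@[fun_prop]
theorem not {p : α → Bool} (hp : PolyFun p) : PolyFun fun a => !(p a) := by
  have : PolyFun fun a => if p a = true then false else true := by fun_prop
  convert this using 2 with a
  cases p a <;> rfl

@[fun_prop]
theorem and {p q : α → Bool} (hp : PolyFun p) (hq : PolyFun q) :
    PolyFun fun a => p a && q a := by
  have : PolyFun fun a => if p a = true then q a else false := by fun_prop
  convert this using 2 with a
  cases p a <;> rfl

@[fun_prop]
theorem or {p q : α → Bool} (hp : PolyFun p) (hq : PolyFun q) :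
    PolyFun fun a => p a || q a := by
  have : PolyFun fun a => if p a = true then true else q a := by fun_prop
  convert this using 2 with a
  cases p a <;> rfl

@[fun_prop]
theorem xor {p q : α → Bool} (hp : PolyFun p) (hq : PolyFun q) :
    PolyFun fun a => Bool.xor (p a) (q a) := by
  have : PolyFun fun a => if p a = true then !(q a) else q a := by fun_prop
  convert this using 2 with a
  cases p a <;> cases q a <;> rfl

@[fun_prop]
theorem bool_beq {p q : α → Bool} (hp : PolyFun p) (hq : PolyFun q) :
    PolyFun fun a => p a == q a := by
  have : PolyFun fun a => !(Bool.xor (p a) (q a)) := by fun_prop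
  convert this using 2 with a
  cases p a <;> cases q a <;> rfl

/-- The bound on all partial results is indispensable: repeating a polynomial-time step, such as
doubling a list, can produce exponentially large values. -/
theorem foldl {l : α → List β} {i : α → σ} {f : α → σ → β → σ} (hl : PolyFun l)
    (hi : PolyFun i) (hf : PolyFun fun p : α × (σ × β) => f p.1 p.2.1 p.2.2) {B : α → ℕ}
    (hB : PolyBdd B) (h : ∀ a l', l' <+: l a → sz (l'.foldl (f a) (i a)) ≤ B a) :
    PolyFun fun a => (l a).foldl (f a) (i a) := by
  -- The state of the loop: the flag that some of the list is left, the parameter, the accumulator,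
  -- and the rest of the list.
  let g : Bool × (α × (σ × List β)) → Bool × (α × (σ × List β)) := fun x =>
    TreeWidthSat.listCase x.2.2.2 (false, x.2) fun b t =>
      (!t.isEmpty, (x.2.1, (f x.2.1 x.2.2.1 b, t)))
  have hg : PolyFun g := by
    have : PolyFun fun p : (Bool × (α × (σ × List β))) × (β × List β) =>
        f p.1.2.1 p.1.2.2.1 p.2.1 :=
      hf.comp (f := fun p : (Bool × (α × (σ × List β))) × (β × List β) =>
        (p.1.2.1, (p.1.2.2.1, p.2.1))) (by fun_prop)
    fun_prop
  let init : α → Bool × (α × (σ × List β)) := fun a => (!(l a).isEmpty, (a, (i a, l a)))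
  have hinit : PolyFun init := by fun_prop
  have hit : ∀ a, ∀ j ≤ (l a).length, g^[j] (init a) =
      (!((l a).drop j).isEmpty, (a, (((l a).take j).foldl (f a) (i a), (l a).drop j))) := by
    intro a j hj
    induction j with
    | zero => simp [init]
    | succ j ih =>
      rw [Function.iterate_succ_apply', ih (by omega), List.drop_eq_getElem_cons (by omega)]
      simp only [g, listCase_cons, List.take_add_one, List.foldl_append]
      rw [List.getElem?_eq_getElem (by omega)]
      rfl
  have := iterate hg hinit (R := fun a => (l a).length)
    (B := fun a => 1 + (sz a + (B a + sz (l a) + 1) + 1) + 1)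
    (hl.size.mono fun a => length_le_sz _)
    (((PolyBdd.const 1).add ((PolyBdd.sz.add ((hB.add hl.size).add (PolyBdd.const 1))).add
      (PolyBdd.const 1))).add (PolyBdd.const 1)) ?_ ?_ ?_
  · have h' : PolyFun fun a => (g^[(l a).length] (init a)).2.2.1 := by fun_prop
    convert h' using 2 with a
    rw [hit a _ le_rfl]
    simp
  · intro a j hj
    rw [hit a j hj.le]
    simpa using hj
  · intro a
    rw [hit a _ le_rfl]
    simp
  · intro a j hj
    rw [hit a j hj]
    have h₁ := h a _ (List.take_prefix j (l a))
    have h₂ := sz_le_of_sublist (List.drop_sublist j (l a))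
    have h₃ := sz_bool_le (!((l a).drop j).isEmpty)
    simp only [sz_pair]
    omega

@[fun_prop]
theorem reverse {l : α → List β} (hl : PolyFun l) : PolyFun fun a => (l a).reverse := by
  have h : ∀ l' : List β, l'.foldl (fun acc b => b :: acc) [] = l'.reverse := by
    intro l'
    simp
  have := foldl hl (const ([] : List β)) (f := fun _ acc b => b :: acc) (by fun_prop) hl.size
    (fun a l' hl' => by rw [h, sz_reverse]; exact sz_le_of_sublist hl'.sublist)
  simpa only [h] using this

@[fun_prop]
theorem append {l l' : α → List β} (hl : PolyFun l) (hl' : PolyFun l') :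
    PolyFun fun a => l a ++ l' a := by
  have h : ∀ l₁ l₂ : List β, l₁.foldl (fun acc b => b :: acc) l₂ = l₁.reverse ++ l₂ := by
    intro l₁ l₂
    simp
  have := foldl hl.reverse hl' (f := fun _ acc b => b :: acc) (by fun_prop)
    (hl.size.add hl'.size) (fun a l₁ h₁ => by
      have := sz_le_of_sublist h₁.sublist
      rw [sz_reverse] at this
      rw [h, sz_append, sz_reverse]
      omega)
  simpa only [h, List.reverse_reverse] using this

@[fun_prop]
theorem flatMap {l : α → List β} {f : α → β → List γ} (hl : PolyFun l)
    (hf : PolyFun fun p : α × β => f p.1 p.2) : PolyFun fun a => (l a).flatMap (f a) := by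
  have h : ∀ a (l' : List β) (acc : List γ),
      l'.foldl (fun acc b => acc ++ f a b) acc = acc ++ l'.flatMap (f a) := by
    intro a l'
    induction l' with
    | nil => simp
    | cons b l' ih => intro acc; simp [ih]
  obtain ⟨k, hk⟩ := hf.size
  have hf' : PolyFun fun p : α × (List γ × β) => f p.1 p.2.2 :=
    hf.comp (f := fun p : α × (List γ × β) => (p.1, p.2.2)) (by fun_prop)
  have hB : PolyBdd fun a => sz (l a) * (sz a + sz (l a) + 3) ^ k :=
    hl.size.mul (((PolyBdd.sz.add hl.size).add (PolyBdd.const 3)).pow k)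
  have := foldl hl (const ([] : List γ)) (f := fun a acc b => acc ++ f a b) (by fun_prop)
    hB (fun a l' hl' => by
      have hs := length_le_sz (l a)
      have hb : ∀ b ∈ l a, sz (f a b) ≤ (sz a + sz (l a) + 3) ^ k := by
        intro b hb
        refine (hk (a, b)).trans (Nat.pow_le_pow_left ?_ k)
        have := sz_le_of_mem hb
        simp only [sz_pair]
        omega
      rw [h, List.nil_append]
      refine le_trans ?_ (Nat.mul_le_mul_right _ (hl'.length_le.trans hs))
      replace hb : ∀ b ∈ l', sz (f a b) ≤ (sz a + sz (l a) + 3) ^ k := fun b h' =>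
        hb b (hl'.subset h')
      clear hl' hs
      induction l' with
      | nil => simp
      | cons b t ih =>
        have h₁ := hb b (by simp)
        have h₂ := ih fun b hb' => hb b (by simp [hb'])
        simp only [List.flatMap_cons, sz_append, List.length_cons, Nat.succ_mul]
        omega)
  simpa only [h, List.nil_append] using this

@[fun_prop]
theorem map {l : α → List β} {f : α → β → γ} (hl : PolyFun l)
    (hf : PolyFun fun p : α × β => f p.1 p.2) : PolyFun fun a => (l a).map (f a) := by
  have : PolyFun fun a => (l a).flatMap fun b => [f a b] := by fun_prop
  convert this using 2 with a
  exact List.map_eq_flatMap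

@[fun_prop]
theorem filter {l : α → List β} {p : α → β → Bool} (hl : PolyFun l)
    (hp : PolyFun fun x : α × β => p x.1 x.2) : PolyFun fun a => (l a).filter (p a) := by
  have : PolyFun fun a => (l a).flatMap fun b => if p a b = true then [b] else [] := by fun_prop
  convert this using 2 with a
  induction l a with
  | nil => rfl
  | cons b t ih => cases h : p a b <;> simp [h, ih]

@[fun_prop]
theorem any {l : α → List β} {p : α → β → Bool} (hl : PolyFun l)
    (hp : PolyFun fun x : α × β => p x.1 x.2) : PolyFun fun a => (l a).any (p a) := by
  have : PolyFun fun a => !((l a).filter (p a)).isEmpty := by fun_prop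
  convert this using 2 with a
  induction l a with
  | nil => rfl
  | cons b t ih => cases h : p a b <;> simp [h, ih]

@[fun_prop]
theorem all {l : α → List β} {p : α → β → Bool} (hl : PolyFun l)
    (hp : PolyFun fun x : α × β => p x.1 x.2) : PolyFun fun a => (l a).all (p a) := by
  have : PolyFun fun a => !(l a).any fun b => !(p a b) := by fun_prop
  convert this using 2 with a
  induction l a with
  | nil => rfl
  | cons b t ih => cases h : p a b <;> simp [h, ih]

@[fun_prop]
theorem succ {f : α → ℕ} (hf : PolyFun f) : PolyFun fun a => f a + 1 :=
  ((const Data.nil).prodMk hf).of_enc_eq_comp fun _ => rfl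

@[fun_prop]
theorem length {l : α → List β} (hl : PolyFun l) : PolyFun fun a => (l a).length := by
  have h : ∀ l' : List β, l'.foldl (fun n _ => n + 1) 0 = l'.length := fun l' => by simp
  have := foldl hl (const (0 : ℕ)) (f := fun _ n _ => n + 1) (by fun_prop) hl.size
    (fun a l' hl' => by
      rw [h, sz_nat]
      exact hl'.length_le.trans (length_le_sz _))
  simpa only [h] using this

@[fun_prop]
theorem replicate {n : α → ℕ} {f : α → β} (hn : PolyFun n) (hf : PolyFun f) :
    PolyFun fun a => List.replicate (n a) (f a) := by
  -- Numbers are encoded in unary, so a number already is a list of `nil`s.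
  have h₁ : PolyFun fun a => List.replicate (n a) Data.nil :=
    hn.of_enc_eq_comp fun a => by simp [enc]
  have : PolyFun fun a => (List.replicate (n a) Data.nil).map fun _ => f a := by fun_prop
  convert this using 2 with a
  rw [List.map_replicate]

@[fun_prop]
theorem natCase {n : α → ℕ} {x : α → γ} {f : α → ℕ → γ} (hn : PolyFun n)
    (hx : PolyFun x) (hf : PolyFun fun p : α × ℕ => f p.1 p.2) :
    PolyFun fun a => TreeWidthSat.natCase (n a) (x a) (f a) := by
  have : PolyFun fun a => TreeWidthSat.listCase (List.replicate (n a) false) (x a)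
      fun _ t => f a t.length := by
    have : PolyFun fun p : α × (Bool × List Bool) => f p.1 p.2.2.length :=
      hf.comp (f := fun p : α × (Bool × List Bool) => (p.1, p.2.2.length)) (by fun_prop)
    fun_prop
  convert this using 2 with a
  cases n a with
  | zero => rfl
  | succ m => simp [List.replicate_succ]

@[fun_prop]
theorem sub {m n : α → ℕ} (hm : PolyFun m) (hn : PolyFun n) : PolyFun fun a => m a - n a := by
  have h : ∀ k j : ℕ, (List.replicate k false).foldl (fun i _ => i - 1) j = j - k := by
    intro k
    induction k with
    | zero => simp
    | succ k ih => intro j; rw [List.replicate_succ, List.foldl_cons, ih]; omega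
  have hpred : PolyFun fun p : α × (ℕ × Bool) => p.2.1 - 1 := by
    have : PolyFun fun p : α × (ℕ × Bool) => TreeWidthSat.natCase p.2.1 0 fun i => i := by
      fun_prop
    convert this using 2 with p
    cases p.2.1 <;> rfl
  have := foldl (hn.replicate (const false)) hm (f := fun _ i _ => i - 1) hpred hm.size
    (fun a l' hl' => by
      obtain ⟨-, hl'⟩ := List.prefix_replicate_iff.1 hl'
      rw [hl', h, sz_nat, sz_nat]
      omega)
  simpa only [h] using this

@[fun_prop]
theorem ble {m n : α → ℕ} (hm : PolyFun m) (hn : PolyFun n) :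
    PolyFun fun a => Nat.ble (m a) (n a) := by
  have : PolyFun fun a => TreeWidthSat.natCase (m a - n a) true fun _ => false := by fun_prop
  convert this using 2 with a
  rcases h : m a - n a with _ | k
  · exact Nat.ble_eq_true_of_le (by omega)
  · rw [natCase_succ, Bool.eq_false_iff]
    intro h'
    have := Nat.le_of_ble_eq_true h'
    omega

@[fun_prop]
theorem nat_beq {m n : α → ℕ} (hm : PolyFun m) (hn : PolyFun n) :
    PolyFun fun a => m a == n a := by
  have : PolyFun fun a => Nat.ble (m a) (n a) && Nat.ble (n a) (m a) := by fun_prop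
  convert this using 2 with a
  rw [Bool.eq_iff_iff]
  simp only [beq_iff_eq, Bool.and_eq_true, Nat.ble_eq]
  omega

@[fun_prop]
theorem contains {l : α → List ℕ} {n : α → ℕ} (hl : PolyFun l) (hn : PolyFun n) :
    PolyFun fun a => (l a).contains (n a) := by
  have : PolyFun fun a => (l a).any fun b => n a == b := by fun_prop
  convert this using 2 with a
  exact List.contains_eq_any_beq

@[fun_prop]
theorem add {m n : α → ℕ} (hm : PolyFun m) (hn : PolyFun n) : PolyFun fun a => m a + n a := by
  have : PolyFun fun a => (List.replicate (m a) false ++ List.replicate (n a) false).length := by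
    fun_prop
  simpa using this

@[fun_prop]
theorem zipIdx {l : α → List β} {n : α → ℕ} (hl : PolyFun l) (hn : PolyFun n) :
    PolyFun fun a => (l a).zipIdx (n a) := by
  have h : ∀ (l' : List β) (k : ℕ) (acc : List (β × ℕ)), l'.foldl (fun acc b =>
      acc ++ [(b, k + acc.length)]) acc = acc ++ l'.zipIdx (k + acc.length) := by
    intro l' k
    induction l' with
    | nil => simp
    | cons b l' ih => intro acc; simp [ih, add_assoc]
  have hB : PolyBdd fun a => sz (l a) * (sz (l a) + sz (n a) + sz (l a) + 2) :=
    hl.size.mul (((hl.size.add hn.size).add hl.size).add (PolyBdd.const 2))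
  have := foldl hl (const ([] : List (β × ℕ))) (f := fun a acc b => acc ++ [(b, n a + acc.length)])
    (by fun_prop) hB (fun a l' hl' => by
      rw [h, List.nil_append]
      have hs := length_le_sz (l a)
      have hlen := hl'.length_le
      refine (sz_le_of_forall (B := sz (l a) + sz (n a) + sz (l a) + 1) ?_).trans ?_
      · rintro ⟨b, j⟩ hj
        have h₁ := List.mem_zipIdx hj
        have h₂ : b ∈ l' := by
          rw [h₁.2.2]
          exact List.getElem_mem _
        have h₃ := sz_le_of_mem (hl'.subset h₂)
        have h₄ := h₁.2.1
        simp only [sz_pair, sz_nat, List.length_nil] at *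
        omega
      · rw [List.length_zipIdx]
        exact Nat.mul_le_mul_right _ (hlen.trans hs))
  simpa only [h, List.nil_append, List.length_nil, Nat.add_zero] using this

@[fun_prop]
theorem range {n : α → ℕ} (hn : PolyFun n) : PolyFun fun a => List.range (n a) := by
  have : PolyFun fun a => ((List.replicate (n a) false).zipIdx 0).map fun p => p.2 := by fun_prop
  convert this using 2 with a
  change _ = List.map Prod.snd _
  rw [List.zipIdx_map_snd, List.length_replicate, List.range_eq_range']

end PolyFun

end TreeWidthSat
-- The algorithm: binary arithmetic, the stack machine, the reading of the input
namespace TreeWidthSat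
open Enc

/-! ### Arithmetic of bit lists, least significant bit first -/

/-- A binary number. -/
abbrev Num : Type := List Bool

namespace Num

/-- The sum of `a`, `b` and the carry `c`, truncated to the length of `a`. -/
def addCarry : Bool → Num → Num → Num
  | _, [], _ => []
  | c, x :: a, b =>
    listCase b (Bool.xor x c :: addCarry (x && c) a []) fun y t =>
      Bool.xor (Bool.xor x y) c :: addCarry ((x && y) || (c && Bool.xor x y)) a t

/-- The sum of `a` and `b`, truncated to the length of `a`. -/
def add (a b : Num) : Num := addCarry false a b

/-- Zero, with as many digits as `b`. -/
def zeroLike (b : Num) : Num := b.map fun _ => false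

/-- The product of `a` and `b`, truncated to the length of `b`. -/
def mul (a b : Num) : Num :=
  a.reverse.foldl (fun s x => if x = true then add (add s s) b else add s s) (zeroLike b)

/-- The negative of `b` modulo a power of `2`. -/
def neg (b : Num) : Num := mul (b.map fun _ => true) b

/-- The number `1` with `n + 1` digits. -/
def one (n : ℕ) : Num := true :: List.replicate n false

theorem length_addCarry (c : Bool) (a b : Num) : (addCarry c a b).length = a.length := by
  induction a generalizing b c with
  | nil => simp [addCarry]
  | cons x a ih => cases b <;> simp [addCarry, ih]

theorem length_add (a b : Num) : (add a b).length = a.length := length_addCarry _ _ _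

theorem length_foldl (l : Num) (b s : Num) :
    (l.foldl (fun s x => if x = true then add (add s s) b else add s s) s).length = s.length := by
  induction l generalizing s with
  | nil => rfl
  | cons x l ih => rw [List.foldl_cons, ih]; split_ifs <;> simp [length_add]

theorem length_mul (a b : Num) : (mul a b).length = b.length := by
  rw [mul, length_foldl, zeroLike, List.length_map]

theorem sz_le (a : Num) : sz a ≤ 2 * a.length := by
  have := sz_le_of_forall (l := a) (B := 1) fun b _ => sz_bool_le b
  omega

end Num

namespace PolyFun

variable {α : Type} [Enc α]

@[fun_prop]
theorem num_add {a b : α → Num} (ha : PolyFun a) (hb : PolyFun b) :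
    PolyFun fun x => Num.add (a x) (b x) := by
  -- The accumulator consists of the carry, the unread digits of the second summand, and the digits
  -- of the sum produced so far.
  let f : (Bool × Num) × Num → Bool → (Bool × Num) × Num := fun s x =>
    TreeWidthSat.listCase s.1.2 ((x && s.1.1, []), s.2 ++ [Bool.xor x s.1.1]) fun y t =>
      (((x && y) || (s.1.1 && Bool.xor x y), t), s.2 ++ [Bool.xor (Bool.xor x y) s.1.1])
  have hf : ∀ (a : Num) (s : (Bool × Num) × Num),
      (a.foldl f s).2 = s.2 ++ Num.addCarry s.1.1 a s.1.2 := by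
    intro a
    induction a with
    | nil => simp [Num.addCarry]
    | cons x a ih =>
      rintro ⟨⟨c, b⟩, s⟩
      rw [List.foldl_cons, ih]
      cases b <;> simp [f, Num.addCarry]
  have hs : ∀ (a : Num) (s : (Bool × Num) × Num),
      sz (a.foldl f s) ≤ 1 + sz s.1.2 + sz s.2 + 2 * a.length + 2 := by
    intro a
    induction a with
    | nil =>
      rintro ⟨⟨c, b⟩, s⟩
      have := sz_bool_le c
      simp only [List.foldl_nil, sz_pair]
      omega
    | cons x a ih =>
      rintro ⟨⟨c, b⟩, s⟩
      rw [List.foldl_cons]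
      refine (ih _).trans ?_
      cases b with
      | nil =>
        have := sz_bool_le (Bool.xor x c)
        simp only [f, listCase_nil, sz_append, sz_cons, sz_nil, List.length_cons]
        omega
      | cons y t =>
        have := sz_bool_le (Bool.xor (Bool.xor x y) c)
        simp only [f, listCase_cons, sz_append, sz_cons, sz_nil, List.length_cons]
        omega
  have hfp : PolyFun fun p : α × (((Bool × Num) × Num) × Bool) => f p.2.1 p.2.2 := by fun_prop
  have hB : PolyBdd fun x => 3 + sz (b x) + 2 * sz (a x) :=
    ((PolyBdd.const 3).add hb.size).add ((PolyBdd.const 2).mul ha.size)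
  have := foldl (i := fun x => ((false, b x), ([] : Num))) (f := fun _ => f) ha (by fun_prop) hfp hB
    (fun x l hl => by
      have h₁ := hs l ((false, b x), [])
      have h₂ := hl.length_le.trans (length_le_sz (a x))
      simp only [sz_nil] at h₁
      omega)
  have h' : PolyFun fun x => ((a x).foldl f ((false, b x), [])).2 := by fun_prop
  simpa only [Num.add, hf, List.nil_append] using h'

@[fun_prop]
theorem num_mul {a b : α → Num} (ha : PolyFun a) (hb : PolyFun b) :
    PolyFun fun x => Num.mul (a x) (b x) := by
  have hz : PolyFun fun x => Num.zeroLike (b x) := by unfold Num.zeroLike; fun_prop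
  have hf : PolyFun fun p : α × (Num × Bool) =>
      if p.2.2 = true then Num.add (Num.add p.2.1 p.2.1) (b p.1) else Num.add p.2.1 p.2.1 := by
    fun_prop
  exact foldl (f := fun x s y => if y = true then Num.add (Num.add s s) (b x) else Num.add s s)
    ha.reverse hz hf ((PolyBdd.const 2).mul hb.size) (fun x l _ => by
      refine (Num.sz_le _).trans ?_
      rw [Num.length_foldl, Num.zeroLike, List.length_map]
      exact Nat.mul_le_mul_left _ (length_le_sz _))

@[fun_prop]
theorem num_neg {b : α → Num} (hb : PolyFun b) : PolyFun fun x => Num.neg (b x) := by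
  unfold Num.neg
  fun_prop

@[fun_prop]
theorem num_one {n : α → ℕ} (hn : PolyFun n) : PolyFun fun x => Num.one (n x) := by
  unfold Num.one
  fun_prop

end PolyFun

/-! ### The recursion -/

/-- A vertex with a value. -/
abbrev Lit : Type := ℕ × Bool

/-- A partial assignment. -/
abbrev Pat : Type := List Lit

/-- The values of a quantity at some partial assignments. -/
abbrev Table : Type := List (Pat × Num)

/-- Equality of literals. -/
def litEq (a b : Lit) : Bool := a.1 == b.1 && a.2 == b.2

/-- The vertices `x` and `y` occur together in a forbidden pair. -/
def adjB (F : List (Lit × Lit)) (x y : ℕ) : Bool := F.any fun p => p.1.1 == x && p.2.1 == y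

/-- The vertices of `U` that are in `S` or have a neighbour in `S`. -/
def grow (F : List (Lit × Lit)) (U S : List ℕ) : List ℕ :=
  U.filter fun y => S.contains y || S.any fun x => adjB F x y

/-- The component of `x` in `U`. -/
def component (F : List (Lit × Lit)) (U : List ℕ) (x : ℕ) : List ℕ :=
  U.foldl (fun S _ => grow F U S) (U.filter fun y => y == x)

/-- The elements of `U` that are not in `B`. -/
def remove (U B : List ℕ) : List ℕ := U.filter fun y => !B.contains y

/-- All components of `C` without `B` have at most half the size of `C`. -/
def separates (F : List (Lit × Lit)) (C B : List ℕ) : Bool :=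
  (remove C B).all fun y =>
    Nat.ble ((component F (remove C B) y).length + (component F (remove C B) y).length) C.length

/-- The first bag that separates `C`. -/
def separator (F : List (Lit × Lit)) (bags : List (List ℕ)) (C : List ℕ) : List ℕ :=
  listCase (bags.filter fun B => separates F C B) [] fun B _ => B

/-- The part of an assignment on the neighbours of `C`. -/
def restrict (F : List (Lit × Lit)) (C : List ℕ) (τ : Pat) : Pat :=
  τ.filter fun l => C.any fun y => adjB F l.1 y

/-- The assignment `σ` is a part of `τ`. -/
def subPat (σ τ : Pat) : Bool := σ.all fun l => τ.any fun l' => litEq l l'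

/-- Removal of repeated assignments. -/
def dedupPat (E : List Pat) : List Pat :=
  E.foldl (fun acc τ => if (acc.any fun σ => subPat σ τ) = true then acc else τ :: acc) []

/-- The value at an assignment. -/
def lookup (T : Table) (τ : Pat) : Num :=
  listCase (T.filter fun e => subPat e.1 τ) [] fun e _ => e.2

/-- The literal `l` is not forbidden by `τ`. -/
def compat (F : List (Lit × Lit)) (l : Lit) (τ : Pat) : Bool :=
  !(F.any fun p => litEq p.1 l && τ.any fun l' => litEq p.2 l')

/-- The product of the weight of the literal `l` in the presence of `τ` and `v`. -/
def weigh (F : List (Lit × Lit)) (nv : ℕ) (l : Lit) (τ : Pat) (v : Num) : Num :=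
  if compat F l τ = true then if (l.2 && Nat.ble nv l.1) = true then Num.neg v else v
  else Num.zeroLike v

/-- Summation over the values of `x`. -/
def sumTable (F : List (Lit × Lit)) (nv x : ℕ) (E : List Pat) (T₀ T₁ : Table) : Table :=
  E.map fun τ => (τ, Num.add (weigh F nv (x, false) τ (lookup T₀ ((x, false) :: τ)))
    (weigh F nv (x, true) τ (lookup T₁ ((x, true) :: τ))))

/-- The product of two tables. -/
def prodTable (E : List Pat) (T₁ T₂ : Table) : Table :=
  E.map fun τ => (τ, Num.mul (lookup T₁ τ) (lookup T₂ τ))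

/-- A task `(U, P, h, E)`: sum over the values of the vertices in `U`, for all assignments in `E`
to the other vertices; the vertices in `P` come first, and for the first `h` of them the two
values are treated one after the other. -/
abbrev Task : Type := List ℕ × (List ℕ × (ℕ × List Pat))

/-- An unfinished call `(x, E, t, T)`: `x` is the vertex that is summed over (none for a product),
`t` the second call if it is still to be done, and `T` the result of the first call if there is
another one. -/
abbrev Frame : Type := List ℕ × (List Pat × (List Task × List Table))

/-- A state `(t, T, K)`: the current task if there is one, else the result of the last call, and
the stack. -/
abbrev State : Type := List Task × (Table × List Frame)

/-- The forbidden pairs, the number of variables, the bags, the number of vertices of a separator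
that are treated one value after the other, and the number of vertices. -/
abbrev Env : Type := List (Lit × Lit) × (ℕ × (List (List ℕ) × (ℕ × ℕ)))

/-- The results `T₁` and `T₂` of the calls are put together. -/
def finish (e : Env) (x : List ℕ) (E : List Pat) (T₁ T₂ : Table) : Table :=
  listCase x (prodTable E T₁ T₂) fun y _ => sumTable e.1 e.2.1 y E T₁ T₂

/-- Extension of all assignments by a literal. -/
def extend (l : Lit) (E : List Pat) : List Pat := E.map fun τ => l :: τ

/-- The task of a component. -/
def componentTask (e : Env) (C : List ℕ) (E : List Pat) : Task :=
  (C, (C.filter fun y => (separator e.1 e.2.2.1 C).contains y, (e.2.2.2.1,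
    dedupPat (E.map fun τ => restrict e.1 C τ))))

/-- A step in the evaluation of a task. -/
def callStep (e : Env) (t : Task) (K : List Frame) : State :=
  listCase t.1 ([], (t.2.2.2.map fun τ => (τ, Num.one e.2.2.2.2), K)) fun x _ =>
    listCase t.2.1
      -- No vertex is pending: split off the component of the first vertex, and leave the rest as a
      -- second call whose result is multiplied in.
      ([componentTask e (component e.1 t.1 x) t.2.2.2],
        ([], ([], (t.2.2.2, ([(remove t.1 (component e.1 t.1 x), ([], (0, t.2.2.2)))], []))) :: K))
      -- While the counter is positive, the two values of `y` become two calls. At zero they are put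
      -- into one batch, which doubles the table and not the number of calls.
      fun y P => natCase t.2.2.1
        ([(remove t.1 [y], (P, (0, extend (y, false) t.2.2.2 ++ extend (y, true) t.2.2.2)))],
          ([], ([y], (t.2.2.2, ([], []))) :: K))
        fun h => ([(remove t.1 [y], (P, (h, extend (y, false) t.2.2.2)))],
          ([], ([y], (t.2.2.2, ([(remove t.1 [y], (P, (h, extend (y, true) t.2.2.2)))], [])))
            :: K))

/-- A step after the end of a call with the result `T`. -/
def returnStep (e : Env) (T : Table) (fr : Frame) (K : List Frame) : State :=
  listCase fr.2.2.1
    ([], (finish e fr.1 fr.2.1 (listCase fr.2.2.2 T fun T₁ _ => T₁) T, K))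
    fun t _ => ([t], ([], (fr.1, (fr.2.1, ([], [T]))) :: K))

/-- A step of the recursion. -/
def step (e : Env) (s : State) : State :=
  listCase s.1 (listCase s.2.2 s fun fr K => returnStep e s.2.1 fr K)
    fun t _ => callStep e t s.2.2

/-- There is something left to do. -/
def running (s : State) : Bool := !(s.1.isEmpty && s.2.2.isEmpty)

/-- A step of the recursion with its environment. -/
def envStep (s : Bool × (Env × State)) : Bool × (Env × State) :=
  (running (step s.2.1 s.2.2), (s.2.1, step s.2.1 s.2.2))

namespace PolyFun

variable {α : Type} [Enc α] {F : α → List (Lit × Lit)} {U S C B P : α → List ℕ} {x y nv : α → ℕ}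
  {l l' : α → Lit} {τ σ : α → Pat} {E : α → List Pat} {T T₀ T₁ : α → Table} {e : α → Env}

@[fun_prop]
theorem litEq (hl : PolyFun l) (hl' : PolyFun l') :
    PolyFun fun a => TreeWidthSat.litEq (l a) (l' a) := by
  unfold TreeWidthSat.litEq
  fun_prop

@[fun_prop]
theorem adjB (hF : PolyFun F) (hx : PolyFun x) (hy : PolyFun y) :
    PolyFun fun a => TreeWidthSat.adjB (F a) (x a) (y a) := by
  unfold TreeWidthSat.adjB
  fun_prop

@[fun_prop]
theorem grow (hF : PolyFun F) (hU : PolyFun U) (hS : PolyFun S) :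
    PolyFun fun a => TreeWidthSat.grow (F a) (U a) (S a) := by
  unfold TreeWidthSat.grow
  fun_prop

@[fun_prop]
theorem component (hF : PolyFun F) (hU : PolyFun U) (hx : PolyFun x) :
    PolyFun fun a => TreeWidthSat.component (F a) (U a) (x a) := by
  refine foldl (f := fun a S _ => TreeWidthSat.grow (F a) (U a) S) hU (by fun_prop) (by fun_prop)
    hU.size fun a l' _ => ?_
  -- Every stage is a sublist of `U`, so nothing grows.
  induction l' using List.reverseRecOn with
  | nil => exact sz_le_of_sublist List.filter_sublist
  | append_singleton t b _ =>
    rw [List.foldl_append]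
    exact sz_le_of_sublist List.filter_sublist

@[fun_prop]
theorem remove (hU : PolyFun U) (hB : PolyFun B) :
    PolyFun fun a => TreeWidthSat.remove (U a) (B a) := by
  unfold TreeWidthSat.remove
  fun_prop

@[fun_prop]
theorem separates (hF : PolyFun F) (hC : PolyFun C) (hB : PolyFun B) :
    PolyFun fun a => TreeWidthSat.separates (F a) (C a) (B a) := by
  unfold TreeWidthSat.separates
  fun_prop

@[fun_prop]
theorem separator {bags : α → List (List ℕ)} (hF : PolyFun F) (hb : PolyFun bags)
    (hC : PolyFun C) : PolyFun fun a => TreeWidthSat.separator (F a) (bags a) (C a) := by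
  unfold TreeWidthSat.separator
  fun_prop

@[fun_prop]
theorem restrict (hF : PolyFun F) (hC : PolyFun C) (hτ : PolyFun τ) :
    PolyFun fun a => TreeWidthSat.restrict (F a) (C a) (τ a) := by
  unfold TreeWidthSat.restrict
  fun_prop

@[fun_prop]
theorem subPat (hσ : PolyFun σ) (hτ : PolyFun τ) :
    PolyFun fun a => TreeWidthSat.subPat (σ a) (τ a) := by
  unfold TreeWidthSat.subPat
  fun_prop

@[fun_prop]
theorem dedupPat (hE : PolyFun E) : PolyFun fun a => TreeWidthSat.dedupPat (E a) := by
  refine foldl (f := fun a acc τ => if (acc.any fun σ => TreeWidthSat.subPat σ τ) = true then acc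
    else τ :: acc) hE (const []) (by fun_prop) hE.size fun a l' hl' => ?_
  refine le_trans ?_ (sz_le_of_sublist hl'.sublist)
  clear hl'
  induction l' using List.reverseRecOn with
  | nil => simp
  | append_singleton t b ih =>
    rw [List.foldl_append, List.foldl_cons, List.foldl_nil, sz_append, sz_cons]
    split_ifs
    · omega
    · rw [sz_cons]
      omega

@[fun_prop]
theorem lookup (hT : PolyFun T) (hτ : PolyFun τ) :
    PolyFun fun a => TreeWidthSat.lookup (T a) (τ a) := by
  unfold TreeWidthSat.lookup
  fun_prop

@[fun_prop]
theorem compat (hF : PolyFun F) (hl : PolyFun l) (hτ : PolyFun τ) :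
    PolyFun fun a => TreeWidthSat.compat (F a) (l a) (τ a) := by
  unfold TreeWidthSat.compat
  fun_prop

@[fun_prop]
theorem weigh {v : α → Num} (hF : PolyFun F) (hn : PolyFun nv) (hl : PolyFun l) (hτ : PolyFun τ)
    (hv : PolyFun v) :
    PolyFun fun a => TreeWidthSat.weigh (F a) (nv a) (l a) (τ a) (v a) := by
  unfold TreeWidthSat.weigh Num.zeroLike
  fun_prop

@[fun_prop]
theorem sumTable (hF : PolyFun F) (hn : PolyFun nv) (hx : PolyFun x) (hE : PolyFun E)
    (h₀ : PolyFun T₀) (h₁ : PolyFun T₁) :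
    PolyFun fun a => TreeWidthSat.sumTable (F a) (nv a) (x a) (E a) (T₀ a) (T₁ a) := by
  unfold TreeWidthSat.sumTable
  fun_prop

@[fun_prop]
theorem prodTable (hE : PolyFun E) (h₀ : PolyFun T₀) (h₁ : PolyFun T₁) :
    PolyFun fun a => TreeWidthSat.prodTable (E a) (T₀ a) (T₁ a) := by
  unfold TreeWidthSat.prodTable
  fun_prop

@[fun_prop]
theorem finish (he : PolyFun e) (hx : PolyFun U) (hE : PolyFun E)
    (h₀ : PolyFun T₀) (h₁ : PolyFun T₁) :
    PolyFun fun a => TreeWidthSat.finish (e a) (U a) (E a) (T₀ a) (T₁ a) := by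
  unfold TreeWidthSat.finish
  fun_prop

@[fun_prop]
theorem extend (hl : PolyFun l) (hE : PolyFun E) :
    PolyFun fun a => TreeWidthSat.extend (l a) (E a) := by
  unfold TreeWidthSat.extend
  fun_prop

@[fun_prop]
theorem componentTask (he : PolyFun e) (hC : PolyFun C) (hE : PolyFun E) :
    PolyFun fun a => TreeWidthSat.componentTask (e a) (C a) (E a) := by
  unfold TreeWidthSat.componentTask
  fun_prop

@[fun_prop]
theorem callStep {t : α → Task} {K : α → List Frame} (he : PolyFun e) (ht : PolyFun t)
    (hK : PolyFun K) : PolyFun fun a => TreeWidthSat.callStep (e a) (t a) (K a) := by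
  unfold TreeWidthSat.callStep
  fun_prop

@[fun_prop]
theorem returnStep {fr : α → Frame} {K : α → List Frame} (he : PolyFun e) (hT : PolyFun T)
    (hf : PolyFun fr) (hK : PolyFun K) :
    PolyFun fun a => TreeWidthSat.returnStep (e a) (T a) (fr a) (K a) := by
  unfold TreeWidthSat.returnStep
  fun_prop

/-- The parameter `q` enters only through the initial environment, so the polynomial obtained here
is the same for all `q`. -/
theorem envStep : PolyFun TreeWidthSat.envStep := by
  unfold TreeWidthSat.envStep TreeWidthSat.running TreeWidthSat.step
  fun_prop

end PolyFun

/-! ### Reading the input -/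

/-- An input: clauses and nodes. -/
abbrev Input : Type := List (List Bool × List Bool) × List (List Bool × (List Bool × List Bool))

/-- The positions of `true` in `l`, counted from `k`. -/
def positions (k : ℕ) (l : List Bool) : List ℕ :=
  ((l.zipIdx k).filter fun p => p.1).map fun p => p.2

/-- The number of variables. -/
def inputVars (i : Input) : ℕ := listCase i.2 0 fun t _ => t.2.1.length

/-- The number of clauses. -/
def inputClauses (i : Input) : ℕ := listCase i.2 0 fun t _ => t.2.2.length

/-- The literals of a clause. -/
def clauseLits (c : List Bool × List Bool) : List Lit :=
  ((positions 0 c.1).map fun v => (v, true)) ++ (positions 0 c.2).map fun v => (v, false)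

/-- The forbidden pairs: a clause with the value `true` and a literal that occurs in it. -/
def inputForbidden (i : Input) : List (Lit × Lit) :=
  (i.1.zipIdx (inputVars i)).flatMap fun c =>
    ((clauseLits c.1).map fun l => (l, (c.2, true))) ++
      (clauseLits c.1).map fun l => ((c.2, true), l)

/-- The bags. -/
def inputBags (i : Input) : List (List ℕ) :=
  i.2.map fun t => positions 0 t.2.1 ++ positions (inputVars i) t.2.2

/-- The maximal size of a bag. -/
def inputWidth (i : Input) : ℕ :=
  (inputBags i).foldl (fun m B => if Nat.ble m B.length = true then B.length else m) 0

/-- The number `w - w / (q + 1)`. -/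
def decrease (q w : ℕ) : ℕ :=
  ((List.replicate w false).foldl (fun (s : ℕ × ℕ) _ =>
    natCase s.1 (q, s.2) fun r => (r, s.2 + 1)) (q, 0)).2

/-- The maximal degree of the tree is at most `2`. -/
def inputPath (i : Input) : Bool := i.2.all fun t => Nat.ble (t.1.filter fun b => b).length 2

/-- The environment. -/
def inputEnv (q : ℕ) (i : Input) : Env :=
  (inputForbidden i, (inputVars i, (inputBags i,
    (if inputPath i = true then decrease q (inputWidth i) else inputWidth i,
      inputVars i + inputClauses i))))

/-- The initial state. -/
def inputState (q : ℕ) (i : Input) : Bool × (Env × State) :=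
  (true, (inputEnv q i, ([(List.range (inputVars i + inputClauses i), ([], (0, [[]])))], ([], []))))

/-- The answer. -/
def answer (s : Bool × (Env × State)) : Bool := s.2.2.2.1.any fun e => e.2.any fun b => b

namespace PolyFun

variable {α : Type} [Enc α]

@[fun_prop]
theorem positions {k : α → ℕ} {l : α → List Bool} (hk : PolyFun k) (hl : PolyFun l) :
    PolyFun fun a => TreeWidthSat.positions (k a) (l a) := by
  unfold TreeWidthSat.positions
  fun_prop

@[fun_prop]
theorem inputVars {i : α → Input} (hi : PolyFun i) :
    PolyFun fun a => TreeWidthSat.inputVars (i a) := by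
  unfold TreeWidthSat.inputVars
  fun_prop

@[fun_prop]
theorem inputClauses {i : α → Input} (hi : PolyFun i) :
    PolyFun fun a => TreeWidthSat.inputClauses (i a) := by
  unfold TreeWidthSat.inputClauses
  fun_prop

@[fun_prop]
theorem clauseLits {c : α → List Bool × List Bool} (hc : PolyFun c) :
    PolyFun fun a => TreeWidthSat.clauseLits (c a) := by
  unfold TreeWidthSat.clauseLits
  fun_prop

@[fun_prop]
theorem inputForbidden : PolyFun TreeWidthSat.inputForbidden := by
  unfold TreeWidthSat.inputForbidden
  fun_prop

@[fun_prop]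
theorem inputBags : PolyFun TreeWidthSat.inputBags := by
  unfold TreeWidthSat.inputBags
  fun_prop

@[fun_prop]
theorem inputWidth : PolyFun TreeWidthSat.inputWidth := by
  refine foldl (f := fun _ m B => if Nat.ble m B.length = true then B.length else m) inputBags
    (const 0) (by fun_prop) inputBags.size fun a l' hl' => ?_
  refine le_trans ?_ (sz_le_of_sublist hl'.sublist)
  clear hl'
  rw [sz_nat]
  induction l' using List.reverseRecOn with
  | nil => simp
  | append_singleton t b ih =>
    rw [List.foldl_append, List.foldl_cons, List.foldl_nil, sz_append, sz_cons]
    have := length_le_sz b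
    split_ifs <;> omega

theorem sz_decrease_foldl (q : ℕ) (l : List Bool) (s : ℕ × ℕ) (hs : s.1 ≤ q) :
    sz (l.foldl (fun (s : ℕ × ℕ) _ => TreeWidthSat.natCase s.1 (q, s.2) fun r => (r, s.2 + 1)) s)
      ≤ q + s.2 + l.length + 1 := by
  induction l generalizing s with
  | nil =>
    rw [List.foldl_nil, sz_prod, sz_nat, sz_nat, List.length_nil]
    omega
  | cons b t ih =>
    rw [List.foldl_cons, List.length_cons]
    rcases s with ⟨_ | r, j⟩
    · refine (ih _ le_rfl).trans ?_
      simp only [natCase_zero]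
      omega
    · simp only at hs
      refine (ih _ (by simp only [natCase_succ]; omega)).trans ?_
      simp only [natCase_succ]
      omega

@[fun_prop]
theorem decrease (q : ℕ) {w : α → ℕ} (hw : PolyFun w) :
    PolyFun fun a => TreeWidthSat.decrease q (w a) := by
  have := foldl (l := fun a => List.replicate (w a) false) (i := fun _ => (q, 0))
    (f := fun _ (s : ℕ × ℕ) _ => TreeWidthSat.natCase s.1 (q, s.2) fun r => (r, s.2 + 1))
    (by fun_prop) (by fun_prop) (by fun_prop) (((PolyBdd.const q).add hw.size).add
      (PolyBdd.const 1)) fun a l' hl' => by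
    refine (sz_decrease_foldl q l' (q, 0) le_rfl).trans ?_
    have := hl'.length_le
    simp only [List.length_replicate, sz_nat] at *
    omega
  unfold TreeWidthSat.decrease
  fun_prop

@[fun_prop]
theorem inputPath : PolyFun TreeWidthSat.inputPath := by
  unfold TreeWidthSat.inputPath
  fun_prop

theorem inputState (q : ℕ) : PolyFun (TreeWidthSat.inputState q) := by
  unfold TreeWidthSat.inputState TreeWidthSat.inputEnv
  fun_prop

theorem answer : PolyFun TreeWidthSat.answer := by
  unfold TreeWidthSat.answer
  fun_prop

end PolyFun

end TreeWidthSat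
-- Arithmetic modulo a power of two, and the algebra of the signed sum
namespace TreeWidthSat

namespace Num

/-- The value of a binary number. -/
def val : Num → ℕ
  | [] => 0
  | x :: a => x.toNat + 2 * val a

theorem val_lt (a : Num) : val a < 2 ^ a.length := by
  induction a with
  | nil => simp [val]
  | cons x a ih =>
    have := Bool.toNat_le x
    simp only [val, List.length_cons, pow_succ]
    omega

/-- Missing digits of `b` count as zero, and superfluous ones vanish modulo `2 ^ a.length`, so the
lengths need not agree. -/
theorem val_addCarry (c : Bool) (a b : Num) :
    val (addCarry c a b) ≡ val a + val b + c.toNat [MOD 2 ^ a.length] := by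
  induction a generalizing c b with
  | nil => simpa using Nat.modEq_one
  | cons x a ih =>
    rw [List.length_cons, pow_succ']
    cases b with
    | nil =>
      have h := ((ih (x && c) []).mul_left' 2).add_left (Bool.xor x c).toNat
      simp only [addCarry, listCase_nil, val] at h ⊢
      refine h.trans (congrArg (· % _) ?_)
      cases x <;> cases c <;> simp <;> ring
    | cons y t =>
      have h := ((ih ((x && y) || (c && Bool.xor x y)) t).mul_left' 2).add_left
        (Bool.xor (Bool.xor x y) c).toNat
      simp only [addCarry, listCase_cons, val] at h ⊢
      refine h.trans (congrArg (· % _) ?_)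
      cases x <;> cases c <;> cases y <;> simp <;> ring

theorem val_zeroLike (a : Num) : val (zeroLike a) = 0 := by
  induction a with
  | nil => rfl
  | cons x a ih => simpa [zeroLike, val] using ih

theorem length_zeroLike (a : Num) : (zeroLike a).length = a.length := List.length_map _

theorem val_add (a b : Num) : val (add a b) ≡ val a + val b [MOD 2 ^ a.length] :=
  val_addCarry false a b

/-- Horner's scheme: double, and add `b` if the digit is one, from the most significant digit of `a`
downwards. -/
theorem val_mul (a b : Num) : val (mul a b) ≡ val a * val b [MOD 2 ^ b.length] := by
  rw [mul, List.foldl_reverse]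
  induction a with
  | nil => simp [val, val_zeroLike, Nat.ModEq]
  | cons x a ih =>
    rw [List.foldr_cons]
    set s := List.foldr (fun x s => if x = true then add (add s s) b else add s s) (zeroLike b) a
      with hs
    have hlen : s.length = b.length := by
      have := length_foldl a.reverse b (zeroLike b)
      rwa [List.foldl_reverse, length_zeroLike] at this
    have h₁ : val (add s s) ≡ val s + val s [MOD 2 ^ b.length] := hlen ▸ val_add s s
    have h₂ : val s + val s ≡ val a * val b + val a * val b [MOD 2 ^ b.length] := ih.add ih
    cases x with
    | false =>
      simp only [Bool.false_eq_true, if_false, val, Bool.toNat_false]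
      exact (h₁.trans h₂).trans (congrArg (· % _) (by ring))
    | true =>
      simp only [if_true, val, Bool.toNat_true]
      have h₃ := val_add (add s s) b
      rw [length_add, hlen] at h₃
      exact (h₃.trans ((h₁.trans h₂).add_right _)).trans (congrArg (· % _) (by ring))

theorem val_ones (b : Num) : val (b.map fun _ => true) + 1 = 2 ^ b.length := by
  induction b with
  | nil => rfl
  | cons x a ih =>
    simp only [List.map_cons, val, Bool.toNat_true, List.length_cons, pow_succ]
    omega

theorem any_iff (a : Num) : (a.any fun b => b) = true ↔ val a ≠ 0 := by
  induction a with
  | nil => simp [val]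
  | cons x a ih =>
    rw [List.any_cons, Bool.or_eq_true, ih]
    cases x <;> simp [val]

/-- The number `a` has `L` digits and represents the integer `z` modulo `2 ^ L`. -/
def Represents (L : ℕ) (a : Num) (z : ℤ) : Prop :=
  a.length = L ∧ (val a : ℤ) ≡ z [ZMOD (2 ^ L : ℕ)]

theorem Represents.add {L : ℕ} {a b : Num} {z w : ℤ} (ha : Represents L a z)
    (hb : Represents L b w) : Represents L (add a b) (z + w) := by
  obtain ⟨rfl, ha⟩ := ha
  refine ⟨length_add _ _, ?_⟩
  have h := (Int.natCast_modEq_iff.2 (val_add a b))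
  push_cast at h ha hb ⊢
  exact h.trans (ha.add hb.2)

theorem Represents.mul {L : ℕ} {a b : Num} {z w : ℤ} (ha : Represents L a z)
    (hb : Represents L b w) : Represents L (mul a b) (z * w) := by
  obtain ⟨rfl, hb⟩ := hb
  refine ⟨length_mul _ _, ?_⟩
  have h := (Int.natCast_modEq_iff.2 (val_mul a b))
  push_cast at h ha hb ⊢
  exact h.trans (ha.2.mul hb)

/-- All digits one represents -1. -/
theorem Represents.neg {L : ℕ} {b : Num} {w : ℤ} (hb : Represents L b w) :
    Represents L (neg b) (-w) := by
  have : Represents L (b.map fun _ => true) (-1) := by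
    refine ⟨by rw [List.length_map, hb.1], ?_⟩
    have h := val_ones b
    rw [hb.1] at h
    rw [← h]
    exact Int.modEq_iff_dvd.2 ⟨-1, by push_cast; ring⟩
  simpa [Num.neg] using this.mul hb

theorem Represents.zeroLike {L : ℕ} {b : Num} {w : ℤ} (hb : Represents L b w) :
    Represents L (zeroLike b) 0 :=
  ⟨by rw [length_zeroLike, hb.1], by rw [val_zeroLike]; rfl⟩

theorem represents_one (n : ℕ) : Represents (n + 1) (one n) 1 := by
  have : ∀ n, val (List.replicate n false) = 0 := by
    intro n
    induction n with
    | zero => rfl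
    | succ n ih => simp [List.replicate_succ, val, ih]
  exact ⟨by simp [one], by simp [one, val, this]⟩

/-- Intermediate sums may be negative, so only residues are kept. The final value lies in a range of
length `2 ^ L` and is recovered from its residue. -/
theorem Represents.any_iff {L : ℕ} {a : Num} {z : ℤ} (h : Represents L a z) (h₀ : 0 ≤ z)
    (h₁ : z < (2 ^ L : ℕ)) : (a.any fun b => b) = true ↔ z ≠ 0 := by
  have hv := val_lt a
  rw [h.1] at hv
  have : (val a : ℤ) = z := by
    have h₂ := h.2
    rwa [Int.ModEq, Int.emod_eq_of_lt (by omega) (by exact_mod_cast hv),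
      Int.emod_eq_of_lt h₀ h₁] at h₂
  rw [Num.any_iff, ← this]
  simp

end Num

/-! ### The sum over all spins -/

section partitionSum

variable {F : List (Lit × Lit)} {nv : ℕ}

theorem litEq_iff {a b : Lit} : litEq a b = true ↔ a = b := by
  simp [litEq, Prod.ext_iff]

theorem compat_iff {l : Lit} {τ : Pat} :
    compat F l τ = true ↔ ∀ l' ∈ τ, (l, l') ∉ F := by
  simp only [compat, Bool.not_eq_true', List.any_eq_false, Bool.and_eq_true, not_and,
    litEq_iff, Bool.not_eq_true, List.any_eq_false]
  constructor
  · rintro h l' hl' hF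
    exact h _ hF rfl _ hl' rfl
  · rintro h ⟨a, b⟩ hF rfl l' hl' rfl
    exact h _ hl' hF

theorem adjB_iff {x y : ℕ} : adjB F x y = true ↔ ∃ b c, ((x, b), (y, c)) ∈ F := by
  simp only [adjB, List.any_eq_true, Bool.and_eq_true, beq_iff_eq, Prod.exists]
  constructor
  · rintro ⟨a, b, c, d, h, rfl, rfl⟩
    exact ⟨_, _, h⟩
  · rintro ⟨b, c, h⟩
    exact ⟨_, _, _, _, h, rfl, rfl⟩

theorem subPat_iff {σ τ : Pat} : subPat σ τ = true ↔ σ ⊆ τ := by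
  simp [subPat, litEq_iff, List.subset_def]

/-- The weight of a literal in the presence of a partial assignment. -/
def weight (F : List (Lit × Lit)) (nv : ℕ) (l : Lit) (τ : Pat) : ℤ :=
  if compat F l τ = true then if (l.2 && Nat.ble nv l.1) = true then -1 else 1 else 0

/-- The sum over all values of the vertices in a list of the products of the weights. -/
def partitionSum (F : List (Lit × Lit)) (nv : ℕ) : List ℕ → Pat → ℤ
  | [], _ => 1
  | x :: U, τ => weight F nv (x, false) τ * partitionSum F nv U ((x, false) :: τ) +
      weight F nv (x, true) τ * partitionSum F nv U ((x, true) :: τ)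

theorem represents_weigh {L : ℕ} {l : Lit} {τ : Pat} {v : Num} {z : ℤ}
    (h : Num.Represents L v z) :
    Num.Represents L (weigh F nv l τ v) (weight F nv l τ * z) := by
  unfold weigh weight
  split_ifs
  · simpa using h.neg
  · simpa using h
  · simpa using h.zeroLike

theorem weight_congr {l : Lit} {τ τ' : Pat}
    (h : ∀ l', adjB F l.1 l'.1 = true → (l' ∈ τ ↔ l' ∈ τ')) :
    weight F nv l τ = weight F nv l τ' := by
  have : compat F l τ = compat F l τ' := by
    rw [Bool.eq_iff_iff, compat_iff, compat_iff]
    refine forall_congr' fun l' => ?_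
    by_cases hF : (l, l') ∈ F
    · rw [h l' (adjB_iff.2 ⟨_, _, hF⟩)]
    · simp [hF]
  rw [weight, weight, this]

/-- Locality: only the values on the neighbours of `U` matter. This justifies restricting
assignments before a component is entered. -/
theorem partitionSum_congr {U : List ℕ} {τ τ' : Pat}
    (h : ∀ l, ∀ y ∈ U, adjB F y l.1 = true → (l ∈ τ ↔ l ∈ τ')) :
    partitionSum F nv U τ = partitionSum F nv U τ' := by
  induction U generalizing τ τ' with
  | nil => rfl
  | cons x U ih =>
    have h₁ : ∀ b, weight F nv (x, b) τ = weight F nv (x, b) τ' := fun b =>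
      weight_congr fun l' => h l' x (by simp)
    have h₂ : ∀ b, partitionSum F nv U ((x, b) :: τ) = partitionSum F nv U ((x, b) :: τ') := by
      intro b
      refine ih fun l y hy hl => ?_
      rw [List.mem_cons, List.mem_cons, h l y (by simp [hy]) hl]
    simp only [partitionSum, h₁, h₂]

/-- Constraints are pairwise, so each assigned literal contributes a factor of its own. -/
theorem weight_cons (l l' : Lit) (τ : Pat) :
    weight F nv l (l' :: τ) = weight F nv l τ * if (l, l') ∈ F then 0 else 1 := by
  have : compat F l (l' :: τ) = true ↔ compat F l τ = true ∧ (l, l') ∉ F := by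
    simp only [compat_iff, List.mem_cons, forall_eq_or_imp]
    tauto
  unfold weight
  by_cases h₁ : compat F l τ = true <;> by_cases h₂ : (l, l') ∈ F <;> simp [this, h₁, h₂]

/-- When two neighbouring vertices in the list are swapped, their interaction factor moves from the
weight of one to the weight of the other. By symmetry of `F` it is the same factor. -/
theorem partitionSum_perm (hF : ∀ l l', (l, l') ∈ F → (l', l) ∈ F) {U U' : List ℕ}
    (h : U.Perm U') (τ : Pat) : partitionSum F nv U τ = partitionSum F nv U' τ := by
  induction h generalizing τ with
  | nil => rfl
  | cons x _ ih => simp only [partitionSum, ih]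
  | swap x y U =>
    have h₁ : ∀ b c, partitionSum F nv U ((x, b) :: (y, c) :: τ)
        = partitionSum F nv U ((y, c) :: (x, b) :: τ) := fun b c =>
      partitionSum_congr fun l _ _ _ => by simp only [List.mem_cons]; tauto
    have h₂ : ∀ l l', (if (l, l') ∈ F then (0 : ℤ) else 1) = if (l', l) ∈ F then 0 else 1 :=
      fun l l' => if_congr ⟨hF _ _, hF _ _⟩ rfl rfl
    simp only [partitionSum, weight_cons, h₁]
    rw [h₂ (x, false) (y, false), h₂ (x, false) (y, true), h₂ (x, true) (y, false),
      h₂ (x, true) (y, true)]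
    ring
  | trans _ _ ih₁ ih₂ => rw [ih₁, ih₂]

/-- Without edges between the two parts, the values on `U` are invisible to `V`, and the sum
factors. -/
theorem partitionSum_append {U V : List ℕ} (h : ∀ y ∈ V, ∀ x ∈ U, adjB F y x = false) (τ : Pat) :
    partitionSum F nv (U ++ V) τ = partitionSum F nv U τ * partitionSum F nv V τ := by
  induction U generalizing τ with
  | nil => simp [partitionSum]
  | cons x U ih =>
    have h₁ : ∀ b, partitionSum F nv V ((x, b) :: τ) = partitionSum F nv V τ := fun b =>
      partitionSum_congr fun l y hy hl => by
        have : l ≠ (x, b) := by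
          rintro rfl
          rw [h y hy x (by simp)] at hl
          cases hl
        simp [this]
    rw [List.cons_append]
    simp only [partitionSum, ih (fun y hy x hx => h y hy x (by simp [hx])), h₁]
    ring

theorem mem_remove {U B : List ℕ} {x : ℕ} : x ∈ remove U B ↔ x ∈ U ∧ x ∉ B := by
  simp [remove]

theorem nodup_remove {U : List ℕ} (hU : U.Nodup) (B : List ℕ) : (remove U B).Nodup :=
  hU.filter _

theorem partitionSum_remove (hF : ∀ l l', (l, l') ∈ F → (l', l) ∈ F) {U : List ℕ}
    (hU : U.Nodup) {x : ℕ} (hx : x ∈ U) (τ : Pat) :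
    partitionSum F nv U τ =
      weight F nv (x, false) τ * partitionSum F nv (remove U [x]) ((x, false) :: τ) +
      weight F nv (x, true) τ * partitionSum F nv (remove U [x]) ((x, true) :: τ) := by
  have h : U.Perm (x :: remove U [x]) := by
    refine (List.perm_ext_iff_of_nodup hU ?_).2 fun y => ?_
    · exact List.nodup_cons.2 ⟨by simp [mem_remove], nodup_remove hU _⟩
    · rw [List.mem_cons, mem_remove, List.mem_singleton]
      by_cases hy : y = x <;> simp [hy, hx]
  rw [partitionSum_perm hF h]
  rfl

theorem partitionSum_split (hF : ∀ l l', (l, l') ∈ F → (l', l) ∈ F) {U C : List ℕ}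
    (hU : U.Nodup) (hC : C.Nodup) (hCU : C ⊆ U)
    (h : ∀ y ∈ U, y ∉ C → ∀ x ∈ C, adjB F y x = false) (τ : Pat) :
    partitionSum F nv U τ = partitionSum F nv C τ * partitionSum F nv (remove U C) τ := by
  rw [← partitionSum_append fun y hy => h y (mem_remove.1 hy).1 (mem_remove.1 hy).2]
  refine partitionSum_perm hF ((List.perm_ext_iff_of_nodup hU ?_).2 fun y => ?_) τ
  · refine List.nodup_append.2 ⟨hC, nodup_remove hU _, fun x hx y hy => ?_⟩
    rintro rfl
    exact (mem_remove.1 hy).2 hx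
  · rw [List.mem_append, mem_remove]
    by_cases hy : y ∈ C
    · simp [hy, hCU hy]
    · simp [hy]

end partitionSum

end TreeWidthSat
-- The signed sum counts satisfying assignments
namespace TreeWidthSat
open Enc

/-! ### The sum over all spins counts the satisfying assignments -/

section count

variable {F : List (Lit × Lit)} {nv : ℕ} {Occ : Lit → ℕ → Prop}

/-- The pairs in `F` consist of a literal and a clause with the value `true` in which the literal
occurs. The clauses have the numbers from `nv` on. -/
def ForbidsOcc (F : List (Lit × Lit)) (nv : ℕ) (Occ : Lit → ℕ → Prop) : Prop :=
  ∀ l l', (l, l') ∈ F ↔ (l.1 < nv ∧ nv ≤ l'.1 ∧ l'.2 = true ∧ Occ l l'.1) ∨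
    (l'.1 < nv ∧ nv ≤ l.1 ∧ l.2 = true ∧ Occ l' l.1)

theorem ForbidsOcc.symm (hF : ForbidsOcc F nv Occ) (l l' : Lit) (h : (l, l') ∈ F) :
    (l', l) ∈ F :=
  (hF _ _).2 ((hF _ _).1 h).symm

-- The inclusion-exclusion identity behind the weights: for each clause, the value false contributes
-- 1, and the value true contributes -1 exactly when no assigned literal satisfies the clause.
-- Clauses do not interact, so the indicators multiply.
open Classical in
theorem partitionSum_clauses (hF : ForbidsOcc F nv Occ) (cl : List ℕ) (hcl : ∀ j ∈ cl, nv ≤ j)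
    (τ : Pat) : partitionSum F nv cl τ =
      if ∀ j ∈ cl, ∃ l ∈ τ, l.1 < nv ∧ Occ l j then 1 else 0 := by
  induction cl generalizing τ with
  | nil => simp [partitionSum]
  | cons j cl ih =>
    have hj := hcl j (by simp)
    have h₁ : ∀ b, (∀ i ∈ cl, ∃ l ∈ (j, b) :: τ, l.1 < nv ∧ Occ l i)
        ↔ ∀ i ∈ cl, ∃ l ∈ τ, l.1 < nv ∧ Occ l i := by
      intro b
      refine forall₂_congr fun i _ => ?_
      simp [show ¬ j < nv by omega]
    have h₂ : weight F nv (j, false) τ = 1 := by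
      have : compat F (j, false) τ = true := by
        refine compat_iff.2 fun l' _ h => ?_
        rcases (hF _ _).1 h with ⟨h, -⟩ | ⟨-, -, h, -⟩
        · exact absurd h (by simpa using hj)
        · cases h
      simp [weight, this]
    have h₃ : weight F nv (j, true) τ = if ∃ l ∈ τ, l.1 < nv ∧ Occ l j then 0 else -1 := by
      have : compat F (j, true) τ = true ↔ ¬ ∃ l ∈ τ, l.1 < nv ∧ Occ l j := by
        rw [compat_iff]
        push Not
        refine forall₂_congr fun l _ => ?_
        rw [hF]
        simp only [show ¬ j < nv by omega, false_and, false_or, hj, true_and, not_and]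
      have hj' : Nat.ble nv j = true := Nat.ble_eq_true_of_le hj
      by_cases h : ∃ l ∈ τ, l.1 < nv ∧ Occ l j
      · rw [if_pos h, weight, if_neg]
        rw [this]
        exact not_not.2 h
      · rw [if_neg h, weight, if_pos (this.2 h)]
        simp [hj']
    rw [partitionSum, ih (fun i hi => hcl i (by simp [hi])), ih (fun i hi => hcl i (by simp [hi])),
      if_congr (h₁ _) rfl rfl, if_congr (h₁ _) rfl rfl, h₂, h₃]
    simp only [List.forall_mem_cons]
    have key : ∀ (P Q : Prop), (1 : ℤ) * (if Q then 1 else 0) + (if P then 0 else -1) *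
        (if Q then 1 else 0) = if P ∧ Q then 1 else 0 := fun P Q => by
      by_cases hP : P <;> by_cases hQ : Q <;> simp [hP, hQ]
    convert key _ _

/-- As long as only variables are assigned, nothing is forbidden and each variable has weight 1. So
this is a plain sum of indicators over all assignments of `vs`; it is never negative, and nothing
cancels. -/
theorem partitionSum_vars (hF : ForbidsOcc F nv Occ) (vs cl : List ℕ) (hcl : ∀ j ∈ cl, nv ≤ j)
    (hvs : ∀ v ∈ vs, v < nv) (hnd : vs.Nodup) (τ : Pat) (hτ : ∀ l ∈ τ, l.1 < nv) :
    0 ≤ partitionSum F nv (vs ++ cl) τ ∧ partitionSum F nv (vs ++ cl) τ ≤ 2 ^ vs.length ∧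
      (partitionSum F nv (vs ++ cl) τ ≠ 0 ↔ ∃ a : ℕ → Bool, ∀ j ∈ cl,
        (∃ l ∈ τ, Occ l j) ∨ ∃ v ∈ vs, Occ (v, a v) j) := by
  classical
  induction vs generalizing τ with
  | nil =>
    rw [List.nil_append, partitionSum_clauses hF cl hcl]
    have : (∀ j ∈ cl, ∃ l ∈ τ, l.1 < nv ∧ Occ l j) ↔ ∀ j ∈ cl, ∃ l ∈ τ, Occ l j :=
      forall₂_congr fun j _ => exists_congr fun l =>
        ⟨fun h => ⟨h.1, h.2.2⟩, fun h => ⟨h.1, hτ l h.1, h.2⟩⟩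
    rw [if_congr this rfl rfl]
    split_ifs with h
    · simpa using h
    · simpa using h
  | cons v vs ih =>
    have hv := hvs v (by simp)
    have hw : ∀ b, weight F nv (v, b) τ = 1 := by
      intro b
      have : compat F (v, b) τ = true := by
        refine compat_iff.2 fun l hl h => ?_
        have := hτ l hl
        rcases (hF _ _).1 h with ⟨-, h, -⟩ | ⟨-, h, -⟩
        · omega
        · simp only at h
          omega
      have hv' : Nat.ble nv v = false := by
        rw [Bool.eq_false_iff]
        intro h'
        have := Nat.le_of_ble_eq_true h'
        omega
      simp [weight, this, hv']
    have hb := fun b => ih (fun u hu => hvs u (by simp [hu])) (List.nodup_cons.1 hnd).2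
      ((v, b) :: τ) (by simpa [hv] using hτ)
    obtain ⟨p₀, q₀, r₀⟩ := hb false
    obtain ⟨p₁, q₁, r₁⟩ := hb true
    rw [List.cons_append, partitionSum, hw, hw, one_mul, one_mul]
    refine ⟨by omega, by rw [List.length_cons, pow_succ]; omega, ?_⟩
    have h₁ : partitionSum F nv (vs ++ cl) ((v, false) :: τ) +
        partitionSum F nv (vs ++ cl) ((v, true) :: τ) ≠ 0 ↔
        ∃ b, partitionSum F nv (vs ++ cl) ((v, b) :: τ) ≠ 0 := by
      rw [Bool.exists_bool]
      omega
    have h₂ : ∀ b, partitionSum F nv (vs ++ cl) ((v, b) :: τ) ≠ 0 ↔ ∃ a : ℕ → Bool, ∀ j ∈ cl,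
        (∃ l ∈ (v, b) :: τ, Occ l j) ∨ ∃ v ∈ vs, Occ (v, a v) j := fun b => (hb b).2.2
    rw [h₁]
    simp only [h₂, List.exists_mem_cons_iff]
    constructor
    · rintro ⟨b, a, ha⟩
      -- The list has no repetitions, so changing the value at `v` leaves the other variables alone.
      refine ⟨Function.update a v b, fun j hj => ?_⟩
      rcases ha j hj with (h | h) | ⟨u, hu, h⟩
      · exact Or.inr (Or.inl (by simpa using h))
      · exact Or.inl h
      · refine Or.inr (Or.inr ⟨u, hu, ?_⟩)
        rw [Function.update_of_ne]
        · exact h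
        · rintro rfl
          exact (List.nodup_cons.1 hnd).1 hu
    · rintro ⟨a, ha⟩
      refine ⟨a v, a, fun j hj => ?_⟩
      rcases ha j hj with h | h | h
      · exact Or.inl (Or.inr h)
      · exact Or.inl (Or.inl h)
      · exact Or.inr h

end count

/-! ### The input of the algorithm -/

section input

theorem mem_zipIdx_ofFn {β : Type} {m k : ℕ} {f : Fin m → β} {b : β} {x : ℕ} :
    (b, x) ∈ (List.ofFn f).zipIdx k ↔ ∃ v : Fin m, x = k + v ∧ f v = b := by
  rw [List.mk_mem_zipIdx_iff_le_and_getElem?_sub, List.getElem?_ofFn]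
  constructor
  · rintro ⟨h, h'⟩
    split_ifs at h' with hx
    exact ⟨⟨x - k, hx⟩, by simp only; omega, by simpa using h'⟩
  · rintro ⟨v, rfl, rfl⟩
    simp

theorem mem_positions {m k : ℕ} {p : Fin m → Bool} {x : ℕ} :
    x ∈ positions k (List.ofFn p) ↔ ∃ v : Fin m, x = k + v ∧ p v = true := by
  simp only [positions, List.mem_map, List.mem_filter, Prod.exists, exists_eq_right,
    mem_zipIdx_ofFn]

theorem nodup_positions (k : ℕ) (l : List Bool) : (positions k l).Nodup := by
  have h : ((l.zipIdx k).map fun p => p.2).Nodup := by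
    change (List.map Prod.snd _).Nodup
    rw [List.zipIdx_map_snd]
    exact List.nodup_range'
  exact h.sublist (List.filter_sublist.map _)

variable {φ : CNF} {N : ℕ}

open Classical in
/-- The input as a value. -/
noncomputable def toInput (φ : CNF) (D : TreeDecomposition φ.incidenceGraph (Fin N)) : Input :=
  (List.ofFn fun j => (List.ofFn fun v => decide ((v, true) ∈ φ.clause j),
    List.ofFn fun v => decide ((v, false) ∈ φ.clause j)),
  List.ofFn fun t => (List.ofFn fun u => decide (D.tree.Adj t u),
    (List.ofFn fun v => decide (Sum.inl v ∈ D.bag t),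
      List.ofFn fun j => decide (Sum.inr j ∈ D.bag t))))

theorem enc_toInput (D : TreeDecomposition φ.incidenceGraph (Fin N)) :
    enc (toInput φ D) = encodeInput φ D := by
  have h : ∀ (k : ℕ) (p : Fin k → Prop) [DecidablePred p],
      enc (List.ofFn fun i => decide (p i)) = Data.ofPred p := by
    intro k p _
    simp only [enc, Data.ofPred, List.map_ofFn]
    congr 2
    funext i
    by_cases hp : p i <;> simp [hp, Data.ofProp]
  have h' : ∀ (α : Type) [Enc α] (k : ℕ) (f : Fin k → α),
      enc (List.ofFn f) = Data.ofList (List.ofFn fun i => enc (f i)) := by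
    intro α _ k f
    simp only [enc, List.map_ofFn]
    rfl
  have h'' : ∀ (α β : Type) [Enc α] [Enc β] (a : α) (b : β),
      enc (a, b) = Data.cons (enc a) (enc b) := fun _ _ _ _ _ _ => rfl
  rw [toInput, h'', encodeInput, encodeFormula, encodeDecomposition, h', h']
  simp only [h'', h]

variable (D : TreeDecomposition φ.incidenceGraph (Fin N))

theorem inputVars_toInput (hN : 0 < N) : inputVars (toInput φ D) = φ.numVars := by
  obtain ⟨N, rfl⟩ : ∃ M, N = M + 1 := ⟨N - 1, by omega⟩
  simp [inputVars, toInput, List.ofFn_succ]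

theorem inputClauses_toInput (hN : 0 < N) : inputClauses (toInput φ D) = φ.numClauses := by
  obtain ⟨N, rfl⟩ : ∃ M, N = M + 1 := ⟨N - 1, by omega⟩
  simp [inputClauses, toInput, List.ofFn_succ]

/-- The literal `l` occurs in the clause with the number `j`. -/
def OccursIn (φ : CNF) (l : Lit) (j : ℕ) : Prop :=
  ∃ (v : Fin φ.numVars) (i : Fin φ.numClauses), l.1 = v ∧ j = φ.numVars + i ∧ (v, l.2) ∈ φ.clause i

theorem forbidsOcc_toInput (hN : 0 < N) :
    ForbidsOcc (inputForbidden (toInput φ D)) φ.numVars (OccursIn φ) := by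
  have hc : ∀ (i : Fin φ.numClauses) (l : Lit),
      l ∈ clauseLits (List.ofFn (fun v => decide ((v, true) ∈ φ.clause i)),
        List.ofFn fun v => decide ((v, false) ∈ φ.clause i)) ↔
      ∃ v : Fin φ.numVars, l.1 = v ∧ (v, l.2) ∈ φ.clause i := by
    rintro i ⟨x, b⟩
    simp only [clauseLits, List.mem_append, List.mem_map, mem_positions, decide_eq_true_eq,
      Prod.mk.injEq]
    cases b <;> simp [and_comm, eq_comm]
  rintro ⟨x, b⟩ ⟨y, c⟩
  rw [inputForbidden, List.mem_flatMap, inputVars_toInput D hN]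
  simp only [toInput, Prod.exists, List.mem_append, List.mem_map]
  constructor
  · rintro ⟨c₁, c₂, j, hj, h⟩
    obtain ⟨i, rfl, hi⟩ := mem_zipIdx_ofFn.1 hj
    rw [← hi] at h
    simp only [hc, Prod.mk.injEq] at h
    rcases h with ⟨x', b', ⟨v, h₁, h₂⟩, ⟨rfl, rfl⟩, rfl, rfl⟩ |
      ⟨x', b', ⟨v, h₁, h₂⟩, ⟨rfl, rfl⟩, rfl, rfl⟩
    · exact Or.inl ⟨by omega, by simp, rfl, v, i, h₁, rfl, h₂⟩
    · exact Or.inr ⟨by omega, by simp, rfl, v, i, h₁, rfl, h₂⟩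
  · rintro (⟨-, -, h, v, i, h₁, h₂, h₃⟩ | ⟨-, -, h, v, i, h₁, h₂, h₃⟩)
    · simp only at h h₁ h₂ h₃
      subst h h₂
      refine ⟨_, _, _, mem_zipIdx_ofFn.2 ⟨i, rfl, rfl⟩, Or.inl ⟨x, b, (hc _ _).2 ⟨v, h₁, h₃⟩, rfl⟩⟩
    · simp only at h h₁ h₂ h₃
      subst h h₂
      refine ⟨_, _, _, mem_zipIdx_ofFn.2 ⟨i, rfl, rfl⟩, Or.inr ⟨y, c, (hc _ _).2 ⟨v, h₁, h₃⟩, rfl⟩⟩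

/-- Variables are numbered before clauses, so the natural order is the one in which the sum was
computed. The algorithm uses other orders, which `partitionSum_perm` permits. -/
theorem partitionSum_toInput (hN : 0 < N) :
    0 ≤ partitionSum (inputForbidden (toInput φ D)) φ.numVars (List.range φ.size) [] ∧
    partitionSum (inputForbidden (toInput φ D)) φ.numVars (List.range φ.size) [] ≤
      2 ^ φ.numVars ∧
    (partitionSum (inputForbidden (toInput φ D)) φ.numVars (List.range φ.size) [] ≠ 0 ↔
      φ.Satisfiable) := by
  have hr : List.range φ.size = List.range φ.numVars ++
      (List.range φ.numClauses).map (φ.numVars + ·) := by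
    rw [CNF.size, add_comm, List.range_add]
  rw [hr]
  have := partitionSum_vars (forbidsOcc_toInput D hN) (List.range φ.numVars)
    ((List.range φ.numClauses).map (φ.numVars + ·)) (by simp) (by simp) List.nodup_range [] (by simp)
  rw [List.length_range] at this
  refine ⟨this.1, this.2.1, this.2.2.trans ?_⟩
  simp only [List.not_mem_nil, false_and, exists_false, false_or, List.mem_map, List.mem_range,
    forall_exists_index, and_imp, forall_apply_eq_imp_iff₂]
  constructor
  · rintro ⟨a, ha⟩
    refine ⟨fun v => a v, fun j => ?_⟩
    obtain ⟨v, hv, u, i, h₁, h₂, h₃⟩ := ha j j.2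
    obtain rfl : j = i := Fin.ext (by omega)
    simp only at h₁ h₃
    exact ⟨_, h₃, by rw [h₁]⟩
  · rintro ⟨a, ha⟩
    refine ⟨fun v => if h : v < φ.numVars then a ⟨v, h⟩ else false, fun j hj => ?_⟩
    obtain ⟨⟨v, b⟩, h₁, h₂⟩ := ha ⟨j, hj⟩
    refine ⟨v, v.2, v, ⟨j, hj⟩, rfl, rfl, ?_⟩
    simp only at h₂
    simpa [h₂] using h₁

end input

end TreeWidthSat
-- Components and balanced separators in tree decompositions
namespace TreeWidthSat

/-! ### Components -/

section component

variable {F : List (Lit × Lit)} {U : List ℕ} {x y : ℕ}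

theorem mem_grow {S : List ℕ} :
    y ∈ grow F U S ↔ y ∈ U ∧ (y ∈ S ∨ ∃ z ∈ S, adjB F z y = true) := by
  simp [grow]

/-- Each round either has reached a fixed point or has added a vertex. -/
theorem foldl_grow_or (l : List ℕ) (p : ℕ → Bool) :
    grow F U (l.foldl (fun S _ => grow F U S) (U.filter p)) =
      l.foldl (fun S _ => grow F U S) (U.filter p) ∨
    (U.filter p).length + l.length ≤ (l.foldl (fun S _ => grow F U S) (U.filter p)).length := by
  induction l generalizing p with
  | nil => exact Or.inr le_rfl
  | cons a l ih =>
    -- All stages are filters of `U` and hence ordered alike, so equal length forces equality.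
    have hsub : (U.filter p).Sublist (grow F U (U.filter p)) := by
      have hp : U.filter p = U.filter fun y => (U.filter p).contains y :=
        List.filter_congr fun y hy => by rw [Bool.eq_iff_iff]; simp [hy]
      conv_lhs => rw [hp]
      exact List.monotone_filter_right U fun y hy => by simp only [hy, Bool.true_or]
    by_cases h : grow F U (U.filter p) = U.filter p
    · left
      have : ∀ l : List ℕ, l.foldl (fun S _ => grow F U S) (U.filter p) = U.filter p := by
        intro l
        induction l with
        | nil => rfl
        | cons b l ih => rw [List.foldl_cons, h, ih]
      rw [this, h]
    · rw [List.foldl_cons]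
      have hlt : (U.filter p).length < (grow F U (U.filter p)).length := by
        refine lt_of_le_of_ne hsub.length_le fun he => h (hsub.eq_of_length he).symm
      rcases ih (fun y => (U.filter p).contains y || (U.filter p).any fun x => adjB F x y) with h' | h'
      · exact Or.inl h'
      · right
        refine le_trans ?_ h'
        change _ ≤ (grow F U (U.filter p)).length + _
        rw [List.length_cons]
        omega

theorem component_sublist : (component F U x).Sublist U := by
  have : ∀ (l : List ℕ) (p : ℕ → Bool),
      (l.foldl (fun S _ => grow F U S) (U.filter p)).Sublist U := by
    intro l
    induction l with
    | nil => intro p; exact List.filter_sublist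
    | cons a l ih => intro p; exact ih _
  exact this _ _

theorem grow_component (hx : x ∈ U) : grow F U (component F U x) = component F U x := by
  rcases foldl_grow_or (F := F) (U := U) U (fun y => y == x) with h | h
  · exact h
  -- A start with at least one vertex and `U.length` further ones would not fit into `U`.
  · have h₁ : 0 < (U.filter fun y => y == x).length :=
      List.length_pos_of_mem (List.mem_filter.2 ⟨hx, by simp⟩)
    have h₂ : (component F U x).length ≤ U.length := component_sublist.length_le
    change _ ≤ (component F U x).length at h
    omega

theorem component_closed (hx : x ∈ U) {z : ℕ} (hz : z ∈ component F U x) (hy : y ∈ U)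
    (h : adjB F z y = true) : y ∈ component F U x := by
  rw [← grow_component hx]
  exact mem_grow.2 ⟨hy, Or.inr ⟨z, hz, h⟩⟩

theorem mem_component_self (hx : x ∈ U) : x ∈ component F U x := by
  have : ∀ (l S : List ℕ), x ∈ S → x ∈ l.foldl (fun S _ => grow F U S) S := by
    intro l
    induction l with
    | nil => exact fun S h => h
    | cons a l ih => exact fun S h => ih _ (mem_grow.2 ⟨hx, Or.inl h⟩)
  exact this _ _ (List.mem_filter.2 ⟨hx, by simp⟩)

theorem component_induction {P : ℕ → Prop} (h₀ : P x)
    (h : ∀ z ∈ U, ∀ y ∈ U, P z → adjB F z y = true → P y) : ∀ y ∈ component F U x, P y := by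
  have : ∀ (l S : List ℕ), (∀ y ∈ S, y ∈ U ∧ P y) →
      ∀ y ∈ l.foldl (fun S _ => grow F U S) S, P y := by
    intro l
    induction l with
    | nil => exact fun S hS y hy => (hS y hy).2
    | cons a l ih =>
      refine fun S hS => ih _ fun y hy => ?_
      obtain ⟨hyU, hy | ⟨z, hz, hzy⟩⟩ := mem_grow.1 hy
      · exact hS y hy
      · exact ⟨hyU, h z (hS z hz).1 y hyU (hS z hz).2 hzy⟩
  refine this _ _ fun y hy => ?_
  obtain ⟨h₁, h₂⟩ := List.mem_filter.1 hy
  rw [beq_iff_eq] at h₂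
  exact ⟨h₁, h₂ ▸ h₀⟩

theorem component_mono {U' : List ℕ} (h : U' ⊆ U) (hx : x ∈ U) :
    component F U' x ⊆ component F U x :=
  component_induction (P := fun y => y ∈ component F U x) (mem_component_self hx)
    fun _ _ _ hy hz hzy => component_closed hx hz (h hy) hzy

end component

/-! ### Tree decompositions on natural numbers -/

/-- The bags `B t` form a tree decomposition, with the tree `T`, of the graph on the natural
numbers below `n` in which two numbers are adjacent if they occur in a forbidden pair. -/
structure IsTreeBags {W : Type} (F : List (Lit × Lit)) (n : ℕ) (T : SimpleGraph W)
    (B : W → List ℕ) : Prop where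
  exists_mem : ∀ x < n, ∃ t, x ∈ B t
  exists_adj : ∀ x y, adjB F x y = true → ∃ t, x ∈ B t ∧ y ∈ B t
  chain : ∀ x s u, x ∈ B s → x ∈ B u →
    Relation.ReflTransGen (fun a b => T.Adj a b ∧ x ∈ B a ∧ x ∈ B b) s u

namespace IsTreeBags

variable {W : Type} {F : List (Lit × Lit)} {n : ℕ} {T : SimpleGraph W} {B : W → List ℕ}

/-- The nodes that are connected, in the tree without `t`, to a node whose bag contains `x`. -/
def side (T : SimpleGraph W) (B : W → List ℕ) (t : W) (x : ℕ) : Set W :=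
  {u | ∃ s, x ∈ B s ∧ Relation.ReflTransGen (fun a b => T.Adj a b ∧ a ≠ t ∧ b ≠ t) s u}

theorem side_symm {t u v : W}
    (h : Relation.ReflTransGen (fun a b => T.Adj a b ∧ a ≠ t ∧ b ≠ t) u v) :
    Relation.ReflTransGen (fun a b => T.Adj a b ∧ a ≠ t ∧ b ≠ t) v u := by
  induction h with
  | refl => exact .refl
  | tail _ hab ih => exact .head ⟨hab.1.symm, hab.2.2, hab.2.1⟩ ih

theorem chain_of_not_mem (h : IsTreeBags F n T B) {t : W} {x : ℕ} (hx : x ∉ B t) {s u : W}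
    (hs : x ∈ B s) (hu : x ∈ B u) :
    Relation.ReflTransGen (fun a b => T.Adj a b ∧ a ≠ t ∧ b ≠ t) s u :=
  Relation.ReflTransGen.mono (fun _ _ hab =>
    ⟨hab.1, fun e => hx (e ▸ hab.2.1), fun e => hx (e ▸ hab.2.2)⟩) _ _ (h.chain x s u hs hu)

theorem side_connected (h : IsTreeBags F n T B) {t : W} {x : ℕ} (hx : x ∉ B t) {u v : W}
    (hu : u ∈ side T B t x) (hv : v ∈ side T B t x) :
    Relation.ReflTransGen (fun a b => T.Adj a b ∧ a ≠ t ∧ b ≠ t) u v := by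
  obtain ⟨s, hs, hu⟩ := hu
  obtain ⟨s', hs', hv⟩ := hv
  exact (side_symm hu).trans ((h.chain_of_not_mem hx hs hs').trans hv)

theorem not_mem_side {t : W} {x : ℕ} (hx : x ∉ B t) : t ∉ side T B t x := by
  rintro ⟨s, hs, h⟩
  rcases Relation.ReflTransGen.cases_tail h with rfl | ⟨u, -, hu⟩
  · exact hx hs
  · exact hu.2.2 rfl

/-- An edge of the component lies in some bag, and the bags of a vertex outside `B t` are connected
without passing through `t`. So the whole component stays on one side of `t`. -/
theorem mem_side_of_mem_component (h : IsTreeBags F n T B) {C : List ℕ} {t : W} {x y : ℕ}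
    (hy : y ∈ component F (remove C (B t)) x) : ∀ u, y ∈ B u → u ∈ side T B t x := by
  refine component_induction (P := fun y => ∀ u, y ∈ B u → u ∈ side T B t x) ?_ ?_ y hy
  · exact fun u hu => ⟨u, hu, Relation.ReflTransGen.refl⟩
  · intro z _ y hy hz hzy u hu
    obtain ⟨w, hw, hw'⟩ := h.exists_adj z y hzy
    obtain ⟨s, hs, hsw⟩ := hz w hw
    exact ⟨s, hs, hsw.trans (h.chain_of_not_mem (mem_remove.1 hy).2 hw' hu)⟩

theorem reachable_of_side {s t u v : W}
    (h : Relation.ReflTransGen (fun a b => T.Adj a b ∧ a ≠ t ∧ b ≠ t) u v) :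
    (T.deleteEdges {s(s, t)}).Reachable u v := by
  induction h with
  | refl => rfl
  | tail _ hab ih =>
    refine ih.trans (SimpleGraph.Adj.reachable ?_)
    rw [SimpleGraph.deleteEdges_adj]
    refine ⟨hab.1, fun hc => ?_⟩
    rw [Set.mem_singleton_iff, Sym2.eq_iff] at hc
    rcases hc with ⟨-, h⟩ | ⟨h, -⟩
    · exact hab.2.2 h
    · exact hab.2.1 h

/-- Some bag is a balanced separator. -/
theorem exists_separates (h : IsTreeBags F n T B) [Finite W] (hT : T.IsTree) {C : List ℕ}
    (hC : C.Nodup) (hCn : ∀ x ∈ C, x < n) : ∃ t, separates F C (B t) = true := by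
  classical
  by_contra hbad
  push Not at hbad
  have hbad' : ∀ t, ∃ x ∈ remove C (B t),
      C.length < (component F (remove C (B t)) x).length
        + (component F (remove C (B t)) x).length := by
    intro t
    have := hbad t
    simp only [separates, ne_eq, List.all_eq_true, not_forall, Nat.ble_eq, not_le] at this
    obtain ⟨x, hx, hlt⟩ := this
    exact ⟨x, hx, hlt⟩
  choose x hx hlt using hbad'
  have hxt : ∀ t, x t ∉ B t := fun t => (mem_remove.1 (hx t)).2
  have := hT.connected.nonempty
  -- If no bag separates, each `t` has a component with more than half of `C`. A node `t` whose
  -- heavy side is smallest is compared with its neighbour `s` on that side, whose own heavy side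
  -- turns out to be smaller still.
  obtain ⟨t, ht⟩ := Finite.exists_min fun t => (side T B t (x t)).ncard
  obtain ⟨s₀, hs₀⟩ := h.exists_mem _ (hCn _ (mem_remove.1 (hx t)).1)
  have hwalk : ∀ u, u ∈ side T B t (x t) → ∀ p : T.Walk u t, ∃ s ∈ side T B t (x t), T.Adj s t := by
    intro u hu p
    induction p with
    | nil => exact absurd hu (not_mem_side (hxt _))
    | @cons u v w hadj p ih =>
      by_cases hv : v = w
      · exact ⟨u, hu, hv ▸ hadj⟩
      · have huw : u ≠ w := by
          rintro rfl
          exact not_mem_side (hxt _) hu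
        obtain ⟨s', hs', hc⟩ := hu
        exact ih ht hs₀ ⟨s', hs', hc.tail ⟨hadj, huw, hv⟩⟩
  obtain ⟨p⟩ := hT.connected.preconnected s₀ t
  obtain ⟨s, hs, hst⟩ := hwalk s₀ ⟨s₀, hs₀, Relation.ReflTransGen.refl⟩ p
  have hcomp : ∀ t, (component F (remove C (B t)) (x t)).Nodup ∧
      component F (remove C (B t)) (x t) ⊆ C := fun t =>
    ⟨(nodup_remove hC _).sublist component_sublist,
      fun y hy => (mem_remove.1 (component_sublist.subset hy)).1⟩
  -- Two subsets of `C`, each with more than half of its elements, must intersect.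
  obtain ⟨y, hyt, hys⟩ : ∃ y, y ∈ component F (remove C (B t)) (x t) ∧
      y ∈ component F (remove C (B s)) (x s) := by
    by_contra hno
    push Not at hno
    have hd : (component F (remove C (B t)) (x t) ++ component F (remove C (B s)) (x s)).Nodup :=
      List.nodup_append.2 ⟨(hcomp t).1, (hcomp s).1, fun a ha b hb e => hno a ha (e ▸ hb)⟩
    have hl := (hd.subperm (List.append_subset.2 ⟨(hcomp t).2, (hcomp s).2⟩)).length_le
    rw [List.length_append] at hl
    have := hlt t
    have := hlt s
    omega
  obtain ⟨u, hu⟩ := h.exists_mem y (hCn y ((hcomp t).2 hyt))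
  have hut := h.mem_side_of_mem_component hyt u hu
  have hus := h.mem_side_of_mem_component hys u hu
  -- Otherwise there would be connections from `s` to `u` avoiding `t` and from `u` to `t` avoiding
  -- `s`. Together they bypass the edge `st`, which is a bridge.
  have hts : t ∉ side T B s (x s) := by
    intro hts
    have h₁ := reachable_of_side (s := s) (h.side_connected (hxt t) hs hut)
    have h₂ := reachable_of_side (s := t) (h.side_connected (hxt s) hus hts)
    rw [Sym2.eq_swap] at h₂
    have hb := SimpleGraph.isAcyclic_iff_forall_adj_isBridge.1 hT.isAcyclic hst
    exact (SimpleGraph.isBridge_iff.1 hb) (h₁.trans h₂)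
  -- The heavy side of `s` contains neither `s` nor `t`, so moving inside it never meets `t`; the
  -- inclusion is strict since it omits `s`.
  have hss : side T B s (x s) ⊂ side T B t (x t) := by
    refine ⟨fun v hv => ?_, fun hsub => not_mem_side (hxt s) (hsub hs)⟩
    have hc := h.side_connected (hxt s) hus hv
    clear hv
    have : v ∈ side T B t (x t) ∧ v ∈ side T B s (x s) := by
      induction hc with
      | refl => exact ⟨hut, hus⟩
      | @tail b' c' _ hab ih =>
        have hb := show c' ∈ side T B s (x s) by
          obtain ⟨s', hs', hc'⟩ := ih.2
          exact ⟨s', hs', hc'.tail hab⟩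
        refine ⟨?_, hb⟩
        obtain ⟨s', hs', hc'⟩ := ih.1
        refine ⟨s', hs', hc'.tail ⟨hab.1, ?_, ?_⟩⟩
        · rintro rfl
          exact hts ih.2
        · rintro rfl
          exact hts hb
    exact this.1
  exact absurd (ht s) (not_le.2 (Set.ncard_lt_ncard hss (Set.toFinite _)))

/-- A separating bag exists, so the default value `[]` of `separator` is never used. -/
theorem separator_spec {N : ℕ} {T : SimpleGraph (Fin N)} {B : Fin N → List ℕ}
    (h : IsTreeBags F n T B) (hT : T.IsTree) {C : List ℕ}
    (hC : C.Nodup) (hCn : ∀ x ∈ C, x < n) :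
    ∃ t, separator F (List.ofFn B) C = B t ∧ separates F C (B t) = true := by
  obtain ⟨t, ht⟩ := h.exists_separates hT hC hCn
  have hmem : B t ∈ (List.ofFn B).filter fun B => separates F C B :=
    List.mem_filter.2 ⟨List.mem_ofFn.2 ⟨t, rfl⟩, ht⟩
  rw [separator]
  cases hl : (List.ofFn B).filter fun B => separates F C B with
  | nil => rw [hl] at hmem; cases hmem
  | cons b l =>
    have : b ∈ (List.ofFn B).filter fun B => separates F C B := by rw [hl]; simp
    obtain ⟨h₁, h₂⟩ := List.mem_filter.1 this
    obtain ⟨s, rfl⟩ := List.mem_ofFn.1 h₁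
    exact ⟨s, rfl, h₂⟩

end IsTreeBags

end TreeWidthSat
-- Path decompositions, and the invariant that keeps tables small
namespace TreeWidthSat

/-! ### Trees of maximal degree two -/

/-- A tree of maximal degree two has an injective numbering in which neighbours differ by at most
one. -/
theorem exists_numbering {W : Type} [Fintype W] {T : SimpleGraph W} (hT : T.IsTree)
    (hdeg : ∀ t, (T.neighborSet t).ncard ≤ 2) :
    ∃ f : W → ℤ, Function.Injective f ∧ ∀ a b, T.Adj a b → f b ≤ f a + 1 := by
  classical
  have := hT.connected.nonempty
  -- The numbering will be the distance from an end `r` of the path.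
  obtain ⟨r, hr⟩ : ∃ r, (T.neighborSet r).ncard ≤ 1 := by
    rcases subsingleton_or_nontrivial W with h | h
    · obtain ⟨r⟩ := this
      exact ⟨r, (Set.ncard_le_one (Set.toFinite _)).2 fun a _ b _ => Subsingleton.elim a b⟩
    · obtain ⟨r, hr⟩ := hT.exists_vert_degree_one_of_nontrivial
      refine ⟨r, ?_⟩
      rw [← hr, ← SimpleGraph.card_neighborSet_eq_degree, Set.ncard_eq_toFinset_card', Set.toFinset_card]
  have hc := hT.connected
  have hpred : ∀ k a, T.dist r a = k + 1 → ∃ b, T.Adj a b ∧ T.dist r b = k := by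
    intro k a ha
    obtain ⟨p, hp⟩ := hc.exists_walk_length_eq_dist a r
    rw [SimpleGraph.dist_comm, ha] at hp
    cases p with
    | nil => simp at hp
    | @cons _ b _ hab p =>
      refine ⟨b, hab, ?_⟩
      rw [SimpleGraph.Walk.length_cons] at hp
      have h₁ := SimpleGraph.dist_le p
      rw [SimpleGraph.dist_comm] at h₁
      have h₂ := hc.dist_triangle (u := r) (v := b) (w := a)
      have h₃ : T.dist b a = 1 := SimpleGraph.dist_eq_one_iff_adj.2 hab.symm
      omega
  -- Two nodes at distance k + 1 have predecessors at distance k, which coincide by induction. With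
  -- its own predecessor this node would have three neighbours or, if it is `r`, two; both are too
  -- many.
  have hinj : ∀ k a b, T.dist r a = k → T.dist r b = k → a = b := by
    intro k
    induction k with
    | zero =>
      intro a b ha hb
      rw [← hc.dist_eq_zero_iff.1 ha, ← hc.dist_eq_zero_iff.1 hb]
    | succ k ih =>
      intro a b ha hb
      by_contra hab
      obtain ⟨p, hap, hp⟩ := hpred k a ha
      obtain ⟨q, hbq, hq⟩ := hpred k b hb
      obtain rfl := ih p q hp hq
      cases k with
      | zero =>
        obtain rfl := hc.dist_eq_zero_iff.1 hp
        exact hab ((Set.ncard_le_one (Set.toFinite _)).1 hr a hap.symm b hbq.symm)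
      | succ k =>
        obtain ⟨c, hpc, hc'⟩ := hpred k p hp
        have hsub : ({a, b, c} : Set W) ⊆ T.neighborSet p := by
          rintro z (rfl | rfl | rfl)
          · exact hap.symm
          · exact hbq.symm
          · exact hpc
        have hca : a ≠ c := by rintro rfl; omega
        have hcb : b ≠ c := by rintro rfl; omega
        have h₁ := Set.ncard_le_ncard hsub (Set.toFinite _)
        rw [Set.ncard_eq_three.2 ⟨a, b, c, hab, hca, hcb, rfl⟩] at h₁
        have := hdeg p
        omega
  refine ⟨fun a => T.dist r a, fun a b hab => hinj _ a b rfl (by simpa using hab.symm),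
    fun a b hab => ?_⟩
  have h₂ := hc.dist_triangle (u := r) (v := a) (w := b)
  have h₃ : T.dist a b = 1 := SimpleGraph.dist_eq_one_iff_adj.2 hab
  simp only
  omega

namespace IsTreeBags

variable {W : Type} {F : List (Lit × Lit)} {n : ℕ} {T : SimpleGraph W} {B : W → List ℕ}

/-- A discrete intermediate value theorem: the chain of bags of `x` from `s` to `u` climbs by at
most one per edge, so it hits the number of `t`. -/
theorem mem_of_between (h : IsTreeBags F n T B) {f : W → ℤ} (hf : Function.Injective f)
    (hadj : ∀ a b, T.Adj a b → f b ≤ f a + 1) {x : ℕ} {s t u : W} (hs : x ∈ B s) (hu : x ∈ B u)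
    (hst : f s ≤ f t) (htu : f t ≤ f u) : x ∈ B t := by
  have hc := h.chain x s u hs hu
  suffices ∃ v, x ∈ B v ∧ f v = f t by
    obtain ⟨v, hv, hvt⟩ := this
    exact hf hvt ▸ hv
  clear hu
  induction hc with
  | refl => exact ⟨s, hs, le_antisymm hst htu⟩
  | @tail b c _ hbc ih =>
    by_cases hb : f t ≤ f b
    · exact ih hb
    · have := hadj b c hbc.1
      exact ⟨c, hbc.2.2, by omega⟩

end IsTreeBags

/-! ### The vertices that carry a table -/

/-- Conditions on a property `Good C L` of a component `C` and a set `L` of vertices outside `C`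
that make it an invariant of the recursion. -/
structure IsInvariant (F : List (Lit × Lit)) (bags : List (List ℕ)) (n m h₀ : ℕ)
    (Good : List ℕ → Finset ℕ → Prop) : Prop where
  mono : ∀ {C C' L L'}, C' ⊆ C → L' ⊆ L → Good C L → Good C' L'
  card_le : ∀ {C L}, Good C L → L.card ≤ 2 * m
  empty : ∀ C, (∀ x ∈ C, x < n) → Good C ∅
  step : ∀ {C : List ℕ} {L M : Finset ℕ} {y : ℕ}, C.Nodup → (∀ x ∈ C, x < n) → Good C L →
    (∀ x ∈ L, x ∉ C) → (∀ x ∈ M, x ∈ C ∧ x ∈ separator F bags C) →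
    M.card ≤ (C.filter fun x => (separator F bags C).contains x).length - h₀ →
    y ∈ remove C (separator F bags C) →
    Good (component F (remove C (separator F bags C)) y)
      ((L ∪ M).filter fun x =>
        ∃ z ∈ component F (remove C (separator F bags C)) y, adjB F x z = true)

/-- The case of arbitrary trees: all `w` possible separator vertices are branched on, so nothing is
ever tabulated. -/
theorem isInvariant_empty (F : List (Lit × Lit)) (n : ℕ) {N : ℕ} {T : SimpleGraph (Fin N)}
    {B : Fin N → List ℕ} (hB : IsTreeBags F n T B) (hT : T.IsTree) {w : ℕ}
    (hw : ∀ t, (B t).length ≤ w) :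
    IsInvariant F (List.ofFn B) n 0 w fun _ L => L = ∅ where
  mono := fun _ h h' => Finset.subset_empty.1 (h' ▸ h)
  card_le := fun h => by simp [h]
  empty := fun _ _ => rfl
  step := by
    intro C L M y hC hCn hL _ _ hM _
    obtain ⟨t, ht, -⟩ := hB.separator_spec hT hC hCn
    have hle : (C.filter fun x => (separator F (List.ofFn B) C).contains x).length ≤ w := by
      refine le_trans ?_ (hw t)
      refine ((hC.filter _).subperm fun x hx => ?_).length_le
      have := (List.mem_filter.1 hx).2
      rw [ht] at this
      simpa using this
    have : M = ∅ := Finset.card_eq_zero.1 (by omega)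
    subst hL this
    simp

section path

variable {F : List (Lit × Lit)} {n N : ℕ} {T : SimpleGraph (Fin N)} {B : Fin N → List ℕ}

/-- The table vertices of a component in a path decomposition: at most `m` of them are in bags to
the left, and at most `m` in bags to the right of the component. -/
def PathGood (B : Fin N → List ℕ) (m : ℕ) (f : Fin N → ℤ) (C : List ℕ) (L : Finset ℕ) : Prop :=
  ∃ (L₁ L₂ : Finset ℕ) (lo hi : ℤ), L ⊆ L₁ ∪ L₂ ∧ L₁.card ≤ m ∧ L₂.card ≤ m ∧
    (∀ x ∈ L₁, ∃ t, f t ≤ lo ∧ x ∈ B t) ∧ (∀ x ∈ L₂, ∃ t, hi ≤ f t ∧ x ∈ B t) ∧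
    ∀ x ∈ C, ∀ t, x ∈ B t → lo < f t ∧ f t < hi

/-- Reversing the path exchanges the two sides, so only parts to the left of a separator need a
proof. -/
theorem PathGood.neg {m : ℕ} {f : Fin N → ℤ} {C : List ℕ} {L : Finset ℕ}
    (h : PathGood B m f C L) : PathGood B m (fun t => -f t) C L := by
  obtain ⟨L₁, L₂, lo, hi, h, h₁, h₂, h₃, h₄, h₅⟩ := h
  refine ⟨L₂, L₁, -hi, -lo, by rwa [Finset.union_comm], h₂, h₁, fun x hx => ?_, fun x hx => ?_,
    fun x hx t ht => ?_⟩
  · obtain ⟨t, ht, hx⟩ := h₄ x hx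
    exact ⟨t, neg_le_neg ht, hx⟩
  · obtain ⟨t, ht, hx⟩ := h₃ x hx
    exact ⟨t, neg_le_neg ht, hx⟩
  · have := h₅ x hx t ht
    exact ⟨neg_lt_neg this.2, neg_lt_neg this.1⟩

theorem PathGood.mono {m : ℕ} {f : Fin N → ℤ} {C C' : List ℕ} {L L' : Finset ℕ}
    (h : PathGood B m f C L) (hC : C' ⊆ C) (hL : L' ⊆ L) : PathGood B m f C' L' := by
  obtain ⟨L₁, L₂, lo, hi, h, h₁, h₂, h₃, h₄, h₅⟩ := h
  exact ⟨L₁, L₂, lo, hi, hL.trans h, h₁, h₂, h₃, h₄, fun x hx => h₅ x (hC hx)⟩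

/-- The part of the component to the left of the separator. -/
theorem PathGood.left {m w : ℕ} (hm : m ≤ w) (hB : IsTreeBags F n T B)
    (hBw : ∀ t, (B t).length ≤ w) {f : Fin N → ℤ} (hf : Function.Injective f)
    (hadj : ∀ a b, T.Adj a b → f b ≤ f a + 1) {C C' : List ℕ} {L M : Finset ℕ} {t : Fin N}
    (hC : C.Nodup) (h : PathGood B m f C L) (hLC : ∀ x ∈ L, x ∉ C)
    (hM : ∀ x ∈ M, x ∈ C ∧ x ∈ B t)
    (hMc : M.card ≤ (C.filter fun x => (B t).contains x).length - (w - m))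
    (ht : ∃ x ∈ C, x ∈ B t) (hCC' : C' ⊆ C) (hC' : ∀ x ∈ C', ∀ s, x ∈ B s → f s < f t) :
    PathGood B m f C' ((L ∪ M).filter fun x => ∃ z ∈ C', adjB F x z = true) := by
  obtain ⟨L₁, L₂, lo, hi, h, h₁, h₂, h₃, h₄, h₅⟩ := h
  -- The left side is unchanged. On the right, the bag at `t` becomes the new boundary, and only its
  -- members can still be seen.
  refine ⟨L₁, ((L \ L₁).filter fun x => x ∈ B t) ∪ M, lo, f t, ?_, h₁, ?_, h₃, ?_, ?_⟩
  · intro x hx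
    obtain ⟨hx, z, hz, hxz⟩ := Finset.mem_filter.1 hx
    rcases Finset.mem_union.1 hx with hx | hx
    · by_cases hx₁ : x ∈ L₁
      · exact Finset.mem_union_left _ hx₁
      · refine Finset.mem_union_right _ (Finset.mem_union_left _ (Finset.mem_filter.2
          ⟨Finset.mem_sdiff.2 ⟨hx, hx₁⟩, ?_⟩))
        -- Such an `x` has a bag to the right of `t`, and as a neighbour of `C'` also one to the
        -- left of `t`. So it lies in the bag at `t`.
        have hx₂ : x ∈ L₂ := (Finset.mem_union.1 (h hx)).resolve_left hx₁
        obtain ⟨s, hs, hxs⟩ := h₄ x hx₂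
        obtain ⟨u, hxu, hzu⟩ := hB.exists_adj x z hxz
        obtain ⟨y, hy, hyt⟩ := ht
        have h₆ := (h₅ y hy t hyt).2
        have h₇ := hC' z hz u hzu
        exact hB.mem_of_between hf hadj hxu hxs h₇.le (by omega)
    · exact Finset.mem_union_right _ (Finset.mem_union_right _ hx)
  -- If `M` is not empty, the subtraction in `hMc` is not truncated. Old right vertices and all of
  -- `C ∩ B t` share a bag of size at most `w`, and `M` has `w - m` vertices fewer than `C ∩ B t`,
  -- which leaves at most `m`. If `M` is empty, the old bound on `L₂` does.
  · by_cases hM₀ : M = ∅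
    · subst hM₀
      rw [Finset.union_empty]
      refine (Finset.card_le_card fun x hx => ?_).trans h₂
      obtain ⟨hx, -⟩ := Finset.mem_filter.1 hx
      obtain ⟨hx, hx'⟩ := Finset.mem_sdiff.1 hx
      exact (Finset.mem_union.1 (h hx)).resolve_left hx'
    · have hpos : 0 < M.card := Finset.card_pos.2 (Finset.nonempty_iff_ne_empty.2 hM₀)
      have hle : ((L \ L₁).filter fun x => x ∈ B t).card +
          (C.filter fun x => (B t).contains x).length ≤ w := by
        rw [← List.toFinset_card_of_nodup (hC.filter _), ← Finset.card_union_of_disjoint]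
        · refine le_trans (Finset.card_le_card (t := (B t).toFinset) fun x hx => ?_)
            ((List.toFinset_card_le _).trans (hBw t))
          rw [List.mem_toFinset]
          rcases Finset.mem_union.1 hx with hx | hx
          · exact (Finset.mem_filter.1 hx).2
          · rw [List.mem_toFinset, List.mem_filter] at hx
            simpa using hx.2
        · rw [Finset.disjoint_left]
          intro x hx hx'
          rw [List.mem_toFinset, List.mem_filter] at hx'
          exact hLC x (Finset.mem_sdiff.1 (Finset.mem_filter.1 hx).1).1 hx'.1
      have := Finset.card_union_le ((L \ L₁).filter fun x => x ∈ B t) M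
      omega
  · intro x hx
    refine ⟨t, le_rfl, ?_⟩
    rcases Finset.mem_union.1 hx with hx | hx
    · exact (Finset.mem_filter.1 hx).2
    · exact (hM x hx).2
  · exact fun x hx s hs => ⟨(h₅ x (hCC' hx) s hs).1, hC' x hx s hs⟩

theorem isInvariant_pathGood {m w : ℕ} (hm : m ≤ w) (hB : IsTreeBags F n T B) (hT : T.IsTree)
    (hBw : ∀ t, (B t).length ≤ w) {f : Fin N → ℤ} (hf : Function.Injective f)
    (hadj : ∀ a b, T.Adj a b → f b ≤ f a + 1) :
    IsInvariant F (List.ofFn B) n m (w - m) (PathGood B m f) where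
  mono := fun h h' hg => hg.mono h h'
  card_le := by
    rintro C L ⟨L₁, L₂, lo, hi, h, h₁, h₂, -⟩
    have := Finset.card_le_card h
    have := Finset.card_union_le L₁ L₂
    omega
  empty := by
    intro C _
    obtain ⟨lo, hlo⟩ := (Set.finite_range f).bddBelow
    obtain ⟨hi, hhi⟩ := (Set.finite_range f).bddAbove
    refine ⟨∅, ∅, lo - 1, hi + 1, by simp, by simp, by simp, by simp, by simp, fun x _ t _ => ?_⟩
    have := hlo ⟨t, rfl⟩
    have := hhi ⟨t, rfl⟩
    omega
  step := by
    intro C L M y hC hCn hg hLC hM hMc hy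
    obtain ⟨t, ht, -⟩ := hB.separator_spec hT hC hCn
    rw [ht] at hM hMc hy ⊢
    set C' := component F (remove C (B t)) y with hC'
    have hCC' : C' ⊆ C := fun x hx => (mem_remove.1 (component_sublist.subset hx)).1
    -- A bag that misses `C` may lie outside the interval from `lo` to `hi`. Then `M` is empty, and
    -- the old boundaries serve.
    by_cases hne : ∃ x ∈ C, x ∈ B t
    swap
    · have hM₀ : M = ∅ := by
        refine Finset.eq_empty_of_forall_notMem fun x hx => hne ⟨x, hM x hx⟩
      subst hM₀
      rw [Finset.union_empty]
      exact hg.mono hCC' (Finset.filter_subset _ _)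
    have hadj' : ∀ a b, T.Adj a b → -f b ≤ -f a + 1 := fun a b hab => by
      have := hadj b a hab.symm
      omega
    have hf' : Function.Injective fun t => -f t := fun a b hab => hf (by simpa using hab)
    obtain ⟨s₀, hs₀⟩ := hB.exists_mem y (hCn y (mem_remove.1 hy).1)
    -- The bags of a component that avoids the bag at `t` all lie on the same side of `t`. Stated
    -- for a general numbering, it also covers the reversed path.
    have hside : ∀ (g : Fin N → ℤ), Function.Injective g →
        (∀ a b, T.Adj a b → g b ≤ g a + 1) → g s₀ < g t →
        ∀ x ∈ C', ∀ s, x ∈ B s → g s < g t := by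
      intro g hg hga hst
      have hone : ∀ x, x ∉ B t → ∀ s, x ∈ B s → g s < g t → ∀ u, x ∈ B u → g u < g t := by
        intro x hx s hs hst u hu
        by_contra hcon
        exact hx (hB.mem_of_between hg hga hs hu hst.le (not_lt.1 hcon))
      refine component_induction (P := fun x => ∀ s, x ∈ B s → g s < g t) ?_ ?_
      · exact hone y (mem_remove.1 hy).2 s₀ hs₀ hst
      · intro z _ x hx hz hzx
        obtain ⟨u, hzu, hxu⟩ := hB.exists_adj z x hzx
        exact hone x (mem_remove.1 hx).2 u hxu (hz u hzu)
    rcases lt_trichotomy (f s₀) (f t) with hlt | heq | hgt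
    · exact hg.left hm hB hBw hf hadj hC hLC hM hMc hne hCC' (hside f hf hadj hlt)
    · exact absurd (hf heq ▸ hs₀) (mem_remove.1 hy).2
    · have := hg.neg.left hm hB hBw hf' hadj' hC hLC hM hMc hne hCC'
        (hside (fun t => -f t) hf' hadj' (by simpa using hgt))
      simpa using this.neg

end path

end TreeWidthSat
-- Runs of the stack machine, batches of assignments, correctness of tables
namespace TreeWidthSat
open Enc

/-! ### Runs of the recursion -/

section runs

variable {e : Env} {X d : ℕ}

/-- From `s` the recursion reaches `s'` after `R` steps, and all states on the way have at most the
size `B` and are not final. -/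
inductive Steps (e : Env) (B : ℕ) : State → ℕ → State → Prop
  | refl {s : State} (h : sz s ≤ B) : Steps e B s 0 s
  | head {s s' : State} {R : ℕ} (h : sz s ≤ B) (hr : running s = true)
      (h' : Steps e B (step e s) R s') : Steps e B s (R + 1) s'

theorem Steps.trans {B R R' : ℕ} {s s' s'' : State} (h : Steps e B s R s')
    (h' : Steps e B s' R' s'') : Steps e B s (R + R') s'' := by
  induction h with
  | refl _ => rwa [Nat.zero_add]
  | head h hr _ ih => rw [Nat.add_right_comm]; exact .head h hr (ih h')

theorem Steps.mono {B B' R : ℕ} {s s' : State} (h : Steps e B s R s') (hB : B ≤ B') :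
    Steps e B' s R s' := by
  induction h with
  | refl h => exact .refl (h.trans hB)
  | head h hr _ ih => exact .head (h.trans hB) hr ih

theorem Steps.spec {B R : ℕ} {s s' : State} (h : Steps e B s R s') :
    (step e)^[R] s = s' ∧ (∀ j ≤ R, sz ((step e)^[j] s) ≤ B) ∧
      ∀ j < R, running ((step e)^[j] s) = true := by
  induction h with
  | refl h => exact ⟨rfl, fun j hj => by rwa [Nat.le_zero.1 hj], fun j hj => absurd hj (by omega)⟩
  | head h hr _ ih =>
    refine ⟨ih.1, fun j hj => ?_, fun j hj => ?_⟩
    · cases j with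
      | zero => exact h
      | succ j => exact ih.2.1 j (by omega)
    · cases j with
      | zero => exact hr
      | succ j => exact ih.2.2 j (by omega)

/-- The evaluation of the task `t` gives `T` in at most `R` steps and needs at most `d` times the
space `X`. -/
def Evals (e : Env) (X d : ℕ) (t : Task) (T : Table) (R : ℕ) : Prop :=
  ∀ K, ∃ R' ≤ R, Steps e (sz K + d * X) ([t], ([], K)) R' ([], (T, K))

theorem Evals.mono {d' R R' : ℕ} {t : Task} {T : Table} (h : Evals e X d t T R) (hd : d ≤ d')
    (hR : R ≤ R') : Evals e X d' t T R' := by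
  intro K
  obtain ⟨R₁, h₁, h⟩ := h K
  exact ⟨R₁, h₁.trans hR, h.mono (Nat.add_le_add_left (Nat.mul_le_mul_right _ hd) _)⟩

theorem evals_zero {t : Task} {T : Table} (hstep : ∀ K, callStep e t K = ([], (T, K)))
    (ht : sz t + 3 ≤ X) (hT : sz T + 3 ≤ X) : Evals e X 1 t T 1 := by
  intro K
  refine ⟨1, le_rfl, .head ?_ rfl ?_⟩
  · simp only [sz_pair, sz_cons, sz_nil]
    omega
  · change Steps e _ (callStep e t K) 0 _
    rw [hstep]
    refine .refl ?_
    simp only [sz_pair, sz_nil]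
    omega

/-- Both values of a vertex were put into one batch, so the single result `T` takes the place of
both results. The two extra steps are the call and the return. -/
theorem evals_one {t t₁ : Task} {T : Table} {x : List ℕ} {E : List Pat} {R : ℕ}
    (hstep : ∀ K, callStep e t K = ([t₁], ([], (x, (E, ([], []))) :: K)))
    (h : Evals e X d t₁ T R) (ht : sz t + 3 ≤ X)
    (hfr : sz ((x, (E, ([], []))) : Frame) + 1 ≤ X)
    (hT : sz (finish e x E T T) + 3 ≤ X) : Evals e X (d + 1) t (finish e x E T T) (R + 2) := by
  intro K
  obtain ⟨R₁, h₁, h⟩ := h ((x, (E, ([], []))) :: K)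
  have hb : sz K + (d + 1) * X = sz K + d * X + X := by ring
  refine ⟨R₁ + 1 + 1, by omega, .head ?_ rfl ?_⟩
  · simp only [sz_pair, sz_cons, sz_nil, hb]
    omega
  · change Steps e _ (callStep e t K) _ _
    rw [hstep]
    have h' := h.mono (B' := sz K + (d + 1) * X) (by rw [sz_cons]; omega)
    refine h'.trans (.head ?_ rfl (.refl ?_))
    · exact h'.spec.1 ▸ h'.spec.2.1 _ le_rfl
    · change sz (([], (finish e x E T T, K)) : State) ≤ _
      simp only [sz_pair, sz_nil, hb]
      omega

/-- The calls run one after the other in the same space: times add up, while the space grows only by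
one frame of size at most `X`. The three extra steps are the call, the switch to the second call,
and the return. -/
theorem evals_two {t t₁ t₂ : Task} {T₁ T₂ : Table} {x : List ℕ} {E : List Pat} {R₁ R₂ : ℕ}
    (hstep : ∀ K, callStep e t K = ([t₁], ([], (x, (E, ([t₂], []))) :: K)))
    (h₁ : Evals e X d t₁ T₁ R₁) (h₂ : Evals e X d t₂ T₂ R₂) (ht : sz t + 3 ≤ X)
    (hfr : sz ((x, (E, ([t₂], []))) : Frame) + 1 ≤ X)
    (hfr' : sz ((x, (E, ([], [T₁]))) : Frame) + 1 ≤ X)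
    (hT : sz (finish e x E T₁ T₂) + 3 ≤ X) :
    Evals e X (d + 1) t (finish e x E T₁ T₂) (R₁ + R₂ + 3) := by
  intro K
  obtain ⟨R₁', hR₁, h₁⟩ := h₁ ((x, (E, ([t₂], []))) :: K)
  obtain ⟨R₂', hR₂, h₂⟩ := h₂ ((x, (E, ([], [T₁]))) :: K)
  have hb : sz K + (d + 1) * X = sz K + d * X + X := by ring
  refine ⟨R₁' + (R₂' + 1 + 1) + 1, by omega, .head ?_ rfl ?_⟩
  · simp only [sz_pair, sz_cons, sz_nil, hb]
    omega
  · change Steps e _ (callStep e t K) _ _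
    rw [hstep]
    have h₁' := h₁.mono (B' := sz K + (d + 1) * X) (by rw [sz_cons]; omega)
    have h₂' := h₂.mono (B' := sz K + (d + 1) * X) (by rw [sz_cons]; omega)
    refine h₁'.trans (.head ?_ rfl ?_)
    · exact h₁'.spec.1 ▸ h₁'.spec.2.1 _ le_rfl
    · change Steps e _ ([t₂], ([], (x, (E, ([], [T₁]))) :: K)) _ _
      refine h₂'.trans (.head ?_ rfl (.refl ?_))
      · exact h₂'.spec.1 ▸ h₂'.spec.2.1 _ le_rfl
      · change sz (([], (finish e x E T₁ T₂, K)) : State) ≤ _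
        simp only [sz_pair, sz_nil, hb]
        omega

end runs

/-! ### Batches of partial assignments -/

/-- The domain has a fixed order without repetitions, so a literal of `τ` can occur in `τ'` only at
the same position. -/
theorem Pat.eq_of_subset {τ τ' : Pat} (h : τ.map Prod.fst = τ'.map Prod.fst)
    (hn : (τ.map Prod.fst).Nodup) (hs : τ ⊆ τ') : τ = τ' := by
  have hl : τ.length = τ'.length := by simpa using congrArg List.length h
  refine List.ext_getElem hl fun i hi hi' => ?_
  obtain ⟨j, hj, hij⟩ := List.getElem_of_mem (hs (List.getElem_mem hi))
  have h₁ : (τ.map Prod.fst)[i]'(by simpa using hi) = (τ.map Prod.fst)[j]'(by simpa [hl] using hj) := by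
    rw [List.getElem_map, ← hij]
    simp only [h, List.getElem_map]
  have := (hn.getElem_inj_iff).1 h₁
  subst this
  exact hij.symm

/-- The partial assignments in `E` have the same domain, in a fixed order, and differ only
in `L`. No vertex in `U` is assigned. -/
structure IsBatch (n : ℕ) (U : List ℕ) (L : Finset ℕ) (E : List Pat) : Prop where
  nodup : U.Nodup
  lt : ∀ x ∈ U, x < n
  nodup_pats : E.Nodup
  exists_dom : ∃ dm : List ℕ, dm.Nodup ∧ (∀ x ∈ dm, x < n ∧ x ∉ U) ∧ (∀ x ∈ L, x ∈ dm) ∧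
    ∀ τ ∈ E, τ.map Prod.fst = dm
  agree : ∀ τ ∈ E, ∀ τ' ∈ E, ∀ l ∈ τ, l.1 ∉ L → l ∈ τ'

theorem length_le_of_nodup {n : ℕ} {l : List ℕ} (h : l.Nodup) (hl : ∀ x ∈ l, x < n) :
    l.length ≤ n := by
  have := (h.subperm (l₂ := List.range n) fun x hx => List.mem_range.2 (hl x hx)).length_le
  simpa using this

theorem sz_le_of_nodup {n : ℕ} {l : List ℕ} (h : l.Nodup) (hl : ∀ x ∈ l, x < n) :
    sz l ≤ n * n + n := by
  refine (sz_le_of_forall (B := n) fun x hx => by rw [sz_nat]; exact (hl x hx).le).trans ?_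
  have := Nat.mul_le_mul_right (n + 1) (length_le_of_nodup h hl)
  linarith

namespace IsBatch

variable {n : ℕ} {U : List ℕ} {L : Finset ℕ} {E : List Pat}

theorem eq_of_subset (h : IsBatch n U L E) {τ τ' : Pat} (hτ : τ ∈ E) (hτ' : τ' ∈ E)
    (hs : τ ⊆ τ') : τ = τ' := by
  obtain ⟨dm, h₁, -, -, h₂⟩ := h.exists_dom
  exact Pat.eq_of_subset ((h₂ τ hτ).trans (h₂ τ' hτ').symm) ((h₂ τ hτ).symm ▸ h₁) hs

/-- A member of the batch is determined by the set of vertices of `L` at which it is true. -/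
theorem length_le (h : IsBatch n U L E) : E.length ≤ 2 ^ L.card := by
  classical
  obtain ⟨dm, h₁, -, -, h₂⟩ := h.exists_dom
  let f : Pat → Finset ℕ := fun τ => L.filter fun x => (x, true) ∈ τ
  have hf : Set.InjOn f {τ | τ ∈ E} := by
    intro τ hτ τ' hτ' hff
    refine h.eq_of_subset hτ hτ' ?_
    rintro ⟨x, b⟩ hl
    by_cases hx : x ∈ L
    · have hx' : x ∈ τ'.map Prod.fst := by
        rw [h₂ τ' hτ', ← h₂ τ hτ]
        exact List.mem_map_of_mem hl
      obtain ⟨⟨y, c⟩, hc, hyx⟩ := List.mem_map.1 hx'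
      simp only at hyx
      subst hyx
      have huniq : ∀ σ ∈ E, ∀ {a b : Bool}, (y, a) ∈ σ → (y, b) ∈ σ → a = b := by
        intro σ hσ a b ha hb
        have hn : (σ.map Prod.fst).Nodup := (h₂ σ hσ).symm ▸ h₁
        exact (Prod.ext_iff.1 (List.inj_on_of_nodup_map hn ha hb rfl)).2
      have hiff : (y, true) ∈ τ ↔ (y, true) ∈ τ' := by
        have := Finset.ext_iff.1 hff y
        simpa [f, hx] using this
      cases b <;> cases c
      · exact hc
      · exact absurd (huniq τ hτ hl (hiff.2 hc)) (by simp)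
      · exact absurd (huniq τ' hτ' hc (hiff.1 hl)) (by simp)
      · exact hc
    · exact h.agree τ hτ τ' hτ' _ hl hx
  rw [← List.toFinset_card_of_nodup h.nodup_pats, ← Finset.card_powerset]
  refine Finset.card_le_card_of_injOn f (fun τ _ => ?_) fun a ha b hb hab => ?_
  · exact Finset.mem_coe.2 (Finset.mem_powerset.2 (Finset.filter_subset _ _))
  · exact hf (by simpa using ha) (by simpa using hb) hab

theorem sz_pat_le (h : IsBatch n U L E) {τ : Pat} (hτ : τ ∈ E) : sz τ ≤ n * (n + 2) := by
  obtain ⟨dm, h₁, h₃, -, h₂⟩ := h.exists_dom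
  have hl : ∀ l ∈ τ, sz l ≤ n + 1 := by
    intro l hl
    have : l.1 < n := (h₃ l.1 (h₂ τ hτ ▸ List.mem_map_of_mem hl)).1
    have := sz_bool_le l.2
    rw [sz_prod, sz_nat]
    omega
  have hlen : τ.length ≤ n := by
    rw [← List.length_map (f := Prod.fst), h₂ τ hτ]
    exact length_le_of_nodup h₁ fun x hx => (h₃ x hx).1
  exact (sz_le_of_forall hl).trans (by nlinarith)

theorem extend_one (h : IsBatch n U L E) {y : ℕ} (hy : y ∈ U) (b : Bool) :
    IsBatch n (remove U [y]) L (extend (y, b) E) where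
  nodup := nodup_remove h.nodup _
  lt := fun x hx => h.lt x (mem_remove.1 hx).1
  nodup_pats := h.nodup_pats.map fun _ _ h => (List.cons.inj h).2
  exists_dom := by
    obtain ⟨dm, h₁, h₂, h₃, h₄⟩ := h.exists_dom
    refine ⟨y :: dm, List.nodup_cons.2 ⟨fun hd => (h₂ y hd).2 hy, h₁⟩, ?_,
      fun x hx => List.mem_cons_of_mem _ (h₃ x hx), ?_⟩
    · intro x hx
      rw [mem_remove]
      rcases List.mem_cons.1 hx with rfl | hx
      · exact ⟨h.lt _ hy, by simp⟩
      · exact ⟨(h₂ x hx).1, fun hh => (h₂ x hx).2 hh.1⟩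
    · intro τ hτ
      obtain ⟨σ, hσ, rfl⟩ := List.mem_map.1 hτ
      simp [h₄ σ hσ]
  agree := by
    intro τ hτ τ' hτ' l hl hL
    obtain ⟨σ, hσ, rfl⟩ := List.mem_map.1 hτ
    obtain ⟨σ', hσ', rfl⟩ := List.mem_map.1 hτ'
    rcases List.mem_cons.1 hl with rfl | hl
    · simp
    · exact List.mem_cons_of_mem _ (h.agree σ hσ σ' hσ' l hl hL)

/-- Here the members differ at `y`, so `y` joins the free vertices. Under `extend_one` all members
agree at `y`, and `L` stays the same. -/
theorem extend_both (h : IsBatch n U L E) {y : ℕ} (hy : y ∈ U) :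
    IsBatch n (remove U [y]) (insert y L) (extend (y, false) E ++ extend (y, true) E) where
  nodup := nodup_remove h.nodup _
  lt := fun x hx => h.lt x (mem_remove.1 hx).1
  nodup_pats := by
    refine List.nodup_append.2 ⟨(h.extend_one hy false).nodup_pats,
      (h.extend_one hy true).nodup_pats, ?_⟩
    intro a ha b hb
    obtain ⟨σ, hσ, rfl⟩ := List.mem_map.1 ha
    obtain ⟨σ', hσ', rfl⟩ := List.mem_map.1 hb
    simp
  exists_dom := by
    obtain ⟨dm, h₁, h₂, h₃, h₄⟩ := h.exists_dom
    refine ⟨y :: dm, List.nodup_cons.2 ⟨fun hd => (h₂ y hd).2 hy, h₁⟩, ?_, fun x hx => ?_, ?_⟩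
    · intro x hx
      rw [mem_remove]
      rcases List.mem_cons.1 hx with rfl | hx
      · exact ⟨h.lt _ hy, by simp⟩
      · exact ⟨(h₂ x hx).1, fun hh => (h₂ x hx).2 hh.1⟩
    · rcases Finset.mem_insert.1 hx with rfl | hx
      · simp
      · exact List.mem_cons_of_mem _ (h₃ x hx)
    · intro τ hτ
      rcases List.mem_append.1 hτ with hτ | hτ <;>
      · obtain ⟨σ, hσ, rfl⟩ := List.mem_map.1 hτ
        simp [h₄ σ hσ]
  agree := by
    have : ∀ τ ∈ extend (y, false) E ++ extend (y, true) E, ∃ σ ∈ E, ∃ b, τ = (y, b) :: σ := by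
      intro τ hτ
      rcases List.mem_append.1 hτ with hτ | hτ <;>
      · obtain ⟨σ, hσ, rfl⟩ := List.mem_map.1 hτ
        exact ⟨σ, hσ, _, rfl⟩
    intro τ hτ τ' hτ' l hl hL
    obtain ⟨σ, hσ, b, rfl⟩ := this τ hτ
    obtain ⟨σ', hσ', b', rfl⟩ := this τ' hτ'
    rw [Finset.mem_insert, not_or] at hL
    rcases List.mem_cons.1 hl with rfl | hl
    · exact absurd rfl hL.1
    · exact List.mem_cons_of_mem _ (h.agree σ hσ σ' hσ' l hl hL.2)

theorem remove (h : IsBatch n U L E) (C : List ℕ) : IsBatch n (remove U C) L E where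
  nodup := nodup_remove h.nodup _
  lt := fun x hx => h.lt x (mem_remove.1 hx).1
  nodup_pats := h.nodup_pats
  exists_dom := by
    obtain ⟨dm, h₁, h₂, h₃, h₄⟩ := h.exists_dom
    exact ⟨dm, h₁, fun x hx => ⟨(h₂ x hx).1, fun hh => (h₂ x hx).2 (mem_remove.1 hh).1⟩, h₃, h₄⟩
  agree := h.agree

end IsBatch

/-- The program compares assignments by inclusion only; the hypothesis makes this a test for
equality. -/
theorem dedupPat_spec (E : List Pat) (hE : ∀ σ ∈ E, ∀ τ ∈ E, σ ⊆ τ → σ = τ) :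
    (dedupPat E).Nodup ∧ ∀ τ, τ ∈ dedupPat E ↔ τ ∈ E := by
  induction E using List.reverseRecOn with
  | nil => simp [dedupPat]
  | append_singleton E τ ih =>
    have ih := ih fun σ hσ τ hτ => hE σ (by simp [hσ]) τ (by simp [hτ])
    have hd : dedupPat (E ++ [τ]) =
        if ((dedupPat E).any fun σ => subPat σ τ) = true then dedupPat E else τ :: dedupPat E := by
      simp [dedupPat, List.foldl_append]
    have hiff : ((dedupPat E).any fun σ => subPat σ τ) = true ↔ τ ∈ E := by
      rw [List.any_eq_true]
      constructor
      · rintro ⟨σ, hσ, h⟩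
        have hσ' := (ih.2 σ).1 hσ
        exact hE σ (by simp [hσ']) τ (by simp) (subPat_iff.1 h) ▸ hσ'
      · exact fun h => ⟨τ, (ih.2 τ).2 h, subPat_iff.2 fun _ h => h⟩
    rw [hd]
    split_ifs with h
    · rw [hiff] at h
      refine ⟨ih.1, fun σ => ?_⟩
      rw [ih.2, List.mem_append, List.mem_singleton]
      constructor
      · exact Or.inl
      · rintro (h' | rfl)
        · exact h'
        · exact h
    · rw [hiff] at h
      refine ⟨List.nodup_cons.2 ⟨fun h' => h ((ih.2 τ).1 h'), ih.1⟩, fun σ => ?_⟩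
      rw [List.mem_cons, ih.2, List.mem_append, List.mem_singleton, or_comm]

section componentBatch

variable {F : List (Lit × Lit)} {n : ℕ} {U C : List ℕ} {L : Finset ℕ} {E : List Pat}

theorem mem_restrict {τ : Pat} {l : Lit} :
    l ∈ restrict F C τ ↔ l ∈ τ ∧ ∃ y ∈ C, adjB F l.1 y = true := by
  simp [restrict]

theorem map_fst_restrict (τ : Pat) : (restrict F C τ).map Prod.fst =
    (τ.map Prod.fst).filter fun x => C.any fun y => adjB F x y := by
  rw [restrict, List.filter_map]
  rfl

theorem IsBatch.restrict_eq (h : IsBatch n U L E) {σ τ : Pat} (hσ : σ ∈ E) (hτ : τ ∈ E)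
    (hs : restrict F C σ ⊆ τ) : restrict F C σ = restrict F C τ := by
  obtain ⟨dm, h₁, -, -, h₂⟩ := h.exists_dom
  refine Pat.eq_of_subset ?_ ?_ fun l hl => mem_restrict.2 ⟨hs hl, (mem_restrict.1 hl).2⟩
  · rw [map_fst_restrict, map_fst_restrict, h₂ σ hσ, h₂ τ hτ]
  · rw [map_fst_restrict, h₂ σ hσ]
    exact h₁.filter _

theorem IsBatch.dedup_spec (h : IsBatch n U L E) :
    (dedupPat (E.map fun τ => restrict F C τ)).Nodup ∧
      ∀ κ, κ ∈ dedupPat (E.map fun τ => restrict F C τ) ↔ ∃ τ ∈ E, restrict F C τ = κ := by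
  have := dedupPat_spec (E.map fun τ => restrict F C τ) fun σ hσ τ hτ hs => by
    obtain ⟨σ', hσ', rfl⟩ := List.mem_map.1 hσ
    obtain ⟨τ', hτ', rfl⟩ := List.mem_map.1 hτ
    exact h.restrict_eq hσ' hτ' fun l hl => (mem_restrict.1 (hs hl)).1
  exact ⟨this.1, fun κ => (this.2 κ).trans List.mem_map⟩

/-- Forgetting the values that a component cannot see shrinks the set of free vertices, and removing
duplicates turns this into a smaller table. -/
theorem IsBatch.component (h : IsBatch n U L E) (hC : C.Sublist U) :
    IsBatch n C (L.filter fun x => ∃ z ∈ C, adjB F x z = true)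
      (dedupPat (E.map fun τ => restrict F C τ)) where
  nodup := h.nodup.sublist hC
  lt := fun x hx => h.lt x (hC.subset hx)
  nodup_pats := h.dedup_spec.1
  exists_dom := by
    obtain ⟨dm, h₁, h₂, h₃, h₄⟩ := h.exists_dom
    refine ⟨dm.filter fun x => C.any fun y => adjB F x y, h₁.filter _, fun x hx => ?_,
      fun x hx => ?_, fun κ hκ => ?_⟩
    · have := h₂ x (List.mem_filter.1 hx).1
      exact ⟨this.1, fun hh => this.2 (hC.subset hh)⟩
    · obtain ⟨hx, hz⟩ := Finset.mem_filter.1 hx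
      exact List.mem_filter.2 ⟨h₃ x hx, by simpa using hz⟩
    · obtain ⟨τ, hτ, rfl⟩ := (h.dedup_spec.2 κ).1 hκ
      rw [map_fst_restrict, h₄ τ hτ]
  agree := by
    intro κ hκ κ' hκ' l hl hL
    obtain ⟨τ, hτ, rfl⟩ := (h.dedup_spec.2 κ).1 hκ
    obtain ⟨τ', hτ', rfl⟩ := (h.dedup_spec.2 κ').1 hκ'
    obtain ⟨hl, hz⟩ := mem_restrict.1 hl
    refine mem_restrict.2 ⟨h.agree τ hτ τ' hτ' l hl fun hh => hL ?_, hz⟩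
    exact Finset.mem_filter.2 ⟨hh, hz⟩

end componentBatch

/-! ### Tables of values -/

/-- The table `T` gives the sums over the values of the vertices in `U` for all assignments
in `E`. -/
def IsTable (F : List (Lit × Lit)) (nv n : ℕ) (U : List ℕ) (E : List Pat) (T : Table) : Prop :=
  ∃ f : Pat → Num, T = E.map (fun τ => (τ, f τ)) ∧
    ∀ τ ∈ E, Num.Represents (n + 1) (f τ) (partitionSum F nv U τ)

section tables

variable {F : List (Lit × Lit)} {nv n : ℕ} {U C : List ℕ} {L : Finset ℕ} {E : List Pat}
  {T T₀ T₁ : Table}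

/-- `lookup` takes the first key contained in `τ`, so it also finds the entry of the restriction of
`τ` to a component, provided that this key is the only one. -/
theorem lookup_map {f : Pat → Num} {κ τ : Pat} (hκ : κ ∈ E) (hκτ : κ ⊆ τ)
    (h : ∀ κ' ∈ E, κ' ⊆ τ → κ' = κ) : lookup (E.map fun τ => (τ, f τ)) τ = f κ := by
  rw [lookup, List.filter_map]
  have hmem : κ ∈ E.filter ((fun e : Pat × Num => subPat e.1 τ) ∘ fun τ => (τ, f τ)) :=
    List.mem_filter.2 ⟨hκ, subPat_iff.2 hκτ⟩
  cases hl : E.filter ((fun e : Pat × Num => subPat e.1 τ) ∘ fun τ => (τ, f τ)) with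
  | nil => rw [hl] at hmem; cases hmem
  | cons κ' l =>
    have : κ' ∈ E.filter ((fun e : Pat × Num => subPat e.1 τ) ∘ fun τ => (τ, f τ)) := by
      rw [hl]
      simp
    obtain ⟨h₁, h₂⟩ := List.mem_filter.1 this
    rw [← h κ' h₁ (subPat_iff.1 h₂)]
    rfl

theorem IsTable.lookup_self (hT : IsTable F nv n U E T) {U' : List ℕ} (hE : IsBatch n U' L E)
    {τ : Pat} (hτ : τ ∈ E) : Num.Represents (n + 1) (lookup T τ) (partitionSum F nv U τ) := by
  obtain ⟨f, rfl, hf⟩ := hT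
  rw [lookup_map hτ (fun _ h => h) fun κ hκ hs => hE.eq_of_subset hκ hτ hs]
  exact hf τ hτ

theorem isTable_one (E : List Pat) : IsTable F nv n [] E (E.map fun τ => (τ, Num.one n)) :=
  ⟨fun _ => Num.one n, rfl, fun _ _ => Num.represents_one n⟩

theorem isTable_sumTable (hF : ∀ l l', (l, l') ∈ F → (l', l) ∈ F) (hU : U.Nodup) {y : ℕ}
    (hy : y ∈ U)
    (h₀ : ∀ τ ∈ E, Num.Represents (n + 1) (lookup T₀ ((y, false) :: τ))
      (partitionSum F nv (remove U [y]) ((y, false) :: τ)))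
    (h₁ : ∀ τ ∈ E, Num.Represents (n + 1) (lookup T₁ ((y, true) :: τ))
      (partitionSum F nv (remove U [y]) ((y, true) :: τ))) :
    IsTable F nv n U E (sumTable F nv y E T₀ T₁) := by
  refine ⟨_, rfl, fun τ hτ => ?_⟩
  rw [partitionSum_remove hF hU hy]
  exact (represents_weigh (h₀ τ hτ)).add (represents_weigh (h₁ τ hτ))

theorem adjB_symm (hF : ∀ l l', (l, l') ∈ F → (l', l) ∈ F) {x y : ℕ} (h : adjB F x y = true) :
    adjB F y x = true := by
  obtain ⟨b, c, h⟩ := adjB_iff.1 h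
  exact adjB_iff.2 ⟨c, b, hF _ _ h⟩

/-- A component is closed under adjacency in `U`, so the sum splits. Its factor is read from the
table of restricted assignments by locality. -/
theorem isTable_prodTable (hF : ∀ l l', (l, l') ∈ F → (l', l) ∈ F) (hE : IsBatch n U L E)
    {x : ℕ} (hx : x ∈ U)
    (h₀ : IsTable F nv n (component F U x)
      (dedupPat (E.map fun τ => restrict F (component F U x) τ)) T₀)
    (h₁ : IsTable F nv n (remove U (component F U x)) E T₁) :
    IsTable F nv n U E (prodTable E T₀ T₁) := by
  refine ⟨_, rfl, fun τ hτ => ?_⟩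
  rw [partitionSum_split hF hE.nodup (hE.nodup.sublist component_sublist)
    component_sublist.subset]
  · refine Num.Represents.mul ?_ (h₁.lookup_self hE hτ)
    obtain ⟨f, rfl, hf⟩ := h₀
    have hmem := (hE.dedup_spec.2 (restrict F (component F U x) τ)).2 ⟨τ, hτ, rfl⟩
    rw [lookup_map hmem (fun l hl => (mem_restrict.1 hl).1)]
    · rw [partitionSum_congr (τ' := restrict F (component F U x) τ)]
      · exact hf _ hmem
      · intro l y hy hl
        rw [mem_restrict]
        exact ⟨fun h => ⟨h, y, hy, adjB_symm hF hl⟩, fun h => h.1⟩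
    · intro κ hκ hs
      obtain ⟨σ, hσ, rfl⟩ := (hE.dedup_spec.2 κ).1 hκ
      exact hE.restrict_eq hσ hτ hs
  · intro y hy hyC z hz
    by_contra h
    exact hyC (component_closed hx hz hy (adjB_symm hF (by simpa using h)))

end tables

end TreeWidthSat
-- Counting steps and space of the recursion
namespace TreeWidthSat
open Enc

/-! ### The analysis of the recursion -/

/-- The properties of the environment on which the analysis of the recursion rests. -/
structure Setting (F : List (Lit × Lit)) (bags : List (List ℕ)) (n m h₀ : ℕ)
    (Good : List ℕ → Finset ℕ → Prop) : Prop where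
  symm : ∀ l l', (l, l') ∈ F → (l', l) ∈ F
  inv : IsInvariant F bags n m h₀ Good
  separates : ∀ C : List ℕ, C.Nodup → (∀ x ∈ C, x < n) →
    separates F C (separator F bags C) = true
  length_le : ∀ C : List ℕ, C.Nodup → (∀ x ∈ C, x < n) →
    (C.filter fun x => (separator F bags C).contains x).length ≤ h₀ + m
  le : h₀ ≤ n

/-- At most `2 * m` free vertices come from outside the component and `m` from the current
separator, whence `3 * m`. -/
theorem IsBatch.sz_le {n m : ℕ} {U : List ℕ} {L : Finset ℕ} {E : List Pat}
    (h : IsBatch n U L E) (hL : L.card ≤ 3 * m) : sz E ≤ 2 ^ (3 * m) * (n + 2) ^ 2 := by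
  refine (sz_le_of_forall fun τ hτ => h.sz_pat_le hτ).trans (Nat.mul_le_mul ?_ (by nlinarith))
  exact h.length_le.trans (Nat.pow_le_pow_right (by norm_num) hL)

theorem IsTable.sz_le {F : List (Lit × Lit)} {nv n m : ℕ} {U U' : List ℕ} {L : Finset ℕ}
    {E : List Pat} {T : Table} (hT : IsTable F nv n U E T) (h : IsBatch n U' L E)
    (hL : L.card ≤ 3 * m) : sz T ≤ 2 ^ (3 * m) * (n + 2) ^ 2 := by
  obtain ⟨f, rfl, hf⟩ := hT
  refine (sz_le_of_forall (B := n * (n + 2) + 2 * (n + 1) + 1) fun e he => ?_).trans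
    (Nat.mul_le_mul ?_ (by nlinarith))
  · obtain ⟨τ, hτ, rfl⟩ := List.mem_map.1 he
    have h₁ := h.sz_pat_le hτ
    have h₂ := Num.sz_le (f τ)
    rw [(hf τ hτ).1] at h₂
    rw [sz_pair]
    omega
  · rw [List.length_map]
    exact h.length_le.trans (Nat.pow_le_pow_right (by norm_num) hL)

theorem sz_list_le {n m : ℕ} {l : List ℕ} (h : l.Nodup) (hl : ∀ x ∈ l, x < n) :
    sz l ≤ 2 ^ (3 * m) * (n + 2) ^ 2 :=
  (sz_le_of_nodup h hl).trans
    ((show n * n + n ≤ 1 * (n + 2) ^ 2 by nlinarith).trans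
      (Nat.mul_le_mul_right _ Nat.one_le_two_pow))

theorem le_tableSize (n m : ℕ) : n + 4 ≤ 2 ^ (3 * m) * (n + 2) ^ 2 :=
  (show n + 4 ≤ 1 * (n + 2) ^ 2 by nlinarith).trans
      (Nat.mul_le_mul_right _ Nat.one_le_two_pow)

theorem remove_nil (U : List ℕ) : remove U [] = U := by simp [remove]

theorem remove_cons (U P : List ℕ) (y : ℕ) : remove (remove U [y]) P = remove U (y :: P) := by
  simp [remove, List.filter_filter, Bool.and_comm]

theorem length_remove_singleton_lt {U : List ℕ} {y : ℕ} (hy : y ∈ U) :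
    (remove U [y]).length < U.length := by
  rw [remove, List.length_filter_lt_length_iff_exists]
  exact ⟨y, hy, by simp⟩

theorem IsBatch.not_mem {n : ℕ} {U : List ℕ} {L : Finset ℕ} {E : List Pat}
    (h : IsBatch n U L E) {x : ℕ} (hx : x ∈ L) : x ∉ U := by
  obtain ⟨dm, -, h₂, h₃, -⟩ := h.exists_dom
  exact (h₂ x (h₃ x hx)).2

/-- A balanced separator meets a component. -/
theorem exists_mem_separator {F : List (Lit × Lit)} {U B : List ℕ} {x : ℕ} (hU : U.Nodup)
    (hx : x ∈ U) (h : separates F (component F U x) B = true) : ∃ y ∈ component F U x, y ∈ B := by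
  by_contra hno
  push Not at hno
  have hr : remove (component F U x) B = component F U x := by
    rw [remove, List.filter_eq_self]
    intro y hy
    simpa using hno y hy
  have hxC := mem_component_self (F := F) hx
  rw [separates, hr, List.all_eq_true] at h
  have h₁ := h x hxC
  rw [Nat.ble_eq] at h₁
  have h₂ : ∀ y ∈ component F U x, y ∈ component F U x ∧
      y ∈ component F (component F U x) x := by
    refine component_induction (P := fun y => y ∈ component F U x ∧
      y ∈ component F (component F U x) x) ⟨hxC, mem_component_self hxC⟩ ?_
    intro z _ y hy hz hzy
    have := component_closed hx hz.1 hy hzy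
    exact ⟨this, component_closed hxC hz.2 this hzy⟩
  have h₃ := ((hU.sublist component_sublist).subperm fun y hy => (h₂ y hy).2).length_le
  have h₄ := List.length_pos_of_mem hxC
  omega

section analysis

variable {F : List (Lit × Lit)} {bags : List (List ℕ)} {nv n m h₀ : ℕ}
  {Good : List ℕ → Finset ℕ → Prop}

/-- Tasks without pending vertices, with small components, are evaluated in the given number of
steps. -/
def EvalsComponents (F : List (Lit × Lit)) (bags : List (List ℕ)) (nv n m h₀ : ℕ)
    (Good : List ℕ → Finset ℕ → Prop) (s G : ℕ) : Prop :=
  ∀ (U : List ℕ) (L : Finset ℕ) (E : List Pat) (h : ℕ), IsBatch n U L E → L.card ≤ 3 * m →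
    h ≤ n →
    (∀ x ∈ U, (component F U x).length < s ∧
      Good (component F U x) (L.filter fun y => ∃ z ∈ component F U x, adjB F y z = true)) →
    ∃ T, IsTable F nv n U E T ∧
      Evals (F, (nv, (bags, (h₀, n)))) (16 * (2 ^ (3 * m) * (n + 2) ^ 2)) (2 * U.length + 1)
        (U, ([], (h, E))) T (U.length * G + 1)

/-- The set `M` collects the separator vertices already put into the batch; the others that are done
have one fixed value per call. When none is pending, balance has halved the components, so `hend`
applies. The step bound solves the recurrences: a branching vertex takes x to 2x + 3, which the `-
3` turns into exact doubling, and a batched vertex adds only 2. Each pending vertex treated costs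
one frame but makes `U` smaller, which pays for it. -/
theorem evals_pending (S : Setting F bags n m h₀ Good) {s G : ℕ}
    (hend : EvalsComponents F bags nv n m h₀ Good s G) {C : List ℕ} {L : Finset ℕ}
    (hC : C.Nodup) (hCn : ∀ x ∈ C, x < n) (hCs : C.length < 2 * s) (hg : Good C L)
    (hL : ∀ x ∈ L, x ∉ C) (P : List ℕ) :
    ∀ (U : List ℕ) (h : ℕ) (M : Finset ℕ) (E : List Pat), P.Nodup → P ⊆ U →
      (∀ x ∈ P, x ∈ C ∧ x ∈ separator F bags C) →
      remove U P = remove C (separator F bags C) → IsBatch n U (L ∪ M) E →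
      (∀ x ∈ M, x ∈ C ∧ x ∈ separator F bags C) →
      M.card + (P.length - h) ≤ (C.filter fun x => (separator F bags C).contains x).length - h₀ →
      h ≤ h₀ →
      ∃ T, IsTable F nv n U E T ∧
        Evals (F, (nv, (bags, (h₀, n)))) (16 * (2 ^ (3 * m) * (n + 2) ^ 2))
          (2 * U.length + 1 - P.length) (U, (P, (h, E))) T
          (2 ^ h * (C.length * G + 3 * P.length + 4) - 3) := by
  have hle := S.length_le C hC hCn
  have hLm := S.inv.card_le hg
  have hsn := S.le
  have hY := le_tableSize n m
  induction P with
  | nil =>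
    intro U h M E _ _ _ hU hE hM hMc hh
    rw [remove_nil] at hU
    subst hU
    have hcard : (L ∪ M).card ≤ 3 * m := by
      have := Finset.card_union_le L M
      omega
    obtain ⟨T, hT, hev⟩ := hend _ _ E h hE hcard (by omega) fun x hx => by
      have h₁ := S.separates C hC hCn
      rw [separates, List.all_eq_true] at h₁
      have h₁ := h₁ x hx
      rw [Nat.ble_eq] at h₁
      exact ⟨by omega, S.inv.step hC hCn hg hL hM (by simpa using hMc) hx⟩
    refine ⟨T, hT, hev.mono (by simp) ?_⟩
    have h₁ : (remove C (separator F bags C)).length ≤ C.length := List.length_filter_le _ _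
    have h₂ := Nat.mul_le_mul_right G h₁
    have h₃ : 1 * (C.length * G + 4) ≤ 2 ^ h * (C.length * G + 4) :=
      Nat.mul_le_mul_right _ Nat.one_le_two_pow
    simp only [List.length_nil, Nat.mul_zero, Nat.add_zero]
    omega
  | cons y P ih =>
    intro U h M E hP hPU hPC hU hE hM hMc hh
    have hyU : y ∈ U := hPU (by simp)
    rw [← remove_cons] at hU
    have hlt := length_remove_singleton_lt hyU
    have hPl := (hP.subperm hPU).length_le
    rw [List.nodup_cons] at hP
    rw [List.length_cons] at hMc hPl ⊢
    have hPU' : P ⊆ remove U [y] := fun x hx => mem_remove.2 ⟨hPU (by simp [hx]), by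
      rintro hh
      rw [List.mem_singleton] at hh
      exact hP.1 (hh ▸ hx)⟩
    have hcard : (L ∪ M).card ≤ 3 * m := by
      have := Finset.card_union_le L M
      omega
    have hPn : ∀ x ∈ y :: P, x < n := fun x hx => hE.lt x (hPU hx)
    have b₁ := sz_list_le (m := m) hE.nodup hE.lt
    have b₂ := sz_list_le (m := m) (List.nodup_cons.2 hP) hPn
    have b₃ := hE.sz_le hcard
    have b₄ := hPn y (by simp)
    rw [sz_cons] at b₂
    cases h with
    | zero =>
      obtain ⟨T, hT, hev⟩ := ih (remove U [y]) 0 (insert y M) _ hP.2 hPU'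
        (fun x hx => hPC x (by simp [hx])) hU
        (by rw [Finset.union_insert]; exact hE.extend_both hyU)
        (fun x hx => (Finset.mem_insert.1 hx).elim (fun e => e ▸ hPC y (by simp)) (hM x))
        (by have := Finset.card_insert_le y M; omega) hh
      have hE' := hE.extend_both hyU
      have htab : IsTable F nv n U E (sumTable F nv y E T T) :=
        isTable_sumTable S.symm hE.nodup hyU
          (fun τ hτ => hT.lookup_self hE'
            (List.mem_append_left _ (List.mem_map_of_mem hτ)))
          (fun τ hτ => hT.lookup_self hE'
            (List.mem_append_right _ (List.mem_map_of_mem hτ)))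
      have b₅ := htab.sz_le hE hcard
      refine ⟨_, htab, ?_⟩
      have := evals_one (e := (F, (nv, (bags, (h₀, n))))) (t := (U, (y :: P, (0, E)))) (x := [y])
        (E := E) (T := T) (fun K => by
          obtain ⟨u, U', rfl⟩ := List.exists_cons_of_ne_nil (List.ne_nil_of_mem hyU)
          rfl) hev
        (by simp only [sz_pair, sz_cons, sz_nat]; omega)
        (by simp only [sz_pair, sz_cons, sz_nat, sz_nil]; omega)
        (by change sz (sumTable F nv y E T T) + 3 ≤ _; omega)
      refine this.mono (by omega) ?_
      simp only [pow_zero, one_mul]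
      omega
    | succ h =>
      have hb : ∀ b, ∃ T, IsTable F nv n (remove U [y]) (extend (y, b) E) T ∧
        Evals (F, (nv, (bags, (h₀, n)))) (16 * (2 ^ (3 * m) * (n + 2) ^ 2))
          (2 * (remove U [y]).length + 1 - P.length) (remove U [y], (P, (h, extend (y, b) E))) T
          (2 ^ h * (C.length * G + 3 * P.length + 4) - 3) := fun b =>
        ih (remove U [y]) h M _ hP.2 hPU'
          (fun x hx => hPC x (by simp [hx])) hU (hE.extend_one hyU b) hM (by omega) (by omega)
      obtain ⟨T₀, hT₀, hev₀⟩ := hb false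
      obtain ⟨T₁, hT₁, hev₁⟩ := hb true
      have htab : IsTable F nv n U E (sumTable F nv y E T₀ T₁) :=
        isTable_sumTable S.symm hE.nodup hyU
          (fun τ hτ => hT₀.lookup_self (hE.extend_one hyU false) (List.mem_map_of_mem hτ))
          (fun τ hτ => hT₁.lookup_self (hE.extend_one hyU true) (List.mem_map_of_mem hτ))
      have b₅ := htab.sz_le hE hcard
      have b₆ := hT₀.sz_le (hE.extend_one hyU false) hcard
      have b₇ := (hE.extend_one hyU true).sz_le hcard
      have b₈ := sz_list_le (m := m) (hE.extend_one hyU true).nodup (hE.extend_one hyU true).lt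
      refine ⟨_, htab, ?_⟩
      have := evals_two (e := (F, (nv, (bags, (h₀, n))))) (t := (U, (y :: P, (h + 1, E))))
        (x := [y]) (E := E) (fun K => by
          obtain ⟨u, U', rfl⟩ := List.exists_cons_of_ne_nil (List.ne_nil_of_mem hyU)
          rfl) hev₀ hev₁
        (by simp only [sz_pair, sz_cons, sz_nat]; omega)
        (by simp only [sz_pair, sz_cons, sz_nat, sz_nil]; omega)
        (by simp only [sz_pair, sz_cons, sz_nat, sz_nil]; omega)
        (by change sz (sumTable F nv y E T₀ T₁) + 3 ≤ _; omega)
      refine this.mono (by omega) ?_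
      have h₁ : 1 * (C.length * G + 3 * P.length + 4) ≤
        2 ^ h * (C.length * G + 3 * P.length + 4) := Nat.mul_le_mul_right _ Nat.one_le_two_pow
      have h₂ : 2 ^ (h + 1) * (C.length * G + 3 * (P.length + 1) + 4) =
        2 * (2 ^ h * (C.length * G + 3 * P.length + 4)) + 6 * 2 ^ h := by ring
      have h₃ : 1 ≤ 2 ^ h := Nat.one_le_two_pow
      omega

/-- One more level of the recursion: the permitted component size doubles, and the cost per vertex
is multiplied by the number `2 ^ h₀` of branches and a constant. Within a level, components are
split off one at a time, by induction on `U.length`. -/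
theorem EvalsComponents.double (S : Setting F bags n m h₀ Good) {s G : ℕ} (hG : 0 < G)
    (hend : EvalsComponents F bags nv n m h₀ Good s G) :
    EvalsComponents F bags nv n m h₀ Good (2 * s) (8 * 2 ^ h₀ * G) := by
  intro U
  induction hk : U.length using Nat.strong_induction_on generalizing U with
  | _ k ih =>
    subst hk
    intro L E h hE hL hh hgood
    have hY := le_tableSize n m
    have b₁ := sz_list_le (m := m) hE.nodup hE.lt
    have b₂ := hE.sz_le hL
    have hsn := S.le
    by_cases hU₀ : U = []
    · subst hU₀
      have htab := isTable_one (F := F) (nv := nv) (n := n) E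
      have b₃ := htab.sz_le hE hL
      refine ⟨_, htab, (evals_zero (fun K => rfl) ?_ ?_).mono (by omega) (by omega)⟩
      · simp only [sz_pair, sz_nat, sz_nil]; omega
      · omega
    · obtain ⟨x, U', hU⟩ := List.exists_cons_of_ne_nil hU₀
      have hx : x ∈ U := by simp [hU]
      obtain ⟨C, hC⟩ : ∃ C, C = component F U x := ⟨_, rfl⟩
      have hCU : C.Sublist U := hC ▸ component_sublist
      have hCb := hE.component (F := F) hCU
      have hCg := hgood x hx
      rw [← hC] at hCg
      have hcard : (L.filter fun y => ∃ z ∈ C, adjB F y z = true).card ≤ 3 * m :=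
        (Finset.card_le_card (Finset.filter_subset _ _)).trans hL
      -- With at least one pending vertex, the first call needs only `2 * C.length` frames' worth of
      -- space, which leaves room for the frame of the product.
      obtain ⟨y, hyC, hyB⟩ := exists_mem_separator (F := F) (B := separator F bags C) hE.nodup hx
        (by rw [← hC]; exact S.separates C hCb.nodup hCb.lt)
      rw [← hC] at hyC
      have hxC : x ∈ C := hC ▸ mem_component_self hx
      set P := C.filter fun y => (separator F bags C).contains y with hP
      have hPpos : 0 < P.length := List.length_pos_of_mem (a := y)
        (List.mem_filter.2 ⟨hyC, by simpa using hyB⟩)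
      have hPC : P.length ≤ C.length := List.length_filter_le _ _
      obtain ⟨T₁, hT₁, hev₁⟩ := evals_pending S hend hCb.nodup hCb.lt hCg.1 hCg.2
        (fun z hz => hCb.not_mem hz) P C h₀ ∅ _ (hCb.nodup.filter _) (List.filter_subset_self _)
        (fun z hz => ⟨(List.mem_filter.1 hz).1, by simpa using (List.mem_filter.1 hz).2⟩)
        (List.filter_congr fun z hz => by simp [hP, hz]) (by rw [Finset.union_empty]; exact hCb)
        (by simp) (by simp [hP]) le_rfl
      have hlen : C.length + (remove U C).length ≤ U.length := by
        rw [← List.length_append]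
        refine List.Subperm.length_le (List.Nodup.subperm (List.nodup_append.2
          ⟨hCb.nodup, nodup_remove hE.nodup _, ?_⟩) (List.append_subset.2 ⟨hCU.subset, fun z hz =>
            (mem_remove.1 hz).1⟩))
        rintro a ha _ hb rfl
        exact (mem_remove.1 hb).2 ha
      obtain ⟨T₂, hT₂, hev₂⟩ := ih _ (by omega) (remove U C) rfl L E 0 (hE.remove C) hL
        (by omega) fun z hz => by
          have hz' := (mem_remove.1 hz).1
          have hsub : component F (remove U C) z ⊆ component F U z :=
            component_mono (fun a ha => (mem_remove.1 ha).1) hz'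
          have hnd : (component F (remove U C) z).Nodup :=
            (nodup_remove hE.nodup C).sublist component_sublist
          refine ⟨((hnd.subperm hsub).length_le).trans_lt (hgood z hz').1,
            S.inv.mono hsub ?_ (hgood z hz').2⟩
          intro a ha
          obtain ⟨ha, b, hb, hab⟩ := Finset.mem_filter.1 ha
          exact Finset.mem_filter.2 ⟨ha, b, hsub hb, hab⟩
      have htab : IsTable F nv n U E (prodTable E T₁ T₂) :=
        isTable_prodTable S.symm hE hx (hC ▸ hT₁) (hC ▸ hT₂)
      have b₃ := htab.sz_le hE hL
      have b₄ := hT₁.sz_le hCb hcard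
      have b₅ := sz_list_le (m := m) (hE.remove C).nodup (hE.remove C).lt
      -- The constant is 8 = 1 + 3 + 4, since `P` is no longer than `C`, and both `C.length` and `G`
      -- are positive.
      have hG₁ : 2 ^ h₀ * (C.length * G + 3 * P.length + 4) ≤ C.length * (8 * 2 ^ h₀ * G) := by
        have : C.length * G + 3 * P.length + 4 ≤ C.length * (8 * G) := by nlinarith
        calc _ ≤ 2 ^ h₀ * (C.length * (8 * G)) := Nat.mul_le_mul_left _ this
          _ = _ := by ring
      have hG₂ : 4 ≤ 2 ^ h₀ * (C.length * G + 3 * P.length + 4) :=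
        (show 4 ≤ 1 * (C.length * G + 3 * P.length + 4) by omega).trans
          (Nat.mul_le_mul_right _ Nat.one_le_two_pow)
      have hG₃ := Nat.mul_le_mul_right (8 * 2 ^ h₀ * G) hlen
      rw [add_mul] at hG₃
      refine ⟨_, htab, ?_⟩
      have hCpos : 0 < C.length := List.length_pos_of_mem hxC
      refine (evals_two (d := 2 * U.length) (e := (F, (nv, (bags, (h₀, n)))))
        (t := (U, ([], (h, E)))) (x := []) (E := E)
        (T₁ := T₁) (T₂ := T₂) (fun K => by
          subst hU hC
          rfl) (hev₁.mono ?_ le_rfl) (hev₂.mono ?_ le_rfl) ?_ ?_ ?_ ?_).mono (by omega) ?_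
      · have := hCU.length_le
        omega
      · omega
      · simp only [sz_pair, sz_nat, sz_nil]; omega
      · simp only [sz_pair, sz_cons, sz_nat, sz_nil]; omega
      · simp only [sz_pair, sz_cons, sz_nil]; omega
      · change sz (prodTable E T₁ T₂) + 3 ≤ _; omega
      · omega

/-- A component is never empty, so for `k = 0` there is nothing to do; `k` doublings follow. -/
theorem evalsComponents (S : Setting F bags n m h₀ Good) (k : ℕ) :
    EvalsComponents F bags nv n m h₀ Good (2 ^ k) ((8 * 2 ^ h₀) ^ k) := by
  induction k with
  | zero =>
    intro U L E h hE hL hh hgood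
    have hY := le_tableSize n m
    have b₂ := hE.sz_le hL
    have hsn := S.le
    rcases U with _ | ⟨x, U'⟩
    · have htab := isTable_one (F := F) (nv := nv) (n := n) E
      have b₃ := htab.sz_le hE hL
      refine ⟨_, htab, (evals_zero (fun K => rfl) ?_ ?_).mono (by omega) (by omega)⟩
      · simp only [sz_pair, sz_nat, sz_nil]; omega
      · omega
    · have := List.length_pos_of_mem (mem_component_self (F := F) (U := x :: U') (x := x) (by simp))
      have := (hgood x (by simp)).1
      simp only [pow_zero] at this
      omega
  | succ k ih =>
    have := ih.double S (by positivity)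
    rwa [← pow_succ', ← pow_succ'] at this

end analysis

end TreeWidthSat
-- From the given decomposition to a run of the recursion
namespace TreeWidthSat
open Enc

/-! ### The recursion on an input -/

section bags

variable {φ : CNF} {N : ℕ}

/-- The number of a node of the incidence graph. -/
def CNF.index (φ : CNF) : φ.Node → ℕ := Sum.elim (fun v => v) fun j => φ.numVars + j

theorem CNF.index_injective (φ : CNF) : Function.Injective φ.index := by
  rintro (v | j) (v' | j') h <;> simp only [index, Sum.elim_inl, Sum.elim_inr] at h
  · rw [Fin.ext h]
  · omega
  · omega
  · rw [Fin.ext (Nat.add_left_cancel h)]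

theorem CNF.exists_index (φ : CNF) {x : ℕ} (hx : x < φ.size) : ∃ a, φ.index a = x := by
  by_cases h : x < φ.numVars
  · exact ⟨Sum.inl ⟨x, h⟩, rfl⟩
  · rw [size] at hx
    exact ⟨Sum.inr ⟨x - φ.numVars, by omega⟩, by simp only [index, Sum.elim_inr]; omega⟩

variable (D : TreeDecomposition φ.incidenceGraph (Fin N))

open Classical in
/-- A bag as a list of numbers. -/
noncomputable def bagList (t : Fin N) : List ℕ :=
  positions 0 (List.ofFn fun v => decide (Sum.inl v ∈ D.bag t)) ++
    positions φ.numVars (List.ofFn fun j => decide (Sum.inr j ∈ D.bag t))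

theorem mem_bagList {t : Fin N} {x : ℕ} : x ∈ bagList D t ↔ ∃ a ∈ D.bag t, φ.index a = x := by
  simp [bagList, mem_positions, CNF.index, and_comm, eq_comm]

theorem nodup_bagList (t : Fin N) : (bagList D t).Nodup := by
  refine List.nodup_append.2 ⟨nodup_positions _ _, nodup_positions _ _, ?_⟩
  intro a ha b hb
  obtain ⟨v, rfl, -⟩ := mem_positions.1 ha
  obtain ⟨j, rfl, -⟩ := mem_positions.1 hb
  omega

theorem length_bagList_le (t : Fin N) : (bagList D t).length ≤ (D.bag t).card := by
  rw [← List.toFinset_card_of_nodup (nodup_bagList D t), ← Finset.card_image_of_injective _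
    φ.index_injective]
  refine Finset.card_le_card fun x hx => ?_
  rw [List.mem_toFinset, mem_bagList] at hx
  exact Finset.mem_image.2 hx

theorem card_bag_le (t : Fin N) : (D.bag t).card ≤ φ.size := by
  refine (Finset.card_le_univ _).trans ?_
  simp [CNF.size, add_comm]

theorem card_bag_le_width (t : Fin N) : (D.bag t).card ≤ D.width + 1 := by
  have := Finset.le_sup (f := fun t => (D.bag t).card) (Finset.mem_univ t)
  rw [TreeDecomposition.width]
  omega

theorem width_le_size : D.width ≤ φ.size :=
  (Nat.sub_le _ _).trans (Finset.sup_le fun t _ => card_bag_le D t)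

theorem inputBags_toInput (hN : 0 < N) :
    inputBags (toInput φ D) = List.ofFn (bagList D) := by
  rw [inputBags, inputVars_toInput D hN]
  simp only [toInput, List.map_ofFn]
  rfl

theorem isTreeBags_bagList (hN : 0 < N) :
    IsTreeBags (inputForbidden (toInput φ D)) φ.size D.tree (bagList D) where
  exists_mem := by
    intro x hx
    obtain ⟨a, rfl⟩ := φ.exists_index hx
    obtain ⟨t, ht⟩ := D.exists_mem_bag a
    exact ⟨t, (mem_bagList D).2 ⟨a, ht, rfl⟩⟩
  exists_adj := by
    have key : ∀ (l : Lit) (j : ℕ), OccursIn φ l j →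
        ∃ t, l.1 ∈ bagList D t ∧ j ∈ bagList D t := by
      rintro l j ⟨v, i, hv, hj, hl⟩
      obtain ⟨t, h₁, h₂⟩ := D.exists_adj_bag (Sum.inl v) (Sum.inr i) (by
        rw [CNF.incidenceGraph, SimpleGraph.fromRel_adj]
        exact ⟨by simp, Or.inl ⟨v, i, rfl, rfl, l.2, hl⟩⟩)
      exact ⟨t, (mem_bagList D).2 ⟨_, h₁, hv.symm⟩, (mem_bagList D).2 ⟨_, h₂, hj.symm⟩⟩
    intro x y h
    obtain ⟨b, c, h⟩ := adjB_iff.1 h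
    rcases (forbidsOcc_toInput D hN _ _).1 h with ⟨-, -, -, h⟩ | ⟨-, -, -, h⟩
    · exact key _ _ h
    · obtain ⟨t, h₁, h₂⟩ := key _ _ h
      exact ⟨t, h₂, h₁⟩
  chain := by
    intro x s u hs hu
    obtain ⟨a, has, rfl⟩ := (mem_bagList D).1 hs
    obtain ⟨b, hbu, hb⟩ := (mem_bagList D).1 hu
    obtain rfl := φ.index_injective hb
    obtain ⟨p⟩ := (D.subtree b).preconnected ⟨s, has⟩ ⟨u, hbu⟩
    have : ∀ (s u : {t | b ∈ D.bag t}) (_ : (D.tree.induce {t | b ∈ D.bag t}).Walk s u),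
        Relation.ReflTransGen (fun a c => D.tree.Adj a c ∧ φ.index b ∈ bagList D a ∧
          φ.index b ∈ bagList D c) s.1 u.1 := by
      intro s u p
      induction p with
      | nil => exact .refl
      | @cons s t u hst _ ih =>
        exact .head ⟨hst, (mem_bagList D).2 ⟨b, s.2, rfl⟩, (mem_bagList D).2 ⟨b, t.2, rfl⟩⟩ ih
    exact this _ _ p

theorem foldl_max_spec (l : List (List ℕ)) :
    (∀ B ∈ l, B.length ≤
      l.foldl (fun m B => if Nat.ble m B.length = true then B.length else m) 0) ∧
    ∀ k, (∀ B ∈ l, B.length ≤ k) →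
      l.foldl (fun m B => if Nat.ble m B.length = true then B.length else m) 0 ≤ k := by
  induction l using List.reverseRecOn with
  | nil => simp
  | append_singleton l b ih =>
    simp only [List.foldl_append, List.foldl_cons, List.foldl_nil]
    generalize l.foldl (fun m B => if Nat.ble m B.length = true then B.length else m) 0 = r at ih ⊢
    simp only [Nat.ble_eq]
    refine ⟨fun B hB => ?_, fun k hk => ?_⟩
    · rcases List.mem_append.1 hB with hB | hB
      · have := ih.1 B hB
        split_ifs <;> omega
      · rw [List.mem_singleton.1 hB]
        split_ifs <;> omega
    · have h₁ := ih.2 k fun B hB => hk B (by simp [hB])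
      have h₂ := hk b (by simp)
      split_ifs <;> omega

/-- Here `m` is the integer part of `w / (q + 1)`: the countdown starts at `q`, and one round in `q
+ 1` resets it instead of raising the result. -/
theorem decrease_spec (q w : ℕ) : ∃ m, decrease q w + m = w ∧ (q + 1) * m ≤ w ∧
    w < (q + 1) * (m + 1) := by
  have : ∀ w, let s := (List.replicate w false).foldl (fun (s : ℕ × ℕ) _ =>
      natCase s.1 (q, s.2) fun r => (r, s.2 + 1)) (q, 0)
      s.1 ≤ q ∧ ∃ m, s.2 + m = w ∧ (q + 1) * m + (q - s.1) = w := by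
    intro w
    induction w with
    | zero => simp
    | succ w ih =>
      rw [List.replicate_succ', List.foldl_append]
      simp only [List.foldl_cons, List.foldl_nil]
      generalize (List.replicate w false).foldl (fun (s : ℕ × ℕ) _ =>
        natCase s.1 (q, s.2) fun r => (r, s.2 + 1)) (q, 0) = s at ih ⊢
      obtain ⟨hs, m, h₁, h₂⟩ := ih
      obtain ⟨_ | r, j⟩ := s
      · simp only [natCase_zero] at *
        refine ⟨le_rfl, m + 1, by omega, ?_⟩
        rw [Nat.mul_succ]
        omega
      · simp only [natCase_succ] at *
        exact ⟨by omega, m, by omega, by omega⟩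
  obtain ⟨h, m, h₁, h₂⟩ := this w
  refine ⟨m, h₁, by omega, ?_⟩
  rw [Nat.mul_succ]
  omega

theorem length_filter_ofFn {m : ℕ} (p : Fin m → Prop) [DecidablePred p] :
    ((List.ofFn fun u => decide (p u)).filter fun b => b).length = {u | p u}.ncard := by
  rw [Set.ncard_eq_toFinset_card', Set.toFinset_ofPred]
  induction m with
  | zero => simp
  | succ m ih =>
    rw [List.ofFn_succ, List.filter_cons, Fin.card_filter_univ_succ]
    by_cases h : p 0
    · simp only [h, decide_true, if_true, List.length_cons]
      rw [ih fun u => p u.succ]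
    · simp only [h, decide_false, Bool.false_eq_true, if_false]
      rw [ih fun u => p u.succ]

theorem inputPath_toInput :
    inputPath (toInput φ D) = true ↔ ∀ t, (D.tree.neighborSet t).ncard ≤ 2 := by
  classical
  simp only [inputPath, toInput, List.all_eq_true, List.forall_mem_ofFn_iff, Nat.ble_eq]
  refine forall_congr' fun t => ?_
  rw [length_filter_ofFn]
  rfl

theorem base_eq_three (hD : D.maxDegree ≤ 3) (h : inputPath (toInput φ D) ≠ true) :
    D.base = 3 := by
  classical
  rw [Ne, inputPath_toInput] at h
  push Not at h
  obtain ⟨t, ht⟩ := h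
  have h₁ := D.tree.degree_le_maxDegree t
  rw [← SimpleGraph.card_neighborSet_eq_degree, ← Set.toFinset_card,
    ← Set.ncard_eq_toFinset_card'] at h₁
  have h₂ : D.maxDegree = D.tree.maxDegree := by
    rw [TreeDecomposition.maxDegree]
  rw [TreeDecomposition.base]
  omega

/-- The recursion on an input, with the width `w` and the number `m` of the vertices of a separator
whose values are treated together. -/
theorem exists_run (q : ℕ) (hN : 0 < N) : ∃ (m h₀ w : ℕ) (T : Table) (R : ℕ),
    h₀ + m = w ∧ w ≤ D.width + 1 ∧ (q + 1) * m ≤ w ∧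
    (inputPath (toInput φ D) = true → w < (q + 1) * (m + 1)) ∧
    R ≤ φ.size * (8 * 2 ^ h₀) ^ φ.size.size + 1 ∧
    Steps (inputEnv q (toInput φ D)) ((2 * φ.size + 1) * (16 * (2 ^ (3 * m) * (φ.size + 2) ^ 2)))
      ([(List.range φ.size, ([], (0, [[]])))], ([], [])) R ([], (T, [])) ∧
    IsTable (inputForbidden (toInput φ D)) φ.numVars φ.size (List.range φ.size) [[]] T := by
  set F := inputForbidden (toInput φ D) with hF
  set w := inputWidth (toInput φ D) with hw
  have hsum : inputVars (toInput φ D) + inputClauses (toInput φ D) = φ.size := by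
    rw [inputVars_toInput D hN, inputClauses_toInput D hN, CNF.size, add_comm]
  have hB := isTreeBags_bagList D hN
  have hwB : ∀ t, (bagList D t).length ≤ w := fun t => by
    rw [hw, inputWidth, inputBags_toInput D hN]
    exact (foldl_max_spec _).1 _ (List.mem_ofFn.2 ⟨t, rfl⟩)
  have hw_le : ∀ k, (∀ t, (bagList D t).length ≤ k) → w ≤ k := fun k hk => by
    rw [hw, inputWidth, inputBags_toInput D hN]
    refine (foldl_max_spec _).2 k fun B hB => ?_
    obtain ⟨t, rfl⟩ := List.mem_ofFn.1 hB
    exact hk t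
  have hwn : w ≤ φ.size :=
    hw_le _ fun t => (length_bagList_le D t).trans (card_bag_le D t)
  have hww : w ≤ D.width + 1 :=
    hw_le _ fun t => (length_bagList_le D t).trans (card_bag_le_width D t)
  obtain ⟨m, h₀, Good, hsm, hqm, hpath, hh₀, hinv⟩ : ∃ (m h₀ : ℕ)
      (Good : List ℕ → Finset ℕ → Prop), h₀ + m = w ∧ (q + 1) * m ≤ w ∧
      (inputPath (toInput φ D) = true → w < (q + 1) * (m + 1)) ∧
      (if inputPath (toInput φ D) = true then decrease q w else w) = h₀ ∧
      IsInvariant F (List.ofFn (bagList D)) φ.size m h₀ Good := by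
    -- Tables are used only on paths; for other trees `m = 0`.
    by_cases hp : inputPath (toInput φ D) = true
    · obtain ⟨m, h₁, h₂, h₃⟩ := decrease_spec q w
      obtain ⟨f, hf, hadj⟩ := exists_numbering D.isTree ((inputPath_toInput D).1 hp)
      refine ⟨m, decrease q w, PathGood (bagList D) m f, h₁, h₂, fun _ => h₃, if_pos hp, ?_⟩
      have := isInvariant_pathGood (m := m) (by omega) hB D.isTree hwB hf hadj
      rwa [show w - m = decrease q w by omega] at this
    · exact ⟨0, w, _, rfl, by simp, fun h => absurd h hp, if_neg hp,
        isInvariant_empty F φ.size hB D.isTree hwB⟩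
  have henv : inputEnv q (toInput φ D) =
      (F, (φ.numVars, (List.ofFn (bagList D), (h₀, φ.size)))) := by
    rw [inputEnv, ← hw, hh₀, hsum, inputVars_toInput D hN, inputBags_toInput D hN]
  have S : Setting F (List.ofFn (bagList D)) φ.size m h₀ Good :=
    { symm := (forbidsOcc_toInput D hN).symm
      inv := hinv
      separates := fun C hC hCn => by
        obtain ⟨t, ht, h⟩ := hB.separator_spec D.isTree hC hCn
        rwa [ht]
      length_le := fun C hC hCn => by
        obtain ⟨t, ht, -⟩ := hB.separator_spec D.isTree hC hCn
        rw [hsm, ht]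
        refine le_trans ((hC.filter _).subperm fun x hx => ?_).length_le (hwB t)
        simpa using (List.mem_filter.1 hx).2
      le := by omega }
  have hE : IsBatch φ.size (List.range φ.size) ∅ [[]] :=
    { nodup := List.nodup_range
      lt := by simp
      nodup_pats := by simp
      exists_dom := ⟨[], by simp⟩
      agree := by simp }
  obtain ⟨T, hT, hev⟩ := evalsComponents (nv := φ.numVars) S φ.size.size _ ∅ _ 0 hE (by simp)
    (Nat.zero_le _) fun x hx => by
      refine ⟨?_, ?_⟩
      -- The number of levels is the bit length of `φ.size`, so `2 ^ φ.size.size` exceeds the size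
      -- of any component.
      · refine lt_of_le_of_lt ?_ (Nat.lt_size_self φ.size)
        simpa using (component_sublist (F := F) (U := List.range φ.size) (x := x)).length_le
      · rw [Finset.filter_empty]
        exact hinv.empty _ fun y hy => List.mem_range.1 (component_sublist.subset hy)
  obtain ⟨R, hR, hst⟩ := hev []
  rw [List.length_range] at hR hst
  rw [henv]
  exact ⟨m, h₀, w, T, R, hsm, hww, hqm, hpath, hR, by simpa using hst, hT⟩

end bags

end TreeWidthSat
-- Assembly of the algorithm: preparation, loop, answer
namespace TreeWidthSat
open Enc

/-! ### The algorithm -/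

/-- The command `c'` after the command `c`, with the value of `i` as its input. -/
def Cmd.pipe {V V' : Type} (c : Cmd V) (i : V) (c' : Cmd V') (j : V') : Cmd (V ⊕ V') :=
  (c.map Sum.inl).seq (((Cmd.assign (Sum.inr j) (Rhs.var (Sum.inl i))).seq
    (Cmd.assign (Sum.inl i) Rhs.nil)).seq (c'.map Sum.inr))

theorem Exec.pipe {V V' : Type} [Fintype V] [DecidableEq V] [Fintype V'] [DecidableEq V']
    {c : Cmd V} {i₀ i : V} {c' : Cmd V'} {j : V'} {x y z : Data} {t s t' s' : ℕ}
    (h : Exec c (Store.single i₀ x) (Store.single i y) t s)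
    (h' : Exec c' (Store.single j y) (Store.single j z) t' s') :
    ∃ T S, Exec (c.pipe i c' j) (Store.single (Sum.inl i₀) x) (Store.single (Sum.inr j) z) T S ∧
      T ≤ t + t' + y.size + 2 ∧ S ≤ s + s' + 2 * y.size + 2 := by
  obtain ⟨t₁, s₁, h₁, ht₁⟩ : RunsIn ((Cmd.assign (Sum.inr j) (Rhs.var (Sum.inl i))).seq
      (Cmd.assign (Sum.inl i) Rhs.nil)) (Sum.elim (Store.single i y) (Store.single j Data.nil))
      (Sum.elim (Store.single i Data.nil) (Store.single j y)) (1 + y.size + 1) := by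
    refine RunsIn.seq (RunsIn.assign
      (σ' := Sum.elim (Store.single i y) (Store.single j y)) ?_ ?_) (RunsIn.assign ?_ ?_) <;>
    simp [Rhs.eval, Rhs.cost, Sum.update_elim_inl, Sum.update_elim_inr]
  have hs₁ := h₁.space_le.1
  have h₂ := h.map_inl (Store.single j Data.nil)
  have h₃ := h'.map_inr (Store.single i Data.nil)
  have hz : Store.single (V := V ⊕ V') (Sum.inr j) z =
      Sum.elim (Store.single i Data.nil) (Store.single j z) := by
    have : Store.single i Data.nil = fun _ : V => Data.nil := by simp [Store.single]
    rw [this]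
    unfold Store.single
    rw [← Sum.update_elim_inr]
    congr 1
    funext z
    cases z <;> rfl
  rw [Store.single_inl i₀ j, hz]
  rw [Store.size_elim, Store.size_single, Store.size_single] at hs₁
  rw [Store.size_single] at h₂ h₃
  refine ⟨_, _, h₂.seq (h₁.seq h₃), by omega, ?_⟩
  simp only [Data.size, Nat.add_zero, Nat.zero_add] at *
  refine max_le (by omega) (max_le (by omega) (by omega))

/-- The initial flag `b` is arbitrary, so the flag is `running` only after at least one step. -/
theorem iterate_envStep (b : Bool) (e : Env) (s : State) (j : ℕ) :
    envStep^[j + 1] (b, (e, s)) = (running ((step e)^[j + 1] s), (e, (step e)^[j + 1] s)) := by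
  induction j generalizing b s with
  | zero => rfl
  | succ j ih => exact ih _ _

/-- The count is at most `2 ^ nv < 2 ^ (n + 1)`, so `n + 1` binary digits decide whether it is zero.
-/
theorem answer_iff {F : List (Lit × Lit)} {nv n : ℕ} {U : List ℕ} {T : Table} {b : Bool} {e : Env}
    (hT : IsTable F nv n U [[]] T) (h₀ : 0 ≤ partitionSum F nv U [])
    (h₁ : partitionSum F nv U [] ≤ 2 ^ nv) (hn : nv ≤ n) :
    enc (answer (b, (e, ([], (T, []))))) ≠ Data.nil ↔ partitionSum F nv U [] ≠ 0 := by
  obtain ⟨f, rfl, hf⟩ := hT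
  have hf := hf [] (by simp)
  have hlt : partitionSum F nv U [] < (2 ^ (n + 1) : ℕ) := by
    refine h₁.trans_lt ?_
    exact_mod_cast Nat.pow_lt_pow_right (by norm_num) (by omega)
  rw [← hf.any_iff h₀ hlt]
  have : answer (b, (e, (([] : List Task), ([[]].map (fun τ => (τ, f τ)), [])))) =
      (f []).any fun b => b := by simp [answer]
  rw [this]
  cases (f []).any fun b => b <;> simp [enc]

theorem add_le_pow_mul {M a : ℕ} (hM : 8 ≤ M) (ha : a ≤ M) (k m : ℕ) :
    M ^ k + 6 + a * 2 ^ m ≤ M ^ (k + 2) * 2 ^ m := by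
  have h₁ : 1 ≤ M ^ k := Nat.one_le_pow _ _ (by omega)
  have h₂ : 1 ≤ 2 ^ m := Nat.one_le_two_pow
  have a₀ : a * 2 ^ m ≤ M * 2 ^ m := Nat.mul_le_mul_right _ ha
  rw [pow_add]
  generalize M ^ k = u at *
  generalize 2 ^ m = v at *
  have a₁ : u * 1 ≤ u * v := Nat.mul_le_mul_left _ h₂
  have a₂ : 1 * 1 ≤ u * v := Nat.mul_le_mul h₁ h₂
  have a₃ : 1 * (v * M) ≤ u * (v * M) := Nat.mul_le_mul_right _ h₁
  calc u + 6 + a * v ≤ u * v * (M + 7) := by linarith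
    _ ≤ u * v * (M * M) := Nat.mul_le_mul_left _ (by nlinarith)
    _ = u * M ^ 2 * v := by ring

theorem add_pow_le_mul_pow {M B : ℕ} (hM : 0 < M) (hB : 8 ≤ B) (k k' l : ℕ) :
    20 * B + B ^ k + B ^ k' + M ^ l ≤ M ^ l * B ^ (k + k' + 3) := by
  have a₁ : 1 ≤ M ^ l := Nat.one_le_pow _ _ hM
  have a₂ : 1 ≤ B ^ k := Nat.one_le_pow _ _ (by omega)
  have a₃ : 1 ≤ B ^ k' := Nat.one_le_pow _ _ (by omega)
  rw [pow_add, pow_add]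
  generalize M ^ l = u at *
  generalize B ^ k = v at *
  generalize B ^ k' = x at *
  have b₁ : 1 * (1 * 1) ≤ u * (v * x) := Nat.mul_le_mul a₁ (Nat.mul_le_mul a₂ a₃)
  have b₂ : u * (1 * 1) ≤ u * (v * x) := Nat.mul_le_mul le_rfl (Nat.mul_le_mul a₂ a₃)
  have b₃ : 1 * (v * 1) ≤ u * (v * x) := Nat.mul_le_mul a₁ (Nat.mul_le_mul le_rfl a₃)
  have b₄ : 1 * (1 * x) ≤ u * (v * x) := Nat.mul_le_mul a₁ (Nat.mul_le_mul a₂ le_rfl)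
  have b₅ : 20 * B * 1 ≤ 20 * B * (u * (v * x)) := Nat.mul_le_mul_left _ (by omega)
  calc 20 * B + v + x + u ≤ (u * (v * x)) * (20 * B + 3) := by linarith
    _ ≤ (u * (v * x)) * (B * B * B) := Nat.mul_le_mul_left _ (by nlinarith)
    _ = u * (v * x * B ^ 3) := by ring

/-- The algorithm, with bounds for its time and space. -/
theorem exists_algorithm : ∃ κ : ℕ, ∀ q : ℕ, ∃ (A : Algorithm) (k : ℕ), ∀ (φ : CNF) (N : ℕ)
    (D : TreeDecomposition φ.incidenceGraph (Fin N)), 0 < N →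
    ∃ (m h₀ w R : ℕ) (y : Data) (t s : ℕ),
      h₀ + m = w ∧ w ≤ D.width + 1 ∧ (q + 1) * m ≤ w ∧
      (inputPath (toInput φ D) = true → w < (q + 1) * (m + 1)) ∧
      R ≤ φ.size * (8 * 2 ^ h₀) ^ φ.size.size + 1 ∧
      A.Runs (encodeInput φ D) y t s ∧ (y ≠ Data.nil ↔ φ.Satisfiable) ∧
      s ≤ (sz (toInput φ D) + 40 * (φ.size + 2) ^ 3) ^ k * 2 ^ (3 * m * κ) ∧
      t ≤ (R + 1) * ((sz (toInput φ D) + 40 * (φ.size + 2) ^ 3) ^ k * 2 ^ (3 * m * κ)) := by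
  obtain ⟨V₂, _, _, i₂, c₂, b₂, ⟨k₂, hb₂⟩, hc₂⟩ := PolyFun.envStep
  obtain ⟨V₃, _, _, i₃, c₃, b₃, ⟨k₃, hb₃⟩, hc₃⟩ := PolyFun.answer
  -- Only the exponents of the step and of the answer are applied to sizes that are exponential in
  -- `m`. The preparation, which depends on `q`, acts on the input and affects only `k`.
  refine ⟨k₂ + k₃ + 3, fun q => ?_⟩
  obtain ⟨k₀, hk₀⟩ := (PolyFun.inputState q).size
  obtain ⟨V₁, _, _, i₁, c₁, b₁, ⟨k₁, hb₁⟩, hc₁⟩ := PolyFun.inputState q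
  let A : Algorithm :=
    { Var := (V₁ ⊕ (V₂ ⊕ Unit)) ⊕ V₃
      input := Sum.inl (Sum.inl i₁)
      output := Sum.inr i₃
      body := (c₁.pipe i₁ (c₂.repeat i₂) (Sum.inl i₂)).pipe (Sum.inr (Sum.inl i₂)) c₃ i₃ }
  refine ⟨A, k₁ + (k₀ + 2) * (k₂ + k₃ + 3), fun φ N D hN => ?_⟩
  obtain ⟨m, h₀, w, T, R, h₁, h₂, h₃, h₄, hR, hst, hT⟩ := exists_run D q hN
  set I := toInput φ D with hI
  set n := φ.size with hn
  set M := sz I + 40 * (n + 2) ^ 3 with hM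
  have hM₀ : 40 * 8 ≤ M := by
    have : 2 ^ 3 ≤ (n + 2) ^ 3 := Nat.pow_le_pow_left (by omega) 3
    omega
  have hIM : sz I + 2 ≤ M := by
    have : 2 ^ 3 ≤ (n + 2) ^ 3 := Nat.pow_le_pow_left (by omega) 3
    omega
  have hinit : inputState q I = (true, (inputEnv q I, ([(List.range n, ([], (0, [[]])))],
      ([], [])))) := by
    rw [inputState, hI, inputVars_toInput D hN, inputClauses_toInput D hN, add_comm]
    rfl
  set e := inputEnv q I with he
  set s₀ : State := ([(List.range n, ([], (0, [[]])))], ([], [])) with hs₀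
  obtain ⟨hend, hsize, hrun⟩ := hst.spec
  have hsz₀ : sz (inputState q I) ≤ M ^ k₀ := (hk₀ I).trans (Nat.pow_le_pow_left hIM _)
  have hsze : sz e ≤ M ^ k₀ := by
    refine le_trans ?_ hsz₀
    rw [hinit]
    have h₁ := sz_pair true (e, s₀)
    have h₂ := sz_pair e s₀
    omega
  obtain ⟨R', rfl⟩ : ∃ R', R = R' + 1 := by
    cases R with
    | zero => exact absurd (congrArg Prod.fst hend) (by simp [hs₀])
    | succ R => exact ⟨R, rfl⟩
  -- A common bound for the environment together with any state of the run.
  set B := M ^ (k₀ + 2) * 2 ^ (3 * m) with hB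
  have hMB : M * M ≤ B := by
    have h₁ : 1 ≤ M ^ k₀ := Nat.one_le_pow _ _ (by omega)
    have h₂ : 1 ≤ 2 ^ (3 * m) := Nat.one_le_two_pow
    calc M * M = 1 * (M * M) * 1 := by ring
      _ ≤ M ^ k₀ * (M * M) * 2 ^ (3 * m) := by gcongr
      _ = B := by rw [hB]; ring
  -- The reserve of 2 turns the bounds `(sz y + 2) ^ k₂` and `(sz y + 2) ^ k₃` into powers of `B`.
  have hS : ∀ j ≤ R' + 1, sz (envStep^[j] (true, (e, s₀))) ≤ B - 2 := by
    have key : ∀ (b : Bool) (s : State), sz s ≤ (2 * n + 1) * (16 * (2 ^ (3 * m) * (n + 2) ^ 2)) →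
        sz ((b, (e, s)) : Bool × (Env × State)) ≤ B - 2 := by
      intro b s hs
      have hb := sz_bool_le b
      rw [sz_pair, sz_pair]
      have h₅ : (2 * n + 1) * (16 * (2 ^ (3 * m) * (n + 2) ^ 2)) =
          (2 * n + 1) * (16 * (n + 2) ^ 2) * 2 ^ (3 * m) := by ring
      have h₆ := add_le_pow_mul (M := M) (a := (2 * n + 1) * (16 * (n + 2) ^ 2)) (by omega)
        (by nlinarith [Nat.zero_le (sz I)]) k₀ (3 * m)
      omega
    intro j hj
    cases j with
    | zero => exact key _ _ (hsize 0 (by omega))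
    | succ j =>
      rw [iterate_envStep]
      exact key _ _ (hsize _ hj)
  have hB₂ : 320 ≤ B := by nlinarith
  obtain ⟨t₁, s₁, hx₁, ht₁⟩ := hc₁ I
  have hs₁ := hx₁.space_le.1
  rw [Store.size_single] at hs₁
  change s₁ ≤ sz I + t₁ at hs₁
  rw [hinit] at hx₁
  obtain ⟨t₂, s₂, hx₂, ht₂, hs₂⟩ := PolyFun.runsIn_repeat (c := c₂) (i := i₂) (S := B - 2)
    (T := B ^ k₂)
    (fun y hy => (hc₂ y).mono ((hb₂ y).trans (Nat.pow_le_pow_left (by omega) _))) (R' + 1)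
    (true, (e, s₀)) (fun j hj => by
      cases j with
      | zero => rfl
      | succ j =>
        rw [iterate_envStep]
        exact hrun _ hj) (by
      rw [iterate_envStep, hend]
      rfl) hS
  have hS₃ := hS _ le_rfl
  obtain ⟨t₃, s₃, hx₃, ht₃⟩ := hc₃ (envStep^[R' + 1] (true, (e, s₀)))
  have hs₃ := hx₃.space_le.1
  rw [Store.size_single] at hs₃
  change s₃ ≤ sz _ + t₃ at hs₃
  have ht₃' : t₃ ≤ B ^ k₃ := ht₃.trans ((hb₃ _).trans (Nat.pow_le_pow_left (by omega) _))
  have ht₁' : t₁ ≤ M ^ k₁ := ht₁.trans ((hb₁ _).trans (Nat.pow_le_pow_left hIM _))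
  obtain ⟨t₄, s₄, hx₄, ht₄, hs₄⟩ := hx₁.pipe hx₂
  obtain ⟨t₅, s₅, hx₅, ht₅, hs₅⟩ := hx₄.pipe hx₃
  have hz₀ : (enc (true, (e, s₀))).size ≤ B - 2 := hS 0 (by omega)
  change _ ≤ t₄ + t₃ + sz (envStep^[R' + 1] (true, (e, s₀))) + 2 at ht₅
  change _ ≤ s₄ + s₃ + 2 * sz (envStep^[R' + 1] (true, (e, s₀))) + 2 at hs₅
  rw [iterate_envStep, hend] at hx₅
  obtain ⟨hp₁, hp₂, hp₃⟩ := partitionSum_toInput D hN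
  have hfin : ∀ r, r ≤ 20 * B + B ^ k₂ + B ^ k₃ + M ^ k₁ →
      r ≤ M ^ (k₁ + (k₀ + 2) * (k₂ + k₃ + 3)) * 2 ^ (3 * m * (k₂ + k₃ + 3)) := by
    intro r hr
    refine hr.trans ?_
    refine (add_pow_le_mul_pow (by omega) (by omega) _ _ _).trans (le_of_eq ?_)
    rw [hB, mul_pow, ← pow_mul, ← pow_mul, pow_add M k₁, ← mul_assoc]
  have hIB : sz I ≤ B := by nlinarith
  have hruns : A.Runs (encodeInput φ D)
      (enc (answer (running ([], (T, [])), (e, ([], (T, [])))))) t₅ s₅ := by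
    rw [← enc_toInput]
    exact ⟨_, hx₅, Store.single_self _ _⟩
  refine ⟨m, h₀, w, R' + 1, _, t₅, s₅, h₁, h₂, h₃, h₄, hR, hruns, ?_, hfin _ (by omega), ?_⟩
  · rw [← hp₃]
    exact answer_iff hT hp₁ hp₂ (by rw [hn, CNF.size]; omega)
  · refine le_trans ?_ (Nat.mul_le_mul_left (R' + 1 + 1) (hfin _ le_rfl))
    have : (R' + 1) * (B ^ k₂ + (B - 2) + 2) ≤ (R' + 1) * (20 * B + B ^ k₂ + B ^ k₃ + M ^ k₁) :=
      Nat.mul_le_mul_left _ (by omega)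
    rw [Nat.add_mul (R' + 1) 1, one_mul]
    omega

end TreeWidthSat
-- Real exponents and the choice of the parameters
namespace TreeWidthSat
open Enc

/-! ### The bounds -/

theorem sz_ofFn_le {α : Type} [Enc α] {k B : ℕ} {f : Fin k → α} (h : ∀ i, sz (f i) ≤ B) :
    sz (List.ofFn f) ≤ k * (B + 1) := by
  have := sz_le_of_forall (l := List.ofFn f) (B := B) (by simpa [List.forall_mem_ofFn_iff] using h)
  simpa using this

theorem sz_toInput_le {φ : CNF} {N : ℕ} (D : TreeDecomposition φ.incidenceGraph (Fin N)) :
    sz (toInput φ D) ≤ 10 * (φ.size + N + 1) ^ 2 := by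
  have hb : ∀ (k : ℕ) (p : Fin k → Bool), sz (List.ofFn p) ≤ k * 2 := fun k p =>
    sz_ofFn_le fun i => sz_bool_le _
  have h₁ : sz (toInput φ D).1 ≤ φ.numClauses * (4 * φ.numVars + 2) := by
    refine sz_ofFn_le fun i => ?_
    refine (Nat.succ_le_succ (Nat.add_le_add (hb φ.numVars _) (hb φ.numVars _))).trans ?_
    omega
  have h₂ : sz (toInput φ D).2 ≤ N * (2 * N + 2 * φ.size + 3) := by
    refine sz_ofFn_le fun t => ?_
    refine (Nat.succ_le_succ (Nat.add_le_add (hb N _) (Nat.succ_le_succ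
      (Nat.add_le_add (hb φ.numVars _) (hb φ.numClauses _))))).trans ?_
    rw [CNF.size]
    omega
  rw [sz_prod]
  have h₃ : φ.numClauses * (4 * φ.numVars + 2) ≤ φ.size * (4 * φ.size + 2) := by
    unfold CNF.size
    gcongr <;> omega
  nlinarith

/-- A quantity that is exponential in the width is absorbed by a small change in the exponent of
the running time. -/
theorem absorb {a η w n : ℝ} (ha : 0 ≤ a) (hη : 0 < η) (hw : 0 ≤ w) (hn : 1 ≤ n) (hwn : w ≤ n) :
    a * w ≤ η * w * Real.logb 2 n + a * (2 : ℝ) ^ (a / η) := by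
  have hl : 0 ≤ Real.logb 2 n := Real.logb_nonneg (by norm_num) hn
  have hp : 0 < (2 : ℝ) ^ (a / η) := by positivity
  -- Either the logarithm is large enough to absorb the factor `a`, or `n`, and with it `w`, is at
  -- most the constant `2 ^ (a / η)`.
  rcases le_or_gt (a / η) (Real.logb 2 n) with h | h
  · have h₁ : a ≤ η * Real.logb 2 n := by
      rw [div_le_iff₀ hη] at h
      linarith
    have := mul_le_mul_of_nonneg_right h₁ hw
    have := mul_nonneg ha hp.le
    linarith
  · have h₁ : n ≤ (2 : ℝ) ^ (a / η) := by
      rw [← Real.logb_le_iff_le_rpow (by norm_num) (by linarith)]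
      exact h.le
    have h₂ : a * w ≤ a * (2 : ℝ) ^ (a / η) := mul_le_mul_of_nonneg_left (hwn.trans h₁) ha
    have := mul_nonneg (mul_nonneg hη.le hw) hl
    linarith

theorem natSize_le {n : ℕ} (hn : 0 < n) : (n.size : ℝ) ≤ Real.logb 2 n + 1 := by
  have h₁ : 0 < n.size := Nat.size_pos.2 hn
  have h₂ : 2 ^ (n.size - 1) ≤ n := Nat.lt_size.1 (by omega)
  have h₃ : ((n.size - 1 : ℕ) : ℝ) ≤ Real.logb 2 n := by
    rw [Real.le_logb_iff_rpow_le (by norm_num) (by exact_mod_cast hn), Real.rpow_natCast]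
    exact_mod_cast h₂
  rw [Nat.cast_sub h₁] at h₃
  push_cast at h₃
  linarith

/-- With l = log n, the exponent (3 + θw + 2)(l + 1) + 3κ(w + 1) consists of θwl, of 5l (a
polynomial factor), of a constant, and of at most (1 + 3κ)w, which `absorb` trades for ηwl and a
constant. The case n = 0 is separate because its logarithm is only a convention. -/
theorem steps_le {n w h₀ R m κ : ℕ} {θ η : ℝ} (hη : 0 < η) (hθ : θ ≤ 1) (hwn : w ≤ n)
    (hh : (h₀ : ℝ) ≤ θ * w + 2) (hm : m ≤ w + 1)
    (hR : R ≤ n * (8 * 2 ^ h₀) ^ n.size + 1) :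
    (((R + 1) * 2 ^ (3 * m * κ) : ℕ) : ℝ) ≤ 3 * (2 : ℝ) ^ (5 + 3 * (κ : ℝ) +
      (1 + 3 * (κ : ℝ)) * (2 : ℝ) ^ ((1 + 3 * (κ : ℝ)) / η)) * ((n : ℝ) + 1) ^ 6 *
      (2 : ℝ) ^ ((θ + η) * w * Real.logb 2 n) := by
  set a : ℝ := 1 + 3 * (κ : ℝ) with ha
  have ha₀ : 0 ≤ a := by positivity
  have hm' : (2 : ℝ) ^ (3 * m * κ) ≤ (2 : ℝ) ^ (3 * (κ : ℝ) * (w + 1)) := by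
    rw [← Real.rpow_natCast]
    refine Real.rpow_le_rpow_of_exponent_le (by norm_num) ?_
    have : (m : ℝ) ≤ w + 1 := by exact_mod_cast hm
    have := mul_le_mul_of_nonneg_left this (show (0 : ℝ) ≤ 3 * κ by positivity)
    push_cast
    linarith
  rcases Nat.eq_zero_or_pos n with rfl | hn
  · obtain rfl : w = 0 := by omega
    have hR' : R + 1 ≤ 3 := by omega
    have : (2 : ℝ) ^ (3 * (κ : ℝ) * ((0 : ℕ) + 1)) ≤
        (2 : ℝ) ^ (5 + 3 * (κ : ℝ) + a * (2 : ℝ) ^ (a / η)) := by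
      refine Real.rpow_le_rpow_of_exponent_le (by norm_num) ?_
      have : 0 ≤ a * (2 : ℝ) ^ (a / η) := by positivity
      push_cast
      linarith
    have h₁ : (((R + 1) * 2 ^ (3 * m * κ) : ℕ) : ℝ) ≤ 3 * (2 : ℝ) ^ (3 * m * κ) := by
      exact_mod_cast Nat.mul_le_mul_right _ hR'
    simp only [Nat.cast_zero, mul_zero, zero_mul, Real.rpow_zero, zero_add, one_pow, mul_one]
    simp only [Nat.cast_zero, zero_add, mul_one] at this hm'
    linarith
  · have hn' : (1 : ℝ) ≤ n := by exact_mod_cast hn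
    set l := Real.logb 2 n with hl
    have hl₀ : 0 ≤ l := Real.logb_nonneg (by norm_num) hn'
    have hnl : (2 : ℝ) ^ l = n := Real.rpow_logb (by norm_num) (by norm_num) (by linarith)
    have hs := natSize_le hn
    have hw₀ : (0 : ℝ) ≤ w := Nat.cast_nonneg w
    have habs := absorb ha₀ hη hw₀ hn' (by exact_mod_cast hwn : (w : ℝ) ≤ n)
    rw [← hl] at habs hs
    have h₁ : ((8 * 2 ^ h₀ : ℕ) : ℝ) ^ n.size ≤ (2 : ℝ) ^ ((3 + h₀) * (l + 1)) := by
      have : ((8 * 2 ^ h₀ : ℕ) : ℝ) = (2 : ℝ) ^ ((3 : ℝ) + h₀) := by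
        rw [Real.rpow_add (by norm_num), Real.rpow_natCast]
        norm_num
      rw [this, ← Real.rpow_natCast, ← Real.rpow_mul (by norm_num)]
      exact Real.rpow_le_rpow_of_exponent_le (by norm_num) (mul_le_mul_of_nonneg_left hs
        (by positivity))
    have h₂ : (2 : ℝ) ^ ((3 + h₀) * (l + 1)) * (2 : ℝ) ^ (3 * (κ : ℝ) * (w + 1)) ≤
        (2 : ℝ) ^ (5 * l) * ((2 : ℝ) ^ (5 + 3 * (κ : ℝ) + a * (2 : ℝ) ^ (a / η)) *
          (2 : ℝ) ^ ((θ + η) * w * l)) := by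
      rw [← Real.rpow_add (by norm_num), ← Real.rpow_add (by norm_num),
        ← Real.rpow_add (by norm_num)]
      refine Real.rpow_le_rpow_of_exponent_le (by norm_num) ?_
      have e₁ : (3 + (h₀ : ℝ)) * (l + 1) ≤ (3 + (θ * w + 2)) * (l + 1) :=
        mul_le_mul_of_nonneg_right (by linarith) (by linarith)
      have e₂ : θ * w ≤ 1 * w := mul_le_mul_of_nonneg_right hθ hw₀
      nlinarith
    have h₃ : (2 : ℝ) ^ (5 * l) = (n : ℝ) ^ 5 := by
      rw [mul_comm, Real.rpow_mul (by norm_num), hnl]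
      norm_cast
    rw [h₃] at h₂
    set Y := (2 : ℝ) ^ (5 + 3 * (κ : ℝ) + a * (2 : ℝ) ^ (a / η)) * (2 : ℝ) ^ ((θ + η) * w * l)
      with hY
    have hX : (1 : ℝ) ≤ (2 : ℝ) ^ ((3 + h₀) * (l + 1)) :=
      Real.one_le_rpow (by norm_num) (by positivity)
    have hR' : ((R + 1 : ℕ) : ℝ) ≤ 3 * n * (2 : ℝ) ^ ((3 + h₀) * (l + 1)) := by
      have : ((R + 1 : ℕ) : ℝ) ≤ n * ((8 * 2 ^ h₀ : ℕ) : ℝ) ^ n.size + 2 := by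
        exact_mod_cast (show R + 1 ≤ n * (8 * 2 ^ h₀) ^ n.size + 2 by omega)
      nlinarith
    have h₄ : (n : ℝ) * (n : ℝ) ^ 5 ≤ ((n : ℝ) + 1) ^ 6 := by
      rw [← pow_succ']
      exact pow_le_pow_left₀ (by linarith) (by linarith) 6
    calc (((R + 1) * 2 ^ (3 * m * κ) : ℕ) : ℝ) = ((R + 1 : ℕ) : ℝ) * (2 : ℝ) ^ (3 * m * κ) := by
          push_cast
          ring
      _ ≤ (3 * n * (2 : ℝ) ^ ((3 + h₀) * (l + 1))) * (2 : ℝ) ^ (3 * (κ : ℝ) * (w + 1)) := by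
          gcongr
      _ = 3 * n * ((2 : ℝ) ^ ((3 + h₀) * (l + 1)) * (2 : ℝ) ^ (3 * (κ : ℝ) * (w + 1))) := by ring
      _ ≤ 3 * n * ((n : ℝ) ^ 5 * Y) := by gcongr
      _ = 3 * Y * (n * (n : ℝ) ^ 5) := by ring
      _ ≤ 3 * Y * ((n : ℝ) + 1) ^ 6 := by gcongr
      _ = _ := by rw [hY]; ring

theorem two_rpow_le_three_rpow {δ η x : ℝ} (h : 2 * (1 + η) ≤ 3 * δ) (hδ : 0 ≤ δ)
    (hx : 0 ≤ x) :
    (2 : ℝ) ^ ((1 + η) * x) ≤ (3 : ℝ) ^ (δ * x) := by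
  -- After squaring this is 8 ≤ 9. It leaves enough room below the exponent 1 for trees of degree
  -- three.
  have h₁ : (2 : ℝ) ^ (3 / 2 : ℝ) ≤ 3 := by
    have h₂ : ((2 : ℝ) ^ (3 / 2 : ℝ)) ^ 2 ≤ 3 ^ 2 := by
      rw [← Real.rpow_natCast, ← Real.rpow_mul (by norm_num)]
      norm_num
    exact le_of_sq_le_sq h₂ (by norm_num)
  calc (2 : ℝ) ^ ((1 + η) * x) ≤ (2 : ℝ) ^ (3 / 2 * (δ * x)) :=
        Real.rpow_le_rpow_of_exponent_le (by norm_num) (by nlinarith)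
    _ = ((2 : ℝ) ^ (3 / 2 : ℝ)) ^ (δ * x) := Real.rpow_mul (by norm_num) _ _
    _ ≤ _ := Real.rpow_le_rpow (by positivity) h₁ (by positivity)

end TreeWidthSat

theorem mainTheorem7 (ε' : ℝ) (hε' : 0 < ε') :
    ∃ (A : TreeWidthSat.Algorithm) (δ : ℝ), δ < 1 ∧
      ∀ K : ℕ, ∃ C k : ℕ,
        ∀ (φ : TreeWidthSat.CNF) (N : ℕ)
          (D : TreeWidthSat.TreeDecomposition φ.incidenceGraph (Fin N)),
          TreeWidthSat.IsNice K D →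
          ∃ (y : TreeWidthSat.Data) (t s : ℕ),
            A.Runs (TreeWidthSat.encodeInput φ D) y t s ∧
            (y ≠ TreeWidthSat.Data.nil ↔ φ.Satisfiable) ∧
            (s : ℝ) ≤ C * ((φ.size : ℝ) + 1) ^ k * (2 : ℝ) ^ (ε' * (D.width : ℝ)) ∧
            (t : ℝ) ≤ C * ((φ.size : ℝ) + 1) ^ k *
              (D.base : ℝ) ^ (δ * (D.width : ℝ) * Real.logb 2 (φ.size : ℝ)) := by
  obtain ⟨κ, hκ⟩ := TreeWidthSat.exists_algorithm
  -- The bound `3 * κ / ε'` makes the table factor `2 ^ (3 * m * κ)` at most 2 to the power ε' times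
  -- (width + 1), as `(q + 1) * m` is at most the width plus one. The bound 4 gives η ≤ 1/10, which
  -- the case of degree three needs.
  obtain ⟨q, hq⟩ := exists_nat_ge (max 4 (3 * κ / ε'))
  have hq₄ : (4 : ℝ) ≤ q := (le_max_left _ _).trans hq
  have hqε : 3 * (κ : ℝ) ≤ ε' * q := by
    have := (le_max_right _ _).trans hq
    rw [div_le_iff₀ hε'] at this
    linarith
  obtain ⟨A, k, hA⟩ := hκ q
  have hq₀ : (0 : ℝ) < q + 1 := by linarith
  -- Tabulating a fraction 1/(q + 1) = 2η of each separator saves 2η in the exponent on a path. One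
  -- η is spent on absorbing factors exponential in the width, the other one remains in δ = 1 - η.
  set η : ℝ := 1 / (2 * (q + 1)) with hη
  have hη₀ : 0 < η := by positivity
  have hη₁ : η ≤ 1 / 10 := by
    rw [hη]
    exact one_div_le_one_div_of_le (by norm_num) (by linarith)
  set a : ℝ := 3 * (2 : ℝ) ^ (5 + 3 * (κ : ℝ) +
      (1 + 3 * (κ : ℝ)) * (2 : ℝ) ^ ((1 + 3 * (κ : ℝ)) / η)) with ha
  refine ⟨A, 1 - η, by linarith, fun K => ?_⟩
  obtain ⟨b, hb⟩ := exists_nat_ge (max ((2 : ℝ) ^ ε') a)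
  refine ⟨(10 * (K + 2) ^ 2 + 320) ^ k * b, 4 * k + 6, fun φ N D hD => ?_⟩
  -- A tree has a node; the numbers of variables and clauses are read off from the first one.
  have hN : 0 < N := by
    obtain ⟨t⟩ := D.isTree.connected.nonempty
    exact t.pos
  obtain ⟨m, h₀, w, R, y, t, s, h₁, h₂, h₃, h₄, hR, hrun, hsat, hs, ht⟩ := hA φ N D hN
  have hwn := TreeWidthSat.width_le_size D
  have hM : TreeWidthSat.sz (TreeWidthSat.toInput φ D) + 40 * (φ.size + 2) ^ 3 ≤
      (10 * (K + 2) ^ 2 + 320) * (φ.size + 1) ^ 4 := by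
    have h₅ := TreeWidthSat.sz_toInput_le D
    have h₆ : N ≤ K * (φ.size + 1) * (φ.size + 1) :=
      hD.2.trans (Nat.mul_le_mul_right _ (Nat.mul_le_mul_left _ (by omega)))
    have h₇ : φ.size + N + 1 ≤ (K + 2) * (φ.size + 1) ^ 2 := by nlinarith
    have h₈ := Nat.pow_le_pow_left h₇ 2
    have h₉ : (φ.size + 2) ^ 3 ≤ (2 * (φ.size + 1)) ^ 3 := Nat.pow_le_pow_left (by omega) 3
    have h₁₀ : (φ.size + 1) ^ 3 ≤ (φ.size + 1) ^ 4 := Nat.pow_le_pow_right (by omega) (by omega)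
    rw [mul_pow] at h₈ h₉
    have h₁₁ : ((φ.size + 1) ^ 2) ^ 2 = (φ.size + 1) ^ 4 := by ring
    rw [h₁₁] at h₈
    linarith
  have hMk : (((TreeWidthSat.sz (TreeWidthSat.toInput φ D) + 40 * (φ.size + 2) ^ 3) ^ k : ℕ) : ℝ) ≤
      ((10 * (K + 2) ^ 2 + 320) ^ k : ℕ) * ((φ.size : ℝ) + 1) ^ (4 * k) := by
    have := Nat.pow_le_pow_left hM k
    rw [mul_pow, ← pow_mul] at this
    exact_mod_cast this
  have hsize : (1 : ℝ) ≤ (φ.size : ℝ) + 1 := by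
    have : (0 : ℝ) ≤ φ.size := Nat.cast_nonneg _
    linarith
  refine ⟨y, t, s, hrun, hsat, ?_, ?_⟩
  · have h₅ : ((2 ^ (3 * m * κ) : ℕ) : ℝ) ≤ (2 : ℝ) ^ ε' * (2 : ℝ) ^ (ε' * (D.width : ℝ)) := by
      rw [← Real.rpow_add (by norm_num), Nat.cast_pow, Nat.cast_ofNat, ← Real.rpow_natCast]
      refine Real.rpow_le_rpow_of_exponent_le (by norm_num) ?_
      have h₆ : ((q : ℝ) + 1) * m ≤ D.width + 1 := by exact_mod_cast h₃.trans h₂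
      have h₇ : (0 : ℝ) ≤ m := Nat.cast_nonneg _
      have h₈ := mul_le_mul_of_nonneg_right hqε h₇
      have h₉ := mul_le_mul_of_nonneg_left h₆ hε'.le
      have h₁₀ := mul_nonneg hε'.le h₇
      push_cast
      linarith
    have h₆ : (2 : ℝ) ^ ε' ≤ b := (le_max_left _ _).trans hb
    calc (s : ℝ) ≤ (((TreeWidthSat.sz (TreeWidthSat.toInput φ D) + 40 * (φ.size + 2) ^ 3) ^ k : ℕ) : ℝ)
          * ((2 ^ (3 * m * κ) : ℕ) : ℝ) := by exact_mod_cast hs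
      _ ≤ (((10 * (K + 2) ^ 2 + 320) ^ k : ℕ) * ((φ.size : ℝ) + 1) ^ (4 * k)) *
          (b * (2 : ℝ) ^ (ε' * (D.width : ℝ))) := by
        refine mul_le_mul hMk (h₅.trans ?_) (by positivity) (by positivity)
        gcongr
      _ ≤ (((10 * (K + 2) ^ 2 + 320) ^ k : ℕ) * ((φ.size : ℝ) + 1) ^ (4 * k + 6)) *
          (b * (2 : ℝ) ^ (ε' * (D.width : ℝ))) := by
        gcongr
        omega
      _ = _ := by push_cast; ring
  · have hw₀ : (0 : ℝ) ≤ (D.width : ℝ) * Real.logb 2 (φ.size : ℝ) := by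
      refine mul_nonneg (Nat.cast_nonneg _) ?_
      rcases Nat.eq_zero_or_pos φ.size with h | h
      · simp [h]
      · exact Real.logb_nonneg (by norm_num) (by exact_mod_cast h)
    obtain ⟨θ, hθ₁, hθ₂, hθ₃⟩ : ∃ θ : ℝ, θ ≤ 1 ∧ (h₀ : ℝ) ≤ θ * D.width + 2 ∧
        (2 : ℝ) ^ ((θ + η) * D.width * Real.logb 2 (φ.size : ℝ)) ≤
          (D.base : ℝ) ^ ((1 - η) * (D.width : ℝ) * Real.logb 2 (φ.size : ℝ)) := by
      by_cases hp : TreeWidthSat.inputPath (TreeWidthSat.toInput φ D) = true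
      -- Rounding `m` down and passing from bag size to width cost at most one vertex each, which is
      -- the `+ 2`.
      · refine ⟨1 - 2 * η, by linarith, ?_, ?_⟩
        · have h₅ : (w : ℝ) < (q + 1) * (m + 1) := by exact_mod_cast h₄ hp
          have h₆ : (h₀ : ℝ) + m = w := by exact_mod_cast h₁
          have h₇ : (w : ℝ) ≤ D.width + 1 := by exact_mod_cast h₂
          have h₈ : 2 * η * (q + 1) = 1 := by rw [hη]; field_simp
          have h₉ : 2 * η * w ≤ m + 1 := by
            have := mul_le_mul_of_nonneg_left h₅.le (show 0 ≤ 2 * η by linarith)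
            rw [← mul_assoc, h₈] at this
            linarith
          have h₁₀ : (1 - 2 * η) * w ≤ (1 - 2 * η) * (D.width + 1) :=
            mul_le_mul_of_nonneg_left h₇ (by linarith)
          linarith
        · have h₅ : (2 : ℝ) ≤ D.base := by
            exact_mod_cast le_max_left 2 _
          rw [show 1 - 2 * η + η = 1 - η by ring]
          refine Real.rpow_le_rpow (by norm_num) h₅ ?_
          rw [mul_assoc]
          exact mul_nonneg (by linarith) hw₀
      -- Nothing is tabulated here; the gain is that the base is 3 while the branching is binary.
      · refine ⟨1, le_rfl, ?_, ?_⟩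
        · have : h₀ ≤ D.width + 2 := by omega
          rw [one_mul]
          exact_mod_cast this
        · rw [TreeWidthSat.base_eq_three D hD.1 hp, mul_assoc, mul_assoc]
          exact TreeWidthSat.two_rpow_le_three_rpow (by linarith) (by linarith) hw₀
    have h₅ := TreeWidthSat.steps_le (m := m) (κ := κ) hη₀ hθ₁ hwn hθ₂ (by omega) hR
    rw [← ha] at h₅
    have h₆ : a ≤ b := (le_max_right _ _).trans hb
    calc (t : ℝ) ≤ (((TreeWidthSat.sz (TreeWidthSat.toInput φ D) + 40 * (φ.size + 2) ^ 3) ^ k : ℕ) : ℝ)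
          * (((R + 1) * 2 ^ (3 * m * κ) : ℕ) : ℝ) := by
          rw [← Nat.cast_mul]
          exact_mod_cast ht.trans (le_of_eq (by ring))
      _ ≤ (((10 * (K + 2) ^ 2 + 320) ^ k : ℕ) * ((φ.size : ℝ) + 1) ^ (4 * k)) *
          (b * ((φ.size : ℝ) + 1) ^ 6 *
            (D.base : ℝ) ^ ((1 - η) * (D.width : ℝ) * Real.logb 2 (φ.size : ℝ))) := by
        refine mul_le_mul hMk (h₅.trans ?_) (by positivity) (by positivity)
        gcongr
      _ = _ := by push_cast; ring
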